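/- **Setting.** A *model* consists of a probability distribution $\Pr$ over a finite set $\bm X=\{X_1,\dots,X_n\}$ of binary random variables, a subset $\bm Y\subseteq\bm X$, a list of blocks of variables of $\bm Y$, and an arbitrary representation of the model as data. Put $\bm Z=\bm X\setminus\bm Y$. Consider a family of models. An algorithm is a single program that works for all models of the family; it gets as input the representation of the model, $n$, and the list of blocks of $\bm Y$, together with the further input named below. It is *efficient* if its running time (including writing the output) is at most $q(n)$, $n=|\bm X|$, for one polynomial $q$. Programs work on trees of numbers with exact $+,-,\times,/$ and comparison; the theorem holds both when real numbers are allowed and each such operation has unit cost, and when numbers are rational and each operation costs the bit length of its operands. A *decomposition* of a set $\bm S$ of variables is a partition of $\bm S$ into nonempty (ordered) blocks $\bm S_1,\dots,\bm S_k$; its width is $\max_l|\bm S_l|$. Let $\bm y$ be an assignment to variables outside $\bm S$. The decomposition is *exchangeable given $\bm y$* if all blocks have the same size and $$\Pr(\bm y,\bm S_1=\bm s_1,\dots,\bm S_k=\bm s_k)=\Pr(\bm y,\bm S_1=\bm s_{\pi(1)},\dots,\bm S_k=\bm s_{\pi(k)})$$ for all $\bm s_1,\dots,\bm s_k$ and all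 permutations $\pi$ of $\{1,\dots,k\}$ (variables that do not occur are summed out). It is *independent given $\bm y$ with factors $Q_1,\dots,Q_k$* if, as a function of the assignment to $\bm S$, $\Pr(\bm y,\bm S)=c\prod_{l=1}^k Q_l(\bm S_l)$ for a constant $c$ (for example $c=1$, or $c=\Pr(\bm y)$ if $\prod_l Q_l$ is the conditional distribution $\Pr(\bm S\mid\bm y)$). **Theorem.** Suppose that for some constant $w$, for all models of the family: 1. (marginal exchangeability) the given blocks form an exchangeable decomposition of $\bm Y$ (given the empty assignment) of width at most $w$; 2. (conditional decomposability) either (a) for each assignment $\bm y$ to $\bm Y$ there is a decomposition $\mathcal Z_{\bm y}$ of $\bm Z$ that is exchangeable given $\bm y$ and has width at most $w$, and $\mathcal Z_{\bm y}$ can be computed efficiently from $\bm y$; or (b) for each assignment $\bm y$ to $\bm Y$ there is a decomposition $\mathcal Z_{\bm y}$ of $\bm Z$ that is independent given $\bm y$ and has width at most $w$, $\mathcal Z_{\bm y}$ can be computed efficiently from $\bm y$, and the values of its factors $Q_l(\bm z_l)$ can be computed efficiently from $\bm y$, $l$ and $\bm z_l$ (the same case, (a) or (b), for the whole family); 3.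 $\Pr(\bm x)$ can be computed efficiently from the full assignment $\bm x$. Then MPE and marginal inference over $\bm Y$ are solvable in time polynomial in $|\bm X|$: there are efficient algorithms which, given any assignment $\bm e$ to a subset $\bm E\subseteq\bm Y$, return, respectively, an assignment $\bm y$ to $\bm Y$ that agrees with $\bm e$ and maximizes $\Pr(\bm y)$ among all such assignments, and the probability $\Pr(\bm e)$. -/

import Mathlib

namespace ExchInference

/-! ### Machine model: programs, evaluation, running time -/

/-- Two ways of charging for exact arithmetic: `unit` is the real-number model (every real number
is one memory cell, every arithmetic operation and comparison costs a constant), `bit` is the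
bit model (only rational numbers can be handled, an operation costs the bit length of its
operands). -/
inductive CostModel where
  | unit
  | bit

/-- Number of binary digits in the reduced fraction `q`. -/
def ratBits (q : ℚ) : ℕ := Nat.size q.num.natAbs + Nat.size q.den

/-- Size of a number. In the bit model an irrational number has size `⊤` (an infimum over the
empty set), so that no operation can be performed on it. -/
noncomputable def CostModel.numSize : CostModel → ℝ → ℕ∞
  | .unit, _ => 1
  | .bit, r => ⨅ (q : ℚ) (_ : (q : ℝ) = r), (ratBits q : ℕ∞)

/-- Data: binary trees whose leaves are numbers. -/
inductive Val where
  | num (r : ℝ)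
  | pair (u v : Val)

/-- Size of a piece of data. -/
noncomputable def Val.size (C : CostModel) : Val → ℕ∞
  | .num r => C.numSize r + 1
  | .pair u v => u.size C + v.size C + 1

inductive ArithOp where
  | add
  | sub
  | mul
  | div
  | lt

open Classical in
/-- Meaning of the arithmetic operations; a comparison returns `1` (true) or `0` (false). -/
noncomputable def ArithOp.apply : ArithOp → ℝ → ℝ → ℝ
  | .add, a, b => a + b
  | .sub, a, b => a - b
  | .mul, a, b => a * b
  | .div, a, b => a / b
  | .lt, a, b => if a < b then 1 else 0

/-- Programs; each maps data to data. `seq p q` runs `p` and then `q` on the result,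
`mk p q` runs both on the input and pairs the results, `ite c p q` is a conditional, and
`loop c p` is the loop: while `c` returns `1` on the current value, replace it by its image
under `p`. -/
inductive Prog where
  | ident
  | const (k : ℤ)
  | fst
  | snd
  | isPair
  | arith (op : ArithOp)
  | mk (p q : Prog)
  | seq (p q : Prog)
  | ite (c p q : Prog)
  | loop (c p : Prog)

/-- `Eval C p v u t`: on input `v` the program `p` halts with output `u` after `t` steps, where
structural operations take one step and arithmetic is charged according to `C`. -/
inductive Eval (C : CostModel) : Prog → Val → Val → ℕ → Prop
  | ident (v : Val) : Eval C .ident v v 1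
  | const (k : ℤ) (v : Val) (s : ℕ) (hs : C.numSize (k : ℝ) = (s : ℕ∞)) :
      Eval C (.const k) v (.num (k : ℝ)) (s + 1)
  | fst (u v : Val) : Eval C .fst (.pair u v) u 1
  | snd (u v : Val) : Eval C .snd (.pair u v) v 1
  | isPair_num (r : ℝ) : Eval C .isPair (.num r) (.num 0) 1
  | isPair_pair (u v : Val) : Eval C .isPair (.pair u v) (.num 1) 1
  | arith (op : ArithOp) (a b : ℝ) (s t : ℕ) (hs : C.numSize a = (s : ℕ∞))
      (ht : C.numSize b = (t : ℕ∞)) :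
      Eval C (.arith op) (.pair (.num a) (.num b)) (.num (op.apply a b)) (s + t + 1)
  | mk {p q : Prog} {v a b : Val} {s t : ℕ} (hp : Eval C p v a s) (hq : Eval C q v b t) :
      Eval C (.mk p q) v (.pair a b) (s + t + 1)
  | seq {p q : Prog} {v a b : Val} {s t : ℕ} (hp : Eval C p v a s) (hq : Eval C q a b t) :
      Eval C (.seq p q) v b (s + t + 1)
  | ite_true {c p q : Prog} {v a : Val} {s t : ℕ} (hc : Eval C c v (.num 1) s)
      (hp : Eval C p v a t) : Eval C (.ite c p q) v a (s + t + 1)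
  | ite_false {c p q : Prog} {v a : Val} {s t : ℕ} (hc : Eval C c v (.num 0) s)
      (hq : Eval C q v a t) : Eval C (.ite c p q) v a (s + t + 1)
  | loop_done {c p : Prog} {v : Val} {s : ℕ} (hc : Eval C c v (.num 0) s) :
      Eval C (.loop c p) v v (s + 1)
  | loop_step {c p : Prog} {v v' u : Val} {s t r : ℕ} (hc : Eval C c v (.num 1) s)
      (hp : Eval C p v v' t) (hl : Eval C (.loop c p) v' u r) :
      Eval C (.loop c p) v u (s + t + r + 1)

/-- The computational problem with instances `a : α`, where `input a` is the input and `spec a`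
the set of correct outputs, is solved by one program in time polynomial in `size a`.
The running time includes the time for writing down the output. -/
def PolyTime (C : CostModel) {α : Type*} (size : α → ℕ) (input : α → Val)
    (spec : α → Val → Prop) : Prop :=
  ∃ (p : Prog) (q : Polynomial ℕ), ∀ a : α, ∃ (out : Val) (t s : ℕ),
    spec a out ∧ Eval C p (input a) out t ∧ out.size C = (s : ℕ∞) ∧ t + s ≤ q.eval (size a)

/-! ### Distributions over binary variables -/

/-- Full joint assignments to `X_0, …, X_{n-1}`. -/
abbrev Assignment (n : ℕ) : Type := Fin n → Bool

/-- Partial assignments (evidence); `none` marks an unassigned variable. -/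
abbrev Evidence (n : ℕ) : Type := Fin n → Option Bool

/-- The set of assigned variables. -/
def Evidence.dom {n : ℕ} (e : Evidence n) : Finset (Fin n) :=
  Finset.univ.filter fun i => (e i).isSome = true

/-- The empty partial assignment. -/
def Evidence.empty (n : ℕ) : Evidence n := fun _ => none

/-- `x` agrees with `e` on the variables assigned by `e`. -/
abbrev Agrees {n : ℕ} (x : Assignment n) (e : Evidence n) : Prop :=
  ∀ i, e i = none ∨ e i = some (x i)

/-- `y` assigns all variables that `e` assigns, with the same values. -/
def Extends {n : ℕ} (y e : Evidence n) : Prop :=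
  ∀ i, e i = none ∨ e i = y i

/-- The part of `x` on the variables in `S`. -/
def restrict {n : ℕ} (x : Assignment n) (S : Finset (Fin n)) : Evidence n :=
  fun i => if i ∈ S then some (x i) else none

/-- `Pr(e)` for a joint distribution with probability table `prob`. -/
def prEv {n : ℕ} (prob : Assignment n → ℝ) (e : Evidence n) : ℝ :=
  ∑ x : Assignment n with Agrees x e, prob x

/-! ### Variable decompositions -/

/-- A list of blocks, each block listing its variables in an order. -/
abbrev Blocks (n : ℕ) : Type := List (List (Fin n))

/-- `D` partitions `S` into nonempty blocks. -/
def IsDecomposition {n : ℕ} (S : Finset (Fin n)) (D : Blocks n) : Prop :=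
  D.flatten.Nodup ∧ D.flatten.toFinset = S ∧ ∀ B ∈ D, B ≠ []

/-- Every block has at most `w` variables. -/
def WidthLE {n : ℕ} (D : Blocks n) (w : ℕ) : Prop :=
  ∀ B ∈ D, B.length ≤ w

/-- `D` is an exchangeable decomposition of `S` given the assignment `y`: its blocks have equal
size and `Pr(y, S₁ = x₁, …, S_k = x_k) = Pr(y, S₁ = x_{π 1}, …, S_k = x_{π k})` for all
permutations `π` of the blocks. Variables outside `y` and `S` are summed out. -/
def IsExchangeableGiven {n : ℕ} (prob : Assignment n → ℝ) (y : Evidence n) (S : Finset (Fin n))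
    (D : Blocks n) : Prop :=
  IsDecomposition S D ∧
  (∀ B ∈ D, ∀ B' ∈ D, B.length = B'.length) ∧
  ∀ (π : Equiv.Perm (Fin D.length)) (x x' : Assignment n), Agrees x y → Agrees x' y →
    (∀ l, (D.get l).map x' = (D.get (π l)).map x) →
    prEv prob (restrict x' (y.dom ∪ S)) = prEv prob (restrict x (y.dom ∪ S))

/-- `D` is an independent decomposition of `S` given `y` with factors `Q 0, …, Q (k-1)`: on the
assignments that agree with `y`, `Pr(y, S)` is proportional to `∏_l Q_l(S_l)`. The constant
is `1` when the factors multiply to `Pr(y, S)`, and it is `Pr(y)` when they multiply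
to the conditional distribution `Pr(S | y)`. -/
def IsIndependentGiven {n : ℕ} (prob : Assignment n → ℝ) (y : Evidence n) (S : Finset (Fin n))
    (D : Blocks n) (Q : Fin D.length → List Bool → ℝ) : Prop :=
  IsDecomposition S D ∧
  ∃ c : ℝ, ∀ x : Assignment n, Agrees x y →
    prEv prob (restrict x (y.dom ∪ S)) = c * ∏ l, Q l ((D.get l).map x)

/-! ### Encodings as data -/

/-- Lists as right-nested pairs that end in `0`. -/
def encList {α : Type*} (enc : α → Val) : List α → Val
  | [] => .num 0
  | a :: l => .pair (enc a) (encList enc l)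

def encNat (k : ℕ) : Val := .num (k : ℝ)

def encBool (b : Bool) : Val := .num (if b then 1 else 0)

def encOptBool : Option Bool → Val
  | none => .num 2
  | some b => encBool b

/-- A full assignment is the list of its `n` values. -/
def encAssignment {n : ℕ} (x : Assignment n) : Val := encList encBool (List.ofFn x)

/-- A partial assignment is a list of length `n`, with `2` at unassigned positions. -/
def encEvidence {n : ℕ} (e : Evidence n) : Val := encList encOptBool (List.ofFn e)

def encBlocks {n : ℕ} (D : Blocks n) : Val :=
  encList (encList fun i : Fin n => encNat (i : ℕ)) D

/-! ### Families of models and inference problems -/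

/-- A probabilistic model: a distribution `Pr` over `n` binary variables `X`, a distinguished
set `Y ⊆ X`, a given list of blocks of variables in `Y`, and a representation of the model
(of any kind) as data. -/
structure Model where
  n : ℕ
  prob : Assignment n → ℝ
  prob_mem : prob ∈ stdSimplex ℝ (Assignment n)
  Y : Finset (Fin n)
  blocksY : Blocks n
  code : Val

/-- `Z = X \ Y`. -/
def Model.Z (M : Model) : Finset (Fin M.n) := Finset.univ \ M.Y

/-- What a program gets to see of a model. -/
def Model.input (M : Model) : Val :=
  .pair M.code (.pair (encNat M.n) (encBlocks M.blocksY))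

/-- The given blocks form a marginally exchangeable decomposition of `Y`, of bounded width. -/
def MarginallyExchangeableBdd {ι : Type*} (F : ι → Model) : Prop :=
  ∃ w : ℕ, ∀ i, IsExchangeableGiven (F i).prob (Evidence.empty (F i).n) (F i).Y (F i).blocksY ∧
    WidthLE (F i).blocksY w

/-- A model of the family together with an assignment to all of its variables `Y`. -/
abbrev YAssignment {ι : Type*} (F : ι → Model) : Type _ :=
  Σ i, {y : Evidence (F i).n // y.dom = (F i).Y}

/-- `Z` is efficiently exchangeably decomposable given `Y`, with bounded width. -/
def EffExchangeablyDecomposable (C : CostModel) {ι : Type*} (F : ι → Model) : Prop :=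
  ∃ (w : ℕ) (D : (a : YAssignment F) → Blocks (F a.1).n),
    (∀ a : YAssignment F, IsExchangeableGiven (F a.1).prob a.2.1 (F a.1).Z (D a) ∧
      WidthLE (D a) w) ∧
    PolyTime C (fun a : YAssignment F => (F a.1).n)
      (fun a => .pair (F a.1).input (encEvidence a.2.1))
      (fun a out => out = encBlocks (D a))

/-- `Z` is efficiently independently decomposable given `Y`, with bounded width: the decomposition
and, for each block, the values of its factor can be computed in polynomial time. -/
def EffIndependentlyDecomposable (C : CostModel) {ι : Type*} (F : ι → Model) : Prop :=
  ∃ (w : ℕ) (D : (a : YAssignment F) → Blocks (F a.1).n)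
    (Q : (a : YAssignment F) → Fin (D a).length → List Bool → ℝ),
    (∀ a : YAssignment F, IsIndependentGiven (F a.1).prob a.2.1 (F a.1).Z (D a) (Q a) ∧
      WidthLE (D a) w) ∧
    PolyTime C (fun a : YAssignment F => (F a.1).n)
      (fun a => .pair (F a.1).input (encEvidence a.2.1))
      (fun a out => out = encBlocks (D a)) ∧
    PolyTime C
      (fun a : (Σ a : YAssignment F, Σ l : Fin (D a).length,
        {b : List Bool // b.length = ((D a).get l).length}) => (F a.1.1).n)
      (fun a => .pair (.pair (F a.1.1).input (encEvidence a.1.2.1))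
        (.pair (encNat (a.2.1 : ℕ)) (encList encBool a.2.2.1)))
      (fun a out => out = .num (Q a.1 a.2.1 a.2.2.1))

/-- `Pr(x)` can be computed efficiently. -/
def EffProb (C : CostModel) {ι : Type*} (F : ι → Model) : Prop :=
  PolyTime C (fun a : (Σ i, Assignment (F i).n) => (F a.1).n)
    (fun a => .pair (F a.1).input (encAssignment a.2))
    (fun a out => out = .num ((F a.1).prob a.2))

/-- A model of the family together with evidence on some of its variables `Y`. -/
abbrev YEvidence {ι : Type*} (F : ι → Model) : Type _ :=
  Σ i, {e : Evidence (F i).n // e.dom ⊆ (F i).Y}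

/-- MPE inference over `Y` in time polynomial in `|X|`: given evidence `e` on variables in `Y`,
find an assignment to `Y` that extends `e` and has maximal probability. -/
def MPEPolyTime (C : CostModel) {ι : Type*} (F : ι → Model) : Prop :=
  PolyTime C (fun a : YEvidence F => (F a.1).n)
    (fun a => .pair (F a.1).input (encEvidence a.2.1))
    (fun a out => ∃ y : Evidence (F a.1).n, y.dom = (F a.1).Y ∧ Extends y a.2.1 ∧
      (∀ y' : Evidence (F a.1).n, y'.dom = (F a.1).Y → Extends y' a.2.1 →
        prEv (F a.1).prob y' ≤ prEv (F a.1).prob y) ∧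
      out = encEvidence y)

/-- Marginal inference over `Y` in time polynomial in `|X|`: given evidence `e` on variables
in `Y`, compute `Pr(e)`. -/
def MarginalPolyTime (C : CostModel) {ι : Type*} (F : ι → Model) : Prop :=
  PolyTime C (fun a : YEvidence F => (F a.1).n)
    (fun a => .pair (F a.1).input (encEvidence a.2.1))
    (fun a out => out = .num (prEv (F a.1).prob a.2.1))

end ExchInference

open ExchInference

/-!
# Tractable inference by exchangeability of variable decompositions

A distribution that is invariant under permutations of `k ≤ n` blocks of at most `w` binary
variables takes only polynomially many values: an assignment matters only through the number of
blocks that carry each of the at most `2 ^ w` patterns. With `N = n + 1` these numbers are the base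
`N` digits of one natural number, the `key` of the assignment, which is the sum over the blocks of
`N ^ m`, where `m` is the number with the values of the block as binary digits. Equal keys yield a
permutation of the blocks (`exists_perm_of_key_eq`), hence equal probabilities, and keys are
at most `n * N ^ 2 ^ w`.

So it suffices to list, for each key that occurs among the completions of given evidence, one
completion and the number of completions. This `orbitTable` is built variable by variable, merging
the rows with equal keys after each block. It is specified by comparison with the table of all
completions, `fullTable`, which is never computed (`Represents`, `orbitTable_spec`). A marginal
probability is the sum of the probabilities of the representatives weighted with the counts
(`marginalPolyTime`), and a most probable explanation is a representative of maximal probability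
(`mpePolyTime`).

Both need the probability of an assignment `y` to `Y`. If `Z` decomposes exchangeably given `y`, the
same table sums out `Z` (`yProbComp_of_exchangeable`). If it decomposes independently, the
distributive law expresses `Pr(y)` as `c * ∏ l, ∑ z, Q l z`, and the unknown constant is recovered
as the quotient of `Pr(y, z)` and `∏ l, Q l (z l)` for an assignment `z` that is put together from
block assignments with nonzero factors (`factorFormula_spec`, `yProbComp_of_independent`).

Running times are treated without writing programs: `Comp C sz i x` says that some program
computes `x a` from the input `i a` in time polynomial in `sz a`, and the closure properties of
this relation (composition, pairing, conditionals, arithmetic, and bounded loops, from which the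
list operations follow) turn the definition of a function into a program. Copying takes one step
whatever the size of the data, so only the operands of arithmetic need bounds on their bit length
(`NumBdd`); a sum or product of polynomially many numbers of polynomial bit length again has
polynomial bit length.
-/

namespace ExchInference

/-! ### Polynomial bounds and bit lengths -/

/-- `f a` is at most a fixed polynomial in `sz a`. -/
def PolyBdd {α : Type*} (sz f : α → ℕ) : Prop :=
  ∃ q : Polynomial ℕ, ∀ a, f a ≤ q.eval (sz a)

namespace PolyBdd

variable {α β : Type*} {sz f g : α → ℕ}

theorem mono (hg : PolyBdd sz g) (h : ∀ a, f a ≤ g a) : PolyBdd sz f :=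
  let ⟨q, hq⟩ := hg
  ⟨q, fun a => (h a).trans (hq a)⟩

theorem const (k : ℕ) : PolyBdd sz fun _ => k := ⟨Polynomial.C k, fun _ => by simp⟩

theorem self : PolyBdd sz sz := ⟨Polynomial.X, fun _ => by simp⟩

theorem add (hf : PolyBdd sz f) (hg : PolyBdd sz g) : PolyBdd sz fun a => f a + g a := by
  obtain ⟨p, hp⟩ := hf
  obtain ⟨q, hq⟩ := hg
  exact ⟨p + q, fun a => by rw [Polynomial.eval_add]; exact add_le_add (hp a) (hq a)⟩

theorem mul (hf : PolyBdd sz f) (hg : PolyBdd sz g) : PolyBdd sz fun a => f a * g a := by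
  obtain ⟨p, hp⟩ := hf
  obtain ⟨q, hq⟩ := hg
  exact ⟨p * q, fun a => by rw [Polynomial.eval_mul]; exact Nat.mul_le_mul (hp a) (hq a)⟩

theorem pow (hf : PolyBdd sz f) (k : ℕ) : PolyBdd sz fun a => f a ^ k := by
  obtain ⟨p, hp⟩ := hf
  exact ⟨p ^ k, fun a => by rw [Polynomial.eval_pow]; exact Nat.pow_le_pow_left (hp a) k⟩

theorem reindex (hf : PolyBdd sz f) (g : β → α) :
    PolyBdd (fun b => sz (g b)) fun b => f (g b) :=
  let ⟨q, hq⟩ := hf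
  ⟨q, fun b => hq (g b)⟩

end PolyBdd

/-- In the bit model: `x` is a fraction whose numerator and denominator are at most `2 ^ B`. -/
def NumLE : CostModel → ℕ → ℝ → Prop
  | .unit, _, _ => True
  | .bit, B, x => ∃ q : ℚ, (q : ℝ) = x ∧ q.num.natAbs ≤ 2 ^ B ∧ q.den ≤ 2 ^ B

namespace NumLE

variable {C : CostModel} {B B' : ℕ} {x y : ℝ}

theorem mono (h : NumLE C B x) (hB : B ≤ B') : NumLE C B' x := by
  cases C with
  | unit => trivial
  | bit =>
    obtain ⟨q, hq, h1, h2⟩ := h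
    have := Nat.pow_le_pow_right (n := 2) (by norm_num) hB
    exact ⟨q, hq, h1.trans this, h2.trans this⟩

theorem natCast {k : ℕ} (h : k ≤ 2 ^ B) : NumLE C B (k : ℝ) := by
  cases C with
  | unit => trivial
  | bit => exact ⟨k, by simp, by simpa using h, by simpa using Nat.one_le_two_pow⟩

theorem intCast {k : ℤ} (h : k.natAbs ≤ 2 ^ B) : NumLE C B (k : ℝ) := by
  cases C with
  | unit => trivial
  | bit => exact ⟨k, by simp, by simpa using h, by simpa using Nat.one_le_two_pow⟩

theorem neg (hx : NumLE C B x) : NumLE C B (-x) := by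
  cases C with
  | unit => trivial
  | bit =>
    obtain ⟨q, rfl, h1, h2⟩ := hx
    exact ⟨-q, by simp, by simpa using h1, by simpa using h2⟩

theorem add (hx : NumLE C B x) (hy : NumLE C B' y) : NumLE C (B + B' + 1) (x + y) := by
  cases C with
  | unit => trivial
  | bit =>
    obtain ⟨q, rfl, h1, h2⟩ := hx
    obtain ⟨r, rfl, h3, h4⟩ := hy
    refine ⟨q + r, by simp, ?_, ?_⟩
    · -- The reduced numerator divides the numerator over the product of the denominators.
      have h5 : (q + r).num.natAbs ≤ (q.num * r.den + r.num * q.den).natAbs := by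
        have h : (q + r).num ∣ q.num * r.den + r.num * q.den := by
          rw [Rat.add_def, Rat.normalize_eq]
          exact Int.ediv_dvd_of_dvd (Int.natCast_dvd.2 (Nat.gcd_dvd_left _ _))
        by_cases h0 : q.num * r.den + r.num * q.den = 0
        · have : q + r = 0 := by rw [Rat.add_def', h0]; simp
          simp [this]
        · exact Nat.le_of_dvd (Int.natAbs_pos.2 h0) (Int.natAbs_dvd_natAbs.2 h)
      refine h5.trans ((Int.natAbs_add_le _ _).trans ?_)
      rw [Int.natAbs_mul, Int.natAbs_mul, Int.natAbs_natCast, Int.natAbs_natCast]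
      calc _ ≤ 2 ^ B * 2 ^ B' + 2 ^ B' * 2 ^ B := by gcongr
        _ = _ := by ring
    · refine (Nat.le_of_dvd (Nat.mul_pos q.den_pos r.den_pos) (Rat.add_den_dvd q r)).trans ?_
      calc _ ≤ 2 ^ B * 2 ^ B' := by gcongr
        _ ≤ _ := by rw [← pow_add]; exact Nat.pow_le_pow_right (by norm_num) (by omega)

theorem mul (hx : NumLE C B x) (hy : NumLE C B' y) : NumLE C (B + B') (x * y) := by
  cases C with
  | unit => trivial
  | bit =>
    obtain ⟨q, rfl, h1, h2⟩ := hx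
    obtain ⟨r, rfl, h3, h4⟩ := hy
    refine ⟨q * r, by simp, ?_, ?_⟩
    · rw [Rat.num_mul]
      refine (Int.natAbs_ediv_le_natAbs _ _).trans ?_
      rw [Int.natAbs_mul, pow_add]
      gcongr
    · rw [Rat.den_mul, pow_add]
      refine (Nat.div_le_self _ _).trans ?_
      gcongr

theorem inv (hx : NumLE C B x) : NumLE C B x⁻¹ := by
  cases C with
  | unit => trivial
  | bit =>
    obtain ⟨q, rfl, h1, h2⟩ := hx
    refine ⟨q⁻¹, by simp, ?_, ?_⟩
    · rw [Rat.num_inv, Int.natAbs_mul, Int.natAbs_natCast]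
      refine le_trans ?_ h2
      refine (Nat.mul_le_mul_right _ (?_ : _ ≤ 1)).trans (by simp)
      rw [Int.natAbs_sign]
      split_ifs <;> simp
    · rw [Rat.den_inv]
      split_ifs
      · exact Nat.one_le_two_pow
      · exact h1

/-- This includes division by zero, whose value is `0`. -/
theorem div (hx : NumLE C B x) (hy : NumLE C B' y) : NumLE C (B + B') (x / y) := by
  rw [div_eq_mul_inv]
  exact hx.mul hy.inv

theorem list_sum {L : List ℝ} (h : ∀ x ∈ L, NumLE C B x) :
    NumLE C (L.length * (B + 1)) L.sum := by
  induction L with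
  | nil => simpa using natCast (C := C) (B := 0) (k := 0) (by simp)
  | cons a L ih =>
    rw [List.sum_cons, List.length_cons]
    exact ((h a (by simp)).add (ih fun x hx => h x (by simp [hx]))).mono
      (le_of_eq (by ring))

theorem list_prod {L : List ℝ} (h : ∀ x ∈ L, NumLE C B x) :
    NumLE C (L.length * B) L.prod := by
  induction L with
  | nil => simpa using natCast (C := C) (B := 0) (k := 1) (by simp)
  | cons a L ih =>
    rw [List.prod_cons, List.length_cons]
    exact ((h a (by simp)).mul (ih fun x hx => h x (by simp [hx]))).mono
      (le_of_eq (by ring))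

/-- Numbers of bounded bit length have a finite size, so that operations on them are charged
linearly in the bit length. -/
theorem exists_numSize_eq (h : NumLE C B x) : ∃ s : ℕ, C.numSize x = s ∧ s ≤ 2 * B + 2 := by
  cases C with
  | unit => exact ⟨1, rfl, by omega⟩
  | bit =>
    obtain ⟨q, rfl, h1, h2⟩ := h
    have hs : ∀ {m : ℕ}, m ≤ 2 ^ B → Nat.size m ≤ B + 1 := fun hm =>
      Nat.size_le.2 (hm.trans_lt (Nat.pow_lt_pow_right (by norm_num) (by omega)))
    refine ⟨ratBits q, ?_, ?_⟩
    · refine le_antisymm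
        (iInf₂_le (f := fun (r : ℚ) (_ : (r : ℝ) = (q : ℝ)) => (ratBits r : ℕ∞)) q rfl)
        (le_iInf₂ fun r hr => ?_)
      rw [Rat.cast_inj.1 hr]
    · have := hs h1
      have := hs h2
      unfold ratBits
      omega

/-- Conversely, a number that has been written down within a time bound has bounded bit length. -/
theorem of_numSize_le {s : ℕ} (h : C.numSize x ≤ s) : NumLE C s x := by
  cases C with
  | unit => trivial
  | bit =>
    -- An irrational number has size `⊤`.
    have hex : ∃ q : ℚ, (q : ℝ) = x := by
      by_contra hne
      push Not at hne
      have : CostModel.bit.numSize x = ⊤ := by simp [CostModel.numSize, hne]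
      rw [this] at h
      exact absurd h (by simp)
    obtain ⟨q, rfl⟩ := hex
    have hb : ratBits q ≤ s := by
      have : ((ratBits q : ℕ) : ℕ∞) ≤ CostModel.bit.numSize q :=
        le_iInf₂ fun r hr => by rw [Rat.cast_inj.1 hr]
      exact_mod_cast this.trans h
    have hs : ∀ m : ℕ, Nat.size m ≤ s → m ≤ 2 ^ s := fun m hm => (Nat.size_le.1 hm).le
    unfold ratBits at hb
    exact ⟨q, rfl, hs _ (by omega), hs _ (by omega)⟩

end NumLE

/-- The numbers `x a` have bit length polynomial in `sz a`. -/
def NumBdd (C : CostModel) {α : Type*} (sz : α → ℕ) (x : α → ℝ) : Prop :=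
  ∃ B : α → ℕ, PolyBdd sz B ∧ ∀ a, NumLE C (B a) (x a)

/-- The entries of the lists `L a` have bit length polynomial in `sz a`. -/
def ListNumBdd (C : CostModel) {α : Type*} (sz : α → ℕ) (L : α → List ℝ) : Prop :=
  ∃ B : α → ℕ, PolyBdd sz B ∧ ∀ a, ∀ x ∈ L a, NumLE C (B a) x

namespace NumBdd

variable {C : CostModel} {α β : Type*} {sz : α → ℕ} {x y : α → ℝ}

theorem of_polyBdd {k : α → ℕ} (h : PolyBdd sz k) : NumBdd C sz fun a => (k a : ℝ) :=
  ⟨k, h, fun _ => NumLE.natCast Nat.lt_two_pow_self.le⟩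

theorem mul (hx : NumBdd C sz x) (hy : NumBdd C sz y) : NumBdd C sz fun a => x a * y a :=
  let ⟨_, h1, h2⟩ := hx
  let ⟨_, h3, h4⟩ := hy
  ⟨_, h1.add h3, fun a => (h2 a).mul (h4 a)⟩

theorem div (hx : NumBdd C sz x) (hy : NumBdd C sz y) : NumBdd C sz fun a => x a / y a :=
  let ⟨_, h1, h2⟩ := hx
  let ⟨_, h3, h4⟩ := hy
  ⟨_, h1.add h3, fun a => (h2 a).div (h4 a)⟩

theorem list_sum {L : α → List ℝ} (hl : PolyBdd sz fun a => (L a).length)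
    (h : ListNumBdd C sz L) : NumBdd C sz fun a => (L a).sum :=
  let ⟨_, h1, h2⟩ := h
  ⟨_, hl.mul (h1.add (.const 1)), fun a => NumLE.list_sum (h2 a)⟩

theorem list_prod {L : α → List ℝ} (hl : PolyBdd sz fun a => (L a).length)
    (h : ListNumBdd C sz L) : NumBdd C sz fun a => (L a).prod :=
  let ⟨_, h1, h2⟩ := h
  ⟨_, hl.mul h1, fun a => NumLE.list_prod (h2 a)⟩

theorem reindex (hx : NumBdd C sz x) (g : β → α) :
    NumBdd C (fun b => sz (g b)) fun b => x (g b) :=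
  let ⟨B, h1, h2⟩ := hx
  ⟨fun b => B (g b), h1.reindex g, fun b => h2 (g b)⟩

end NumBdd

/-! ### Functions computed by one program in polynomial time -/

/-- Types whose elements are represented as data. -/
class Enc (τ : Type*) where
  enc : τ → Val

instance : Enc Val := ⟨id⟩
instance : Enc ℝ := ⟨Val.num⟩
instance : Enc ℕ := ⟨encNat⟩
instance : Enc Bool := ⟨encBool⟩
instance {τ σ : Type*} [Enc τ] [Enc σ] : Enc (τ × σ) := ⟨fun x => .pair (Enc.enc x.1) (Enc.enc x.2)⟩
instance {τ : Type*} [Enc τ] : Enc (List τ) := ⟨encList Enc.enc⟩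

open Enc

/-- One program computes `x a` from the data `i a`, in time polynomial in `sz a`. The size of the
result is not restricted: copying data of any size takes one step. -/
def Comp (C : CostModel) {α : Type*} (sz : α → ℕ) (i : α → Val) {τ : Type*} [Enc τ]
    (x : α → τ) : Prop :=
  ∃ (p : Prog) (q : Polynomial ℕ), ∀ a, ∃ t, t ≤ q.eval (sz a) ∧ Eval C p (i a) (enc (x a)) t

namespace Comp

variable {C : CostModel} {α β : Type*} {sz : α → ℕ} {i : α → Val}
variable {τ σ ρ : Type*} [Enc τ] [Enc σ] [Enc ρ]

theorem id : Comp C sz i i :=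
  ⟨.ident, 1, fun _ => ⟨1, by simp, .ident _⟩⟩

theorem toVal {x : α → τ} (h : Comp C sz i x) : Comp C sz i fun a => enc (x a) := h

theorem congr {x y : α → τ} (h : Comp C sz i x) (e : ∀ a, x a = y a) : Comp C sz i y := by
  rwa [← funext e]

/-- Functions with the same encoded values are interchangeable. -/
theorem cast {x : α → τ} {y : α → σ} (h : Comp C sz i x) (e : ∀ a, enc (x a) = enc (y a)) :
    Comp C sz i y :=
  let ⟨p, q, H⟩ := h
  ⟨p, q, fun a => e a ▸ H a⟩

theorem comp {v : α → Val} {x : α → τ} (hx : Comp C sz v x) (hv : Comp C sz i v) :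
    Comp C sz i x := by
  obtain ⟨p, q, h⟩ := hv
  obtain ⟨p', q', h'⟩ := hx
  refine ⟨.seq p p', q + q' + 1, fun a => ?_⟩
  obtain ⟨t, ht, e⟩ := h a
  obtain ⟨t', ht', e'⟩ := h' a
  refine ⟨_, ?_, .seq e e'⟩
  simp only [Polynomial.eval_add, Polynomial.eval_one]
  omega

theorem reindex {x : α → τ} (hx : Comp C sz i x) (g : β → α) :
    Comp C (fun b => sz (g b)) (fun b => i (g b)) fun b => x (g b) :=
  let ⟨p, q, h⟩ := hx
  ⟨p, q, fun b => h (g b)⟩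

theorem mk {x : α → τ} {y : α → σ} (hx : Comp C sz i x) (hy : Comp C sz i y) :
    Comp C sz i fun a => (x a, y a) := by
  obtain ⟨p, q, h⟩ := hx
  obtain ⟨p', q', h'⟩ := hy
  refine ⟨.mk p p', q + q' + 1, fun a => ?_⟩
  obtain ⟨t, ht, e⟩ := h a
  obtain ⟨t', ht', e'⟩ := h' a
  refine ⟨_, ?_, .mk e e'⟩
  simp only [Polynomial.eval_add, Polynomial.eval_one]
  omega

theorem mkVal {x y : α → Val} (hx : Comp C sz i x) (hy : Comp C sz i y) :
    Comp C sz i fun a => Val.pair (x a) (y a) :=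
  hx.mk hy

theorem fst {x : α → τ × σ} (hx : Comp C sz i x) : Comp C sz i fun a => (x a).1 :=
  comp (v := fun a => enc (x a)) ⟨.fst, 1, fun _ => ⟨1, by simp, .fst _ _⟩⟩ hx

theorem snd {x : α → τ × σ} (hx : Comp C sz i x) : Comp C sz i fun a => (x a).2 :=
  comp (v := fun a => enc (x a)) ⟨.snd, 1, fun _ => ⟨1, by simp, .snd _ _⟩⟩ hx

theorem fstVal {u v : α → Val} (h : Comp C sz i fun a => Val.pair (u a) (v a)) :
    Comp C sz i u := by
  exact fst (x := fun a => (u a, v a)) h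

theorem sndVal {u v : α → Val} (h : Comp C sz i fun a => Val.pair (u a) (v a)) :
    Comp C sz i v := by
  exact snd (x := fun a => (u a, v a)) h

/-- A computation from the first component of the input. -/
theorem env {x : α → τ} (hx : Comp C sz i x) (g : β → α) {v : β → Val} :
    Comp C (fun b => sz (g b)) (fun b => Val.pair (i (g b)) (v b)) fun b => x (g b) :=
  (hx.reindex g).comp (fstVal id)

/-- Extraction of the second component of the input. -/
theorem arg {sz : β → ℕ} {u : β → Val} {v : β → τ} :
    Comp C sz (fun b => Val.pair (u b) (enc (v b))) v :=
  sndVal (v := fun b => enc (v b)) id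

theorem constReal (k : ℤ) : Comp C sz i fun _ => (k : ℝ) := by
  obtain ⟨s, hs, -⟩ := (NumLE.intCast (C := C) (B := k.natAbs) (k := k)
    Nat.lt_two_pow_self.le).exists_numSize_eq
  exact ⟨.const k, Polynomial.C (s + 1), fun a => ⟨s + 1, by simp, .const k _ s hs⟩⟩

theorem constNat (k : ℕ) : Comp C sz i fun _ => k :=
  (constReal (k : ℤ)).cast fun _ => by simp [enc, encNat]

theorem constBool (b : Bool) : Comp C sz i fun _ => b :=
  (constReal (if b then 1 else 0)).cast fun _ => by cases b <;> simp [enc, encBool]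

theorem arith (op : ArithOp) {x y : α → ℝ} (hx : Comp C sz i x) (hy : Comp C sz i y)
    (bx : NumBdd C sz x) (b_y : NumBdd C sz y) : Comp C sz i fun a => op.apply (x a) (y a) := by
  refine comp (v := fun a => enc (x a, y a)) ?_ (hx.mk hy)
  obtain ⟨B, ⟨q, hq⟩, hB⟩ := bx
  obtain ⟨B', ⟨q', hq'⟩, hB'⟩ := b_y
  refine ⟨.arith op, 2 * q + 2 * q' + 5, fun a => ?_⟩
  obtain ⟨s, hs, hs'⟩ := (hB a).exists_numSize_eq
  obtain ⟨t, ht, ht'⟩ := (hB' a).exists_numSize_eq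
  refine ⟨s + t + 1, ?_, .arith op _ _ s t hs ht⟩
  have := hq a
  have := hq' a
  simp only [Polynomial.eval_add, Polynomial.eval_mul, Polynomial.eval_ofNat]
  omega

open Classical in
theorem ltReal {x y : α → ℝ} (hx : Comp C sz i x) (hy : Comp C sz i y)
    (bx : NumBdd C sz x) (b_y : NumBdd C sz y) : Comp C sz i fun a => decide (x a < y a) :=
  (arith .lt hx hy bx b_y).cast fun a => by
    by_cases h : x a < y a <;> simp [enc, encBool, ArithOp.apply, h]

theorem mulReal {x y : α → ℝ} (hx : Comp C sz i x) (hy : Comp C sz i y)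
    (bx : NumBdd C sz x) (b_y : NumBdd C sz y) : Comp C sz i fun a => x a * y a :=
  arith .mul hx hy bx b_y

theorem divReal {x y : α → ℝ} (hx : Comp C sz i x) (hy : Comp C sz i y)
    (bx : NumBdd C sz x) (b_y : NumBdd C sz y) : Comp C sz i fun a => x a / y a :=
  arith .div hx hy bx b_y

theorem addReal {x y : α → ℝ} (hx : Comp C sz i x) (hy : Comp C sz i y)
    (bx : NumBdd C sz x) (b_y : NumBdd C sz y) : Comp C sz i fun a => x a + y a :=
  arith .add hx hy bx b_y

theorem natCast {x : α → ℕ} (hx : Comp C sz i x) : Comp C sz i fun a => (x a : ℝ) := hx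

theorem addNat {x y : α → ℕ} (hx : Comp C sz i x) (hy : Comp C sz i y)
    (bx : NumBdd C sz fun a => (x a : ℝ)) (b_y : NumBdd C sz fun a => (y a : ℝ)) :
    Comp C sz i fun a => x a + y a :=
  (addReal hx.natCast hy.natCast bx b_y).cast fun a => by simp [enc, encNat]

theorem mulNat {x y : α → ℕ} (hx : Comp C sz i x) (hy : Comp C sz i y)
    (bx : NumBdd C sz fun a => (x a : ℝ)) (b_y : NumBdd C sz fun a => (y a : ℝ)) :
    Comp C sz i fun a => x a * y a :=
  (mulReal hx.natCast hy.natCast bx b_y).cast fun a => by simp [enc, encNat]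

/-- A conditional; each branch need only be computed where it is taken. -/
theorem iteSub {c : α → Bool} {x y : α → τ} (hc : Comp C sz i c)
    (hx : Comp C (fun a : {a // c a = true} => sz a.1) (fun a => i a.1) fun a => x a.1)
    (hy : Comp C (fun a : {a // c a = false} => sz a.1) (fun a => i a.1) fun a => y a.1) :
    Comp C sz i fun a => if c a then x a else y a := by
  obtain ⟨p, q, h⟩ := hc
  obtain ⟨p1, q1, h1⟩ := hx
  obtain ⟨p2, q2, h2⟩ := hy
  refine ⟨.ite p p1 p2, q + q1 + q2 + 1, fun a => ?_⟩
  simp only [Polynomial.eval_add, Polynomial.eval_one]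
  obtain ⟨t, ht, e⟩ := h a
  cases hca : c a with
  | true =>
    obtain ⟨t', ht', e'⟩ := h1 ⟨a, hca⟩
    refine ⟨_, ?_, .ite_true (by simpa [hca, enc, encBool] using e) (by simpa using e')⟩
    simp only at ht'
    omega
  | false =>
    obtain ⟨t', ht', e'⟩ := h2 ⟨a, hca⟩
    refine ⟨_, ?_, .ite_false (by simpa [hca, enc, encBool] using e) (by simpa using e')⟩
    simp only at ht'
    omega

theorem ite {c : α → Bool} {x y : α → τ} (hc : Comp C sz i c) (hx : Comp C sz i x)
    (hy : Comp C sz i y) : Comp C sz i fun a => if c a then x a else y a :=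
  iteSub hc (hx.reindex _) (hy.reindex _)

open Classical in
/-- Equality is decided by two comparisons. -/
theorem eqReal {x y : α → ℝ} (hx : Comp C sz i x) (hy : Comp C sz i y)
    (bx : NumBdd C sz x) (b_y : NumBdd C sz y) : Comp C sz i fun a => decide (x a = y a) :=
  (ite (ltReal hx hy bx b_y) (constBool false)
    (ite (ltReal hy hx b_y bx) (constBool false) (constBool true))).congr fun a => by
      rcases lt_trichotomy (x a) (y a) with h | h | h
      · simp [h, h.ne]
      · simp [h]
      · simp [h, h.ne', h.not_gt]

theorem eqNat {x y : α → ℕ} (hx : Comp C sz i x) (hy : Comp C sz i y)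
    (bx : NumBdd C sz fun a => (x a : ℝ)) (b_y : NumBdd C sz fun a => (y a : ℝ)) :
    Comp C sz i fun a => decide (x a = y a) :=
  (eqReal hx.natCast hy.natCast bx b_y).congr fun a => by simp

/-- A loop that runs through the states `S a 0, …, S a (len a)`. -/
theorem loop {S : α → ℕ → Val} {len : α → ℕ} (hlen : PolyBdd sz len)
    (hc : Comp C (fun x : {x : α × ℕ // x.2 ≤ len x.1} => sz x.1.1)
      (fun x => S x.1.1 x.1.2) fun x => decide (x.1.2 < len x.1.1))
    (hb : Comp C (fun x : {x : α × ℕ // x.2 < len x.1} => sz x.1.1)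
      (fun x => S x.1.1 x.1.2) fun x => S x.1.1 (x.1.2 + 1)) :
    Comp C sz (fun a => S a 0) fun a => S a (len a) := by
  obtain ⟨ql, hl⟩ := hlen
  obtain ⟨pc, qc, hc⟩ := hc
  obtain ⟨pb, qb, hb⟩ := hb
  refine ⟨.loop pc pb, ql * (qc + qb + 1) + qc + 1, fun a => ?_⟩
  -- Induction on the number `j` of remaining passes through the loop.
  have key : ∀ j, j ≤ len a → ∃ t, t ≤ j * (qc.eval (sz a) + qb.eval (sz a) + 1) +
      qc.eval (sz a) + 1 ∧ Eval C (.loop pc pb) (S a (len a - j)) (S a (len a)) t := by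
    intro j
    induction j with
    | zero =>
      intro _
      obtain ⟨t, ht, e⟩ := hc ⟨(a, len a), le_rfl⟩
      refine ⟨t + 1, by simpa using ht, ?_⟩
      rw [Nat.sub_zero]
      exact .loop_done (by simpa [enc, encBool] using e)
    | succ j ih =>
      intro hj
      obtain ⟨r, hr, er⟩ := ih (by omega)
      have hlt : len a - (j + 1) < len a := by omega
      obtain ⟨s, hs, es⟩ := hc ⟨(a, len a - (j + 1)), by simp⟩
      obtain ⟨t, ht, et⟩ := hb ⟨(a, len a - (j + 1)), hlt⟩
      have hsucc : len a - (j + 1) + 1 = len a - j := by omega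
      simp only [hlt, decide_true] at es
      simp only [hsucc] at et
      refine ⟨s + t + r + 1, ?_, .loop_step (by simpa [enc, encBool] using es) et er⟩
      simp only at hs ht
      rw [Nat.add_mul]
      omega
  obtain ⟨t, ht, e⟩ := key (len a) le_rfl
  rw [Nat.sub_self] at e
  refine ⟨t, ht.trans ?_, e⟩
  simp only [Polynomial.eval_add, Polynomial.eval_mul, Polynomial.eval_one]
  gcongr
  exact hl a

/-! ### Lists -/

theorem nil : Comp C sz i fun _ => ([] : List τ) :=
  (constNat 0).cast fun _ => by simp [enc, encNat, encList]

theorem cons {x : α → τ} {L : α → List τ} (hx : Comp C sz i x) (hL : Comp C sz i L) :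
    Comp C sz i fun a => x a :: L a :=
  hx.mk hL

/-- A left fold over a list of polynomial length. The body gets the environment `i a`, the
accumulator and the list item, and may use any property `P` of these that holds at every
stage. -/
theorem foldl {L : α → List τ} {init : α → σ} {f : α → σ → τ → σ} (P : α → σ → τ → Prop)
    (hL : Comp C sz i L) (h0 : Comp C sz i init) (hlen : PolyBdd sz fun a => (L a).length)
    (hP : ∀ a k (h : k < (L a).length), P a (((L a).take k).foldl (f a) (init a)) (L a)[k])
    (hf : Comp C (fun x : {x : α × σ × τ // P x.1 x.2.1 x.2.2} => sz x.1.1)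
      (fun x => .pair (i x.1.1) (enc x.1.2)) fun x => f x.1.1 x.1.2.1 x.1.2.2) :
    Comp C sz i fun a => (L a).foldl (f a) (init a) := by
  let acc : α → ℕ → σ := fun a k => ((L a).take k).foldl (f a) (init a)
  -- The state: the environment, the remaining items and the accumulator.
  let S : α → ℕ → Val := fun a k => .pair (i a) (.pair (enc ((L a).drop k)) (enc (acc a k)))
  have hloop : Comp C sz (fun a => S a 0) fun a => S a (L a).length := by
    refine loop hlen ?_ ?_
    · refine comp (v := fun x : {x : α × ℕ // x.2 ≤ (L x.1).length} =>
        enc ((L x.1.1).drop x.1.2)) ?_ (fstVal (sndVal id))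
      refine ⟨.isPair, 1, fun x => ⟨1, by simp, ?_⟩⟩
      dsimp only
      by_cases h : x.1.2 < (L x.1.1).length
      · rw [List.drop_eq_getElem_cons h]
        simpa [enc, encBool, encList, h] using .isPair_pair _ _
      · rw [List.drop_eq_nil_of_le (not_lt.1 h)]
        simpa [enc, encBool, encList, h] using .isPair_num _
    · have hdrop : Comp C (fun x : {x : α × ℕ // x.2 < (L x.1).length} => sz x.1.1)
          (fun x => S x.1.1 x.1.2)
          fun x => ((L x.1.1)[x.1.2]'x.2, (L x.1.1).drop (x.1.2 + 1)) :=
        Comp.cast (x := fun x => enc ((L x.1.1).drop x.1.2)) (fstVal (sndVal id)) fun x => by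
          rw [List.drop_eq_getElem_cons x.2]
          rfl
      refine mkVal (fstVal id) (mkVal hdrop.snd ?_)
      have hbody := hf.reindex fun x : {x : α × ℕ // x.2 < (L x.1).length} =>
        ⟨(x.1.1, acc x.1.1 x.1.2, (L x.1.1)[x.1.2]'x.2), hP x.1.1 x.1.2 x.2⟩
      refine Comp.cast (Comp.comp hbody ?_) fun x => ?_
      · exact mkVal (fstVal id) (mkVal (sndVal (sndVal id)) hdrop.fst)
      · have h : x.1.2 < (L x.1.1).length := x.2
        have : acc x.1.1 (x.1.2 + 1)
            = f x.1.1 (acc x.1.1 x.1.2) ((L x.1.1)[x.1.2]'h) := by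
          simp only [acc, List.take_succ_eq_append_getElem h, List.foldl_append,
            List.foldl_cons, List.foldl_nil]
        rw [this]
        rfl
  have hres := hloop.comp (i := i) (mkVal id (mkVal (x := fun a => enc ((L a).drop 0))
    (by simpa using hL.toVal) (y := fun a => enc (acc a 0)) (by simpa [acc] using h0.toVal)))
  refine (sndVal (sndVal hres)).cast fun a => ?_
  simp [acc, enc]

end Comp

namespace Comp

variable {C : CostModel} {α β : Type*} {sz : α → ℕ} {i : α → Val}
variable {τ σ ρ : Type*} [Enc τ] [Enc σ] [Enc ρ]

/-- A left fold whose body needs to know only that the item is in the list. -/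
theorem foldlMem {L : α → List τ} {init : α → σ} {f : α → σ → τ → σ}
    (hL : Comp C sz i L) (h0 : Comp C sz i init) (hlen : PolyBdd sz fun a => (L a).length)
    (hf : Comp C (fun x : {x : α × σ × τ // x.2.2 ∈ L x.1} => sz x.1.1)
      (fun x => .pair (i x.1.1) (enc x.1.2)) fun x => f x.1.1 x.1.2.1 x.1.2.2) :
    Comp C sz i fun a => (L a).foldl (f a) (init a) :=
  foldl (fun a _ t => t ∈ L a) hL h0 hlen (fun _ _ _ => List.getElem_mem _) hf

theorem reverse {L : α → List τ} (hL : Comp C sz i L)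
    (hlen : PolyBdd sz fun a => (L a).length) : Comp C sz i fun a => (L a).reverse :=
  (foldlMem (f := fun _ acc t => t :: acc) hL nil hlen (cons arg.snd arg.fst)).congr
    fun a => by simp

theorem append {L M : α → List τ} (hL : Comp C sz i L) (hM : Comp C sz i M)
    (hlen : PolyBdd sz fun a => (L a).length) : Comp C sz i fun a => L a ++ M a :=
  (foldlMem (f := fun _ acc t => t :: acc) (hL.reverse hlen) hM (by simpa using hlen)
    (cons arg.snd arg.fst)).congr fun a => by simp

theorem map {L : α → List τ} {f : α → τ → σ} (hL : Comp C sz i L)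
    (hlen : PolyBdd sz fun a => (L a).length)
    (hf : Comp C (fun x : {x : α × τ // x.2 ∈ L x.1} => sz x.1.1)
      (fun x => .pair (i x.1.1) (enc x.1.2)) fun x => f x.1.1 x.1.2) :
    Comp C sz i fun a => (L a).map (f a) := by
  have h : Comp C sz i fun a => (L a).reverse.foldl (fun acc t => f a t :: acc) [] := by
    refine foldlMem (f := fun a acc t => f a t :: acc) (hL.reverse hlen) nil
      (by simpa using hlen) (cons ?_ arg.fst)
    have h1 := hf.reindex fun x : {x : α × List σ × τ // x.2.2 ∈ (L x.1).reverse} =>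
      ⟨(x.1.1, x.1.2.2), by simpa using x.2⟩
    exact comp h1 (mkVal (fstVal id) arg.snd.toVal)
  exact h.congr fun a => by induction L a <;> simp_all

/-- The lists `f a t` need a uniform length bound, since appending takes time linear in the first
list. -/
theorem flatMap {L : α → List τ} {f : α → τ → List σ} (hL : Comp C sz i L)
    (hlen : PolyBdd sz fun a => (L a).length)
    (hflen : ∃ B, PolyBdd sz B ∧ ∀ a, ∀ t ∈ L a, (f a t).length ≤ B a)
    (hf : Comp C (fun x : {x : α × τ // x.2 ∈ L x.1} => sz x.1.1)
      (fun x => .pair (i x.1.1) (enc x.1.2)) fun x => f x.1.1 x.1.2) :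
    Comp C sz i fun a => (L a).flatMap (f a) := by
  have h : Comp C sz i fun a => (L a).reverse.foldl (fun acc t => f a t ++ acc) [] := by
    refine foldlMem (f := fun a acc t => f a t ++ acc) (hL.reverse hlen) nil
      (by simpa using hlen) (append ?_ arg.fst ?_)
    · have h1 := hf.reindex fun x : {x : α × List σ × τ // x.2.2 ∈ (L x.1).reverse} =>
        ⟨(x.1.1, x.1.2.2), by simpa using x.2⟩
      exact comp h1 (mkVal (fstVal id) arg.snd.toVal)
    · obtain ⟨B, hB, hb⟩ := hflen
      exact (hB.reindex _).mono fun x => hb x.1.1 x.1.2.2 (by simpa using x.2)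
  exact h.congr fun a => by induction L a <;> simp_all

theorem any {L : α → List τ} {f : α → τ → Bool} (hL : Comp C sz i L)
    (hlen : PolyBdd sz fun a => (L a).length)
    (hf : Comp C (fun x : {x : α × τ // x.2 ∈ L x.1} => sz x.1.1)
      (fun x => .pair (i x.1.1) (enc x.1.2)) fun x => f x.1.1 x.1.2) :
    Comp C sz i fun a => (L a).any (f a) := by
  have h : Comp C sz i fun a => (L a).foldl (fun acc t => if f a t then true else acc) false := by
    refine foldlMem (f := fun a acc t => if f a t then true else acc) hL (constBool _) hlen
      (ite ?_ (constBool _) arg.fst)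
    have h1 := hf.reindex fun x : {x : α × Bool × τ // x.2.2 ∈ L x.1} =>
      ⟨(x.1.1, x.1.2.2), x.2⟩
    exact comp h1 (mkVal (fstVal id) arg.snd.toVal)
  have key : ∀ (a : α) (l : List τ) (b : Bool),
      l.foldl (fun acc t => f a t || acc) b = (b || l.any (f a)) := by
    intro a l
    induction l with
    | nil => simp
    | cons t l ih =>
      intro b
      rw [List.foldl_cons, ih, List.any_cons]
      cases f a t <;> cases b <;> simp
  exact h.congr fun a => by simp [key]

theorem zipIdx {L : α → List τ} (hL : Comp C sz i L)
    (hlen : PolyBdd sz fun a => (L a).length) : Comp C sz i fun a => (L a).zipIdx := by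
  have key : ∀ (l : List τ) (m : ℕ) (acc : List (τ × ℕ)),
      l.foldl (fun (s : ℕ × List (τ × ℕ)) t => (s.1 + 1, (t, s.1) :: s.2)) (m, acc) =
        (m + l.length, (l.zipIdx m).reverse ++ acc) := by
    intro l
    induction l with
    | nil => simp
    | cons t l ih =>
      intro m acc
      simp only [List.foldl_cons, ih, List.length_cons, List.zipIdx_cons, List.reverse_cons,
        List.append_assoc, List.cons_append, List.nil_append]
      congr 1
      omega
  have h := foldl (C := C) (L := L) (σ := ℕ × List (τ × ℕ)) (init := fun _ => (0, []))
    (f := fun _ s t => (s.1 + 1, (t, s.1) :: s.2)) (fun a s _ => s.1 ≤ (L a).length)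
    hL ((constNat 0).mk nil) hlen (fun a k hk => by
      rw [key]
      simp [hk.le]) (mk (addNat arg.fst.fst (constNat 1) ?_ (.of_polyBdd (.const 1)))
        (cons (mk arg.snd arg.fst.fst) arg.fst.snd))
  · refine (h.snd.reverse ?_).congr fun a => ?_
    · exact hlen.mono fun a => by simp [key]
    · simp [key]
  · exact .of_polyBdd ((hlen.reindex _).mono fun x => x.2)

theorem getD {L : α → List τ} {k : α → ℕ} {d : α → τ} (hL : Comp C sz i L)
    (hlen : PolyBdd sz fun a => (L a).length) (hk : Comp C sz i k) (bk : PolyBdd sz k)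
    (hd : Comp C sz i d) : Comp C sz i fun a => (L a).getD (k a) (d a) := by
  have h : Comp C sz i fun a => (L a).zipIdx.foldl
      (fun r (t : τ × ℕ) => if decide (t.2 = k a) then t.1 else r) (d a) := by
    refine foldlMem (f := fun a r (t : τ × ℕ) => if decide (t.2 = k a) then t.1 else r)
      (hL.zipIdx hlen) hd (by simpa using hlen) (ite (eqNat arg.snd.snd (hk.env _) ?_ ?_)
        arg.snd.fst arg.fst)
    · refine .of_polyBdd ((hlen.reindex _).mono fun x => ?_)
      have := List.snd_lt_of_mem_zipIdx (x := x.1.2.2) x.2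
      omega
    · exact .of_polyBdd (bk.reindex _)
  have key : ∀ (l : List τ) (m k : ℕ) (d : τ), (l.zipIdx m).foldl
      (fun r (t : τ × ℕ) => if t.2 = k then t.1 else r) d =
        if m ≤ k then l.getD (k - m) d else d := by
    intro l
    induction l with
    | nil => simp
    | cons t l ih =>
      intro m k d
      simp only [List.zipIdx_cons, List.foldl_cons, ih]
      rcases lt_trichotomy m k with h | rfl | h
      · obtain ⟨j, rfl⟩ := Nat.exists_eq_add_of_lt h
        have : m + j + 1 - m = j + 1 := by omega
        simp [h.ne, this, show m + j + 1 - (m + 1) = j by omega, show m ≤ m + j + 1 by omega,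
          show m + 1 ≤ m + j + 1 by omega]
      · simp
      · simp [h.ne', show ¬ m + 1 ≤ k by omega, h.not_ge]
  exact h.congr fun a => by simp [key]

theorem set {L : α → List τ} {k : α → ℕ} {d : α → τ} (hL : Comp C sz i L)
    (hlen : PolyBdd sz fun a => (L a).length) (hk : Comp C sz i k) (bk : PolyBdd sz k)
    (hd : Comp C sz i d) : Comp C sz i fun a => (L a).set (k a) (d a) := by
  have h : Comp C sz i fun a => (L a).zipIdx.map
      fun t : τ × ℕ => if decide (t.2 = k a) then d a else t.1 := by
    refine map (f := fun a (t : τ × ℕ) => if decide (t.2 = k a) then d a else t.1)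
      (hL.zipIdx hlen) (by simpa using hlen) (ite (eqNat arg.snd (hk.env _) ?_ ?_)
        (hd.env _) arg.fst)
    · refine .of_polyBdd ((hlen.reindex _).mono fun x => ?_)
      have := List.snd_lt_of_mem_zipIdx (x := x.1.2) x.2
      omega
    · exact .of_polyBdd (bk.reindex _)
  refine h.congr fun a => List.ext_getElem (by simp) fun j h1 h2 => ?_
  simp [List.getElem_set, eq_comm]

/-- The partial sums are the intermediate results; their bit lengths are bounded by
`NumLE.list_sum`. -/
theorem listSum {L : α → List ℝ} (hL : Comp C sz i L)
    (hlen : PolyBdd sz fun a => (L a).length) (hb : ListNumBdd C sz L) :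
    Comp C sz i fun a => (L a).sum := by
  have h : Comp C sz i fun a => (L a).foldl (fun s t => s + t) 0 := by
    refine foldl (f := fun _ s t => s + t) (fun a s t => (∃ k ≤ (L a).length,
      s = ((L a).take k).sum) ∧ t ∈ L a) hL (by simpa using constReal 0) hlen
      (fun a k hk => ⟨⟨k, hk.le, (List.sum_eq_foldl ..).symm⟩, List.getElem_mem _⟩)
      (addReal arg.fst arg.snd ?_ ?_)
    · obtain ⟨B, h1, h2⟩ := hb
      refine ⟨_, (hlen.mul (h1.add (.const 1))).reindex fun x : {x : α × ℝ × ℝ //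
        (∃ k ≤ (L x.1).length, x.2.1 = ((L x.1).take k).sum) ∧ x.2.2 ∈ L x.1} => x.1.1,
        fun x => ?_⟩
      obtain ⟨k, hk, hs⟩ := x.2.1
      simp only [hs]
      refine (NumLE.list_sum fun y hy => h2 x.1.1 y (List.mem_of_mem_take hy)).mono ?_
      exact Nat.mul_le_mul_right _ (by simp)
    · obtain ⟨B, h1, h2⟩ := hb
      exact ⟨_, h1.reindex _, fun x => h2 _ _ x.2.2⟩
  exact h.congr fun a => (List.sum_eq_foldl ..).symm

/-- As for sums, the bit lengths of the partial products are bounded a priori. -/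
theorem listProd {L : α → List ℝ} (hL : Comp C sz i L)
    (hlen : PolyBdd sz fun a => (L a).length) (hb : ListNumBdd C sz L) :
    Comp C sz i fun a => (L a).prod := by
  have h : Comp C sz i fun a => (L a).foldl (fun s t => s * t) 1 := by
    refine foldl (f := fun _ s t => s * t) (fun a s t => (∃ k ≤ (L a).length,
      s = ((L a).take k).prod) ∧ t ∈ L a) hL (by simpa using constReal 1) hlen
      (fun a k hk => ⟨⟨k, hk.le, (List.prod_eq_foldl ..).symm⟩, List.getElem_mem _⟩)
      (mulReal arg.fst arg.snd ?_ ?_)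
    · obtain ⟨B, h1, h2⟩ := hb
      refine ⟨_, (hlen.mul h1).reindex fun x : {x : α × ℝ × ℝ //
        (∃ k ≤ (L x.1).length, x.2.1 = ((L x.1).take k).prod) ∧ x.2.2 ∈ L x.1} => x.1.1,
        fun x => ?_⟩
      obtain ⟨k, hk, hs⟩ := x.2.1
      simp only [hs]
      refine (NumLE.list_prod fun y hy => h2 x.1.1 y (List.mem_of_mem_take hy)).mono ?_
      exact Nat.mul_le_mul_right _ (by simp)
    · obtain ⟨B, h1, h2⟩ := hb
      exact ⟨_, h1.reindex _, fun x => h2 _ _ x.2.2⟩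
  exact h.congr fun a => (List.prod_eq_foldl ..).symm

end Comp

/-! ### The table of orbits -/

/-- A row `(k, p, c, E)` of the table: a class of assignments to the variables treated so far,
with key `k` (the sum of the powers of the completed blocks), power `p` of the current block,
number `c` of assignments in the class, and the evidence `E`, with values `0`, `1` and `2`
(unassigned), extended by one of these assignments. -/
abbrev Row : Type := ℕ × ℕ × ℕ × List ℕ

/-- The admissible values of a variable on which the evidence has entry `t`. -/
def optValues (t : ℕ) : List ℕ := if t = 2 then [0, 1] else [t]

/-- Assign the values `os` to the variable `v`. The power `N ^ m` of the current block, where `m`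
is the number with the binary digits assigned so far, becomes `N ^ (2 * m + b)`. -/
def splitRow (N v : ℕ) (os : List ℕ) (r : Row) : List Row :=
  os.map fun b => (r.1, r.2.1 * r.2.1 * (if b = 1 then N else 1), r.2.2.1, r.2.2.2.set v b)

/-- `splitRow` applied to all rows. -/
def splitTable (N v : ℕ) (os : List ℕ) (T : List Row) : List Row := T.flatMap (splitRow N v os)

/-- Complete the current block: its power is added to the key, and the next block starts with power
`N ^ 0`. -/
def closeRow (r : Row) : Row := (r.1 + r.2.1, 1, r.2.2)

/-- Add the row `r` to a table, or its count to the count of a row with the same key. -/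
def insertRow (T : List Row) (r : Row) : List Row :=
  if T.any (fun s => decide (s.1 = r.1)) then
    T.map fun s => if decide (s.1 = r.1) then (s.1, s.2.1, s.2.2.1 + r.2.2.1, s.2.2.2) else s
  else r :: T

/-- Assign all values admitted by the evidence `e` to the variables of the block `B`. The values are
read off `e` and not off the rows, so that the keys and powers of the new rows depend only on those
of the old ones. -/
def splitBlock (N : ℕ) (e : List ℕ) (T : List Row) (B : List ℕ) : List Row :=
  B.foldl (fun T v => splitTable N v (optValues (e.getD v 2)) T) T

/-- Treat one block without merging rows. -/
def fullStep (N : ℕ) (e : List ℕ) (T : List Row) (B : List ℕ) : List Row :=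
  (splitBlock N e T B).map closeRow

/-- Treat one block and merge the rows with equal keys. -/
def orbitStep (N : ℕ) (e : List ℕ) (T : List Row) (B : List ℕ) : List Row :=
  (fullStep N e T B).foldl insertRow []

/-- The table of all completions of `e` on the blocks `D`. It has exponential length and serves
only to specify `orbitTable`. -/
def fullTable (N : ℕ) (e : List ℕ) (D : List (List ℕ)) : List Row :=
  D.foldl (fullStep N e) [(0, 1, 1, e)]

/-- The completions of `e` on the blocks `D`, one for each key, with the number of completions
that have this key. -/
def orbitTable (N : ℕ) (e : List ℕ) (D : List (List ℕ)) : List Row :=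
  D.foldl (orbitStep N e) [(0, 1, 1, e)]

/-- The sum over a table of a function of key and power, weighted with the counts. -/
def weightedSum (g : ℕ → ℕ → ℝ) (T : List Row) : ℝ :=
  (T.map fun r => (r.2.2.1 : ℝ) * g r.1 r.2.1).sum

/-- `T` counts the rows of `U` correctly for all keys and powers, and each of its rows occurs in
`U` up to the count. -/
structure Represents (T U : List Row) : Prop where
  sum_eq : ∀ g, weightedSum g T = weightedSum g U
  mem : ∀ r ∈ T, ∃ u ∈ U, u.1 = r.1 ∧ u.2.1 = r.2.1 ∧ u.2.2.2 = r.2.2.2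

theorem weightedSum_splitTable (N v : ℕ) (os : List ℕ) (g : ℕ → ℕ → ℝ) (T : List Row) :
    weightedSum g (splitTable N v os T) =
      weightedSum (fun k p => (os.map fun b => g k (p * p * (if b = 1 then N else 1))).sum) T := by
  induction T with
  | nil => rfl
  | cons r T ih =>
    unfold weightedSum splitTable at ih ⊢
    rw [List.flatMap_cons, List.map_append, List.sum_append, ih, List.map_cons, List.sum_cons,
      splitRow, List.map_map, ← List.sum_map_mul_left]
    rfl

theorem weightedSum_closeRow (g : ℕ → ℕ → ℝ) (T : List Row) :
    weightedSum g (T.map closeRow) = weightedSum (fun k p => g (k + p) 1) T := by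
  simp [weightedSum, closeRow, Function.comp_def]

theorem Represents.splitTable {T U : List Row} (h : Represents T U) (N v : ℕ) (os : List ℕ) :
    Represents (splitTable N v os T) (splitTable N v os U) := by
  refine ⟨fun g => ?_, fun r hr => ?_⟩
  · rw [weightedSum_splitTable, weightedSum_splitTable, h.sum_eq]
  · obtain ⟨s, hs, hr⟩ := List.mem_flatMap.1 hr
    obtain ⟨b, hb, rfl⟩ := List.mem_map.1 hr
    obtain ⟨u, hu, h1, h2, h3⟩ := h.mem s hs
    exact ⟨_, List.mem_flatMap.2 ⟨u, hu, List.mem_map.2 ⟨b, hb, rfl⟩⟩, by simp [h1, h2, h3]⟩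

theorem Represents.splitBlock {T U : List Row} (h : Represents T U) (N : ℕ) (e B : List ℕ) :
    Represents (splitBlock N e T B) (splitBlock N e U B) := by
  induction B generalizing T U with
  | nil => exact h
  | cons v B ih => exact ih (h.splitTable N v _)

theorem Represents.closeRow {T U : List Row} (h : Represents T U) :
    Represents (T.map closeRow) (U.map closeRow) := by
  refine ⟨fun g => ?_, fun r hr => ?_⟩
  · rw [weightedSum_closeRow, weightedSum_closeRow, h.sum_eq]
  · obtain ⟨s, hs, rfl⟩ := List.mem_map.1 hr
    obtain ⟨u, hu, h1, h2, h3⟩ := h.mem s hs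
    exact ⟨_, List.mem_map.2 ⟨u, hu, rfl⟩, by simp [ExchInference.closeRow, h1, h2, h3]⟩

/-- Tables between two blocks: the keys are distinct and all powers are `1`. -/
structure Merged (T : List Row) : Prop where
  nodup : (T.map Prod.fst).Nodup
  power : ∀ r ∈ T, r.2.1 = 1

theorem merged_nil : Merged [] := ⟨by simp, by simp⟩

theorem mem_insertRow {T : List Row} {r s : Row} (hs : s ∈ insertRow T r) :
    s = r ∨ ∃ s' ∈ T, s.1 = s'.1 ∧ s.2.1 = s'.2.1 ∧ s.2.2.2 = s'.2.2.2 := by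
  unfold insertRow at hs
  split_ifs at hs with h
  · obtain ⟨s', hs', rfl⟩ := List.mem_map.1 hs
    right
    refine ⟨s', hs', ?_⟩
    split_ifs <;> simp
  · rcases List.mem_cons.1 hs with rfl | hs
    · exact .inl rfl
    · exact .inr ⟨s, hs, rfl, rfl, rfl⟩

theorem Merged.insertRow {T : List Row} (h : Merged T) {r : Row} (hr : r.2.1 = 1) :
    Merged (insertRow T r) := by
  refine ⟨?_, fun s hs => ?_⟩
  · unfold ExchInference.insertRow
    split_ifs with hk
    · convert h.nodup using 1
      rw [List.map_map]
      refine List.map_congr_left fun s _ => ?_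
      simp only [Function.comp]
      split_ifs <;> rfl
    · rw [List.map_cons, List.nodup_cons]
      exact ⟨by simpa using hk, h.nodup⟩
  · rcases mem_insertRow hs with rfl | ⟨s', hs', -, h2, -⟩
    · exact hr
    · rw [h2, h.power s' hs']

theorem weightedSum_insertRow (g : ℕ → ℕ → ℝ) {T : List Row} (h : Merged T) {r : Row}
    (hr : r.2.1 = 1) :
    weightedSum g (insertRow T r) = weightedSum g T + r.2.2.1 * g r.1 r.2.1 := by
  unfold insertRow
  split_ifs with hk
  · obtain ⟨h1, h2⟩ := h
    induction T with
    | nil => simp at hk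
    | cons s T ih =>
      rw [List.map_cons, List.nodup_cons] at h1
      have hT := ih
      unfold weightedSum at hT ⊢
      by_cases hs : s.1 = r.1
      · have : ∀ t ∈ T, t.1 ≠ r.1 := fun t ht hne =>
          h1.1 (List.mem_map.2 ⟨t, ht, hne.trans hs.symm⟩)
        rw [List.map_cons, List.map_congr_left (g := _root_.id) fun t ht => by simp [this t ht]]
        have hp := h2 s (by simp)
        simp [hs, hr, hp]
        ring
      · have := hT (by simpa [hs] using hk) h1.2 fun t ht => h2 t (by simp [ht])
        simp only [List.map_cons, List.sum_cons, this, hs, decide_false, Bool.false_eq_true,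
          if_false]
        ring
  · simp only [weightedSum, List.map_cons, List.sum_cons]
    ring

theorem Merged.foldl_insertRow {A : List Row} (hA : Merged A) {T : List Row}
    (hT : ∀ r ∈ T, r.2.1 = 1) :
    Merged (T.foldl ExchInference.insertRow A) ∧
      (∀ g, weightedSum g (T.foldl ExchInference.insertRow A) =
        weightedSum g A + weightedSum g T) ∧
      ∀ s ∈ T.foldl ExchInference.insertRow A, ∃ s' ∈ A ++ T,
        s.1 = s'.1 ∧ s.2.1 = s'.2.1 ∧ s.2.2.2 = s'.2.2.2 := by
  induction T generalizing A with
  | nil => exact ⟨hA, fun g => by simp [weightedSum], fun s hs => ⟨s, by simpa using hs, by simp⟩⟩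
  | cons r T ih =>
    have hr := hT r (by simp)
    obtain ⟨h1, h2, h3⟩ := ih (hA.insertRow hr) fun t ht => hT t (by simp [ht])
    refine ⟨h1, fun g => ?_, fun s hs => ?_⟩
    · rw [List.foldl_cons, h2, weightedSum_insertRow g hA hr]
      simp only [weightedSum, List.map_cons, List.sum_cons]
      ring
    · obtain ⟨s', hs', e1, e2, e3⟩ := h3 s hs
      rcases List.mem_append.1 hs' with hs' | hs'
      · rcases mem_insertRow hs' with rfl | ⟨s'', hs'', e4, e5, e6⟩
        · exact ⟨s', by simp, e1, e2, e3⟩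
        · exact ⟨s'', by simp [hs''], e1.trans e4, e2.trans e5, e3.trans e6⟩
      · exact ⟨s', by simp [hs'], e1, e2, e3⟩

theorem power_fullStep {N : ℕ} {e B : List ℕ} {T : List Row} :
    ∀ r ∈ fullStep N e T B, r.2.1 = 1 := by
  intro r hr
  obtain ⟨s, -, rfl⟩ := List.mem_map.1 hr
  rfl

theorem Represents.orbitStep {T U : List Row} (h : Represents T U) (N : ℕ) (e B : List ℕ) :
    Represents (orbitStep N e T B) (fullStep N e U B) := by
  have h' : Represents (fullStep N e T B) (fullStep N e U B) := (h.splitBlock N e B).closeRow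
  obtain ⟨-, h2, h3⟩ := merged_nil.foldl_insertRow
    (T := fullStep N e T B) power_fullStep
  refine ⟨fun g => ?_, fun r hr => ?_⟩
  · rw [ExchInference.orbitStep, h2, h'.sum_eq]
    simp [weightedSum]
  · obtain ⟨s, hs, e1, e2, e3⟩ := h3 r hr
    obtain ⟨u, hu, e4, e5, e6⟩ := h'.mem s (by simpa using hs)
    exact ⟨u, hu, e4.trans e1.symm, e5.trans e2.symm, e6.trans e3.symm⟩

theorem merged_orbitStep (N : ℕ) (e : List ℕ) (T : List Row) (B : List ℕ) :
    Merged (orbitStep N e T B) :=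
  (merged_nil.foldl_insertRow power_fullStep).1

theorem represents_foldl {T U : List Row} (h : Represents T U) (N : ℕ) (e : List ℕ)
    (D : List (List ℕ)) :
    Represents (D.foldl (orbitStep N e) T) (D.foldl (fullStep N e) U) := by
  induction D generalizing T U with
  | nil => exact h
  | cons B D ih => exact ih (h.orbitStep N e B)

theorem orbitTable_represents (N : ℕ) (e : List ℕ) (D : List (List ℕ)) :
    Represents (orbitTable N e D) (fullTable N e D) :=
  represents_foldl ⟨fun _ => rfl, fun r hr => ⟨r, hr, rfl, rfl, rfl⟩⟩ N e D

/-! ### Keys determine orbits -/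

/-- The number with the given binary digits, the most significant one first. -/
def bitsNum (l : List Bool) : ℕ := l.foldl (fun m b => 2 * m + b.toNat) 0

theorem bitsNum_concat (l : List Bool) (b : Bool) :
    bitsNum (l ++ [b]) = 2 * bitsNum l + b.toNat := by
  simp [bitsNum]

theorem bitsNum_injective {l l' : List Bool} (hlen : l.length = l'.length)
    (h : bitsNum l = bitsNum l') : l = l' := by
  induction l using List.reverseRecOn generalizing l' with
  | nil => exact (List.eq_nil_of_length_eq_zero hlen.symm).symm
  | append_singleton l b ih =>
    rcases List.eq_nil_or_concat' l' with rfl | ⟨l', b', rfl⟩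
    · simp at hlen
    · rw [bitsNum_concat, bitsNum_concat] at h
      have hl := ih (l' := l') (by simpa using hlen)
        (by have := b.toNat_le; have := b'.toNat_le; omega)
      have hb : b = b' := by
        cases b <;> cases b' <;> simp_all
      rw [hl, hb]

/-- The key of an assignment: the sum over the blocks of the powers `N ^ m`, where `m` has the
values of the block as its binary digits. -/
def key {n : ℕ} (N : ℕ) (D : Blocks n) (x : Assignment n) : ℕ :=
  (D.map fun B => N ^ bitsNum (B.map x)).sum

/-- Uniqueness of the base `N` expansion. -/
theorem digits_unique {N : ℕ} (M : ℕ) {c c' : ℕ → ℕ} (hc : ∀ v, c v < N) (hc' : ∀ v, c' v < N)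
    (h : ∑ v ∈ Finset.range M, c v * N ^ v = ∑ v ∈ Finset.range M, c' v * N ^ v) :
    ∀ v < M, c v = c' v := by
  induction M generalizing c c' with
  | zero => simp
  | succ M ih =>
    have hN : 0 < N := (Nat.zero_le _).trans_lt (hc 0)
    have split : ∀ c : ℕ → ℕ, ∑ v ∈ Finset.range (M + 1), c v * N ^ v =
        c 0 + N * ∑ v ∈ Finset.range M, c (v + 1) * N ^ v := fun c => by
      rw [Finset.sum_range_succ', Finset.mul_sum, add_comm]
      simp only [pow_zero, mul_one, pow_succ]
      congr 1
      exact Finset.sum_congr rfl fun v _ => by ring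
    rw [split, split] at h
    have h0 : c 0 = c' 0 := by
      have := congrArg (· % N) h
      simpa [Nat.add_mul_mod_self_left, Nat.mod_eq_of_lt (hc 0), Nat.mod_eq_of_lt (hc' 0)]
        using this
    rw [h0, Nat.add_left_cancel_iff] at h
    have hs := ih (fun v => hc (v + 1)) (fun v => hc' (v + 1)) (Nat.eq_of_mul_eq_mul_left hN h)
    rintro (_ | v) hv
    · exact h0
    · exact hs v (by omega)

/-- A sum of fewer than `N` powers of `N` determines the exponents up to their order. -/
theorem exists_perm_of_sum_pow_eq {k N : ℕ} (hk : k < N) {f g : Fin k → ℕ}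
    (h : ∑ l, N ^ f l = ∑ l, N ^ g l) : ∃ π : Equiv.Perm (Fin k), ∀ l, g (π l) = f l := by
  classical
  let cnt : (Fin k → ℕ) → ℕ → ℕ := fun f v => (Finset.univ.filter fun l => f l = v).card
  have hcnt : ∀ f v, cnt f v < N := fun f v =>
    ((Finset.card_filter_le _ _).trans (by simp)).trans_lt hk
  obtain ⟨M, hM⟩ : ∃ M, ∀ l, f l < M ∧ g l < M :=
    ⟨∑ l, (f l + g l) + 1, fun l => by
      have := Finset.single_le_sum (f := fun l => f l + g l) (fun _ _ => Nat.zero_le _)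
        (Finset.mem_univ l)
      omega⟩
  have hsum : ∀ f : Fin k → ℕ, (∀ l, f l < M) →
      ∑ l, N ^ f l = ∑ v ∈ Finset.range M, cnt f v * N ^ v := fun f hf => by
    rw [← Finset.sum_fiberwise_of_maps_to (g := f) (t := Finset.range M)
      (fun l _ => Finset.mem_range.2 (hf l))]
    refine Finset.sum_congr rfl fun v _ => ?_
    rw [Finset.sum_congr rfl (g := fun _ => N ^ v) fun l hl => by rw [(Finset.mem_filter.1 hl).2]]
    simp [cnt]
  rw [hsum f fun l => (hM l).1, hsum g fun l => (hM l).2] at h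
  have heq := digits_unique M (hcnt f) (hcnt g) h
  have hfib : ∀ v, Nonempty ({l // f l = v} ≃ {l // g l = v}) := fun v => by
    refine ⟨Fintype.equivOfCardEq ?_⟩
    rw [Fintype.card_subtype, Fintype.card_subtype]
    by_cases hv : v < M
    · exact heq v hv
    · rw [Finset.filter_false_of_mem, Finset.filter_false_of_mem]
      · exact fun l _ hl => hv (hl ▸ (hM l).2)
      · exact fun l _ hl => hv (hl ▸ (hM l).1)
  exact ⟨Equiv.ofFiberEquiv fun v => (hfib v).some, fun l => Equiv.ofFiberEquiv_map _ l⟩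

theorem exists_perm_of_key_eq {n N : ℕ} {D : Blocks n} (hD : D.length < N)
    (hlen : ∀ B ∈ D, ∀ B' ∈ D, B.length = B'.length) {x x' : Assignment n}
    (h : key N D x' = key N D x) :
    ∃ π : Equiv.Perm (Fin D.length), ∀ l, (D.get l).map x' = (D.get (π l)).map x := by
  have hkey : ∀ x, key N D x = ∑ l, N ^ bitsNum ((D.get l).map x) := fun x => by
    rw [key, ← List.sum_ofFn]
    congr 1
    apply List.ext_getElem <;> simp
  rw [hkey, hkey] at h
  obtain ⟨π, hπ⟩ := exists_perm_of_sum_pow_eq hD h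
  refine ⟨π, fun l => bitsNum_injective ?_ (hπ l).symm⟩
  rw [List.length_map, List.length_map]
  exact hlen _ (List.get_mem _ _) _ (List.get_mem _ _)

/-! ### Evidence -/

/-- The list of values of an assignment to a part of the variables; `2` marks an unassigned
variable. -/
def evList {n : ℕ} (e : Evidence n) : List ℕ :=
  List.ofFn fun i => match e i with
    | none => 2
    | some b => b.toNat

theorem enc_evList {n : ℕ} (e : Evidence n) : enc (evList e) = encEvidence e := by
  have h : ∀ l : List (Option Bool), encList encNat (l.map fun o => match o with
      | none => 2
      | some b => b.toNat) = encList encOptBool l := by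
    intro l
    induction l with
    | nil => rfl
    | cons o l ih =>
      rw [List.map_cons, encList, encList, ih]
      congr 1
      rcases o with _ | _ | _ <;> simp [encNat, encOptBool, encBool]
  rw [encEvidence, ← h, List.map_ofFn]
  rfl

theorem enc_evList_some {n : ℕ} (x : Assignment n) :
    enc (evList fun i => some (x i)) = encAssignment x := by
  have h : ∀ l : List Bool, encList encOptBool (l.map some) = encList encBool l := by
    intro l
    induction l with
    | nil => rfl
    | cons o l ih => rw [List.map_cons, encList, encList, ih]; rfl
  rw [enc_evList, encEvidence, encAssignment, ← h, List.map_ofFn]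
  rfl

@[simp] theorem length_evList {n : ℕ} (e : Evidence n) : (evList e).length = n := by
  simp [evList]

theorem evList_set {n : ℕ} (e : Evidence n) (v : Fin n) (b : Bool) :
    (evList e).set v b.toNat = evList (Function.update e v (some b)) := by
  refine List.ext_getElem (by simp) fun j h1 h2 => ?_
  have hj : j < n := by simpa using h2
  rw [List.getElem_set]
  by_cases h : (v : ℕ) = j
  · subst h
    simp [evList]
  · have : (⟨j, hj⟩ : Fin n) ≠ v := fun hh => h (by rw [← hh])
    simp [evList, h, this]

theorem evList_getD {n : ℕ} (e : Evidence n) (v : Fin n) :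
    (evList e).getD v 2 = match e v with
      | none => 2
      | some b => b.toNat := by
  simp [evList]

theorem evList_injective {n : ℕ} {e e' : Evidence n} (h : evList e = evList e') : e = e' := by
  funext v
  have := congrArg (fun l => l.getD v 2) h
  simp only [evList_getD] at this
  rcases h1 : e v with _ | _ | _ <;> rcases h2 : e' v with _ | _ | _ <;> simp_all

theorem evList_le {n : ℕ} (e : Evidence n) : ∀ t ∈ evList e, t ≤ 2 := by
  intro t ht
  obtain ⟨i, rfl⟩ := (List.mem_ofFn' _ _).1 ht
  dsimp only
  rcases e i with _ | _ | _ <;> simp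

/-- Summing out one variable. -/
theorem prEv_eq_add {n : ℕ} (prob : Assignment n → ℝ) {e : Evidence n} {v : Fin n}
    (h : e v = none) : prEv prob e =
      prEv prob (Function.update e v (some false)) +
        prEv prob (Function.update e v (some true)) := by
  unfold prEv
  rw [← Finset.sum_union]
  · refine Finset.sum_congr ?_ fun _ _ => rfl
    ext x
    simp only [Finset.mem_filter, Finset.mem_univ, true_and, Finset.mem_union]
    constructor
    · intro hx
      cases hv : x v
      · refine .inl fun i => ?_
        by_cases hi : i = v
        · subst hi; simp [hv]
        · simpa [hi] using hx i
      · refine .inr fun i => ?_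
        by_cases hi : i = v
        · subst hi; simp [hv]
        · simpa [hi] using hx i
    · rintro (hx | hx) i <;>
      · by_cases hi : i = v
        · subst hi; exact .inl h
        · simpa [hi] using hx i
  · rw [Finset.disjoint_filter]
    intro x _ h1 h2
    have a1 := h1 v
    have a2 := h2 v
    simp at a1 a2
    simp_all

/-- The evidence `e` overridden by `x` on the variables in `L`. -/
def override {n : ℕ} (e : Evidence n) (x : Assignment n) (L : List (Fin n)) : Evidence n :=
  fun i => if i ∈ L then some (x i) else e i

theorem override_concat {n : ℕ} (e : Evidence n) (x : Assignment n) (L : List (Fin n))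
    (v : Fin n) :
    override e x (L ++ [v]) = Function.update (override e x L) v (some (x v)) := by
  funext i
  by_cases h : i = v
  · subst h; simp [override]
  · simp [override, h]

theorem override_congr {n : ℕ} (e : Evidence n) {x x' : Assignment n} {L : List (Fin n)}
    (h : ∀ i ∈ L, x i = x' i) : override e x L = override e x' L := by
  funext i
  by_cases hi : i ∈ L
  · simp [override, hi, h i hi]
  · simp [override, hi]

/-- On evidence `e` that `x` agrees with, overriding amounts to restricting `x`. -/
theorem override_eq_restrict {n : ℕ} {e : Evidence n} {x : Assignment n} (h : Agrees x e)
    {L : List (Fin n)} {S : Finset (Fin n)} (hS : L.toFinset = S) :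
    override e x L = restrict x (e.dom ∪ S) := by
  funext i
  subst hS
  by_cases hi : i ∈ L
  · simp [override, restrict, hi]
  · rcases h i with h0 | h1
    · simp [override, restrict, hi, h0, Evidence.dom]
    · simp [override, restrict, hi, h1, Evidence.dom]

/-! ### Correctness of the table -/

/-- The row of a single assignment `x` after the blocks in `D` and the part `B` of the current
block. -/
def assignmentRow {n : ℕ} (N : ℕ) (e : Evidence n) (D : Blocks n) (B : List (Fin n))
    (x : Assignment n) : Row :=
  (key N D x, N ^ bitsNum (B.map x), 1, evList (override e x (D.flatten ++ B)))

/-- The table `U` consists of the rows of all assignments that agree with `e`, and it has one row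
for each assignment to the variables treated, so that every distribution is summed correctly. -/
structure IsFull {n : ℕ} (N : ℕ) (e : Evidence n) (D : Blocks n) (B : List (Fin n))
    (U : List Row) : Prop where
  mem_iff : ∀ u, u ∈ U ↔ ∃ x, Agrees x e ∧ u = assignmentRow N e D B x
  sum_eq : ∀ (prob : Assignment n → ℝ) (F : List ℕ → ℝ), (∀ E, F (evList E) = prEv prob E) →
    (U.map fun u => F u.2.2.2).sum = prEv prob e

theorem exists_agrees {n : ℕ} (e : Evidence n) : ∃ x : Assignment n, Agrees x e :=
  ⟨fun i => (e i).getD false, fun i => by rcases h : e i with _ | _ <;> simp [h]⟩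

theorem isFull_nil {n : ℕ} (N : ℕ) (e : Evidence n) :
    IsFull N e [] [] [(0, 1, 1, evList e)] := by
  have : ∀ x, assignmentRow N e [] [] x = (0, 1, 1, evList e) := fun x => by
    have h : override e x [] = e := by funext i; simp [override]
    simp [assignmentRow, key, bitsNum, h]
  refine ⟨fun u => ?_, fun prob F hF => by simp [hF]⟩
  simp only [this, List.mem_singleton, exists_and_right, iff_and_self]
  exact fun _ => exists_agrees e

theorem mem_optValues {n : ℕ} (e : Evidence n) (v : Fin n) (t : ℕ) :
    t ∈ optValues ((evList e).getD v 2) ↔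
      ∃ b : Bool, t = b.toNat ∧ (e v = none ∨ e v = some b) := by
  rw [evList_getD]
  rcases e v with _ | _ | _ <;> simp [optValues]

theorem IsFull.splitTable {n N : ℕ} {e : Evidence n} {D : Blocks n} {B : List (Fin n)}
    {U : List Row} (h : IsFull N e D B U) {v : Fin n} (hv : v ∉ D.flatten ++ B) :
    IsFull N e D (B ++ [v])
      (splitTable N v (optValues ((evList e).getD v 2)) U) := by
  have hD : ∀ C ∈ D, ∀ i ∈ C, i ≠ v := fun C hC i hi hiv =>
    hv (List.mem_append_left _ (List.mem_flatten.2 ⟨C, hC, hiv ▸ hi⟩))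
  have hB : ∀ i ∈ B, i ≠ v := fun i hi hiv => hv (List.mem_append_right _ (hiv ▸ hi))
  have row : ∀ (x x' : Assignment n) (b : Bool), (∀ i, i ≠ v → x' i = x i) → x' v = b →
      assignmentRow N e D (B ++ [v]) x' =
        ((assignmentRow N e D B x).1, (assignmentRow N e D B x).2.1 *
          (assignmentRow N e D B x).2.1 * (if b.toNat = 1 then N else 1), 1,
          (assignmentRow N e D B x).2.2.2.set v b.toNat) := by
    intro x x' b hx hb
    have h1 : key N D x' = key N D x := by
      unfold key
      congr 1
      refine List.map_congr_left fun C hC => ?_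
      rw [List.map_congr_left fun i hi => hx i (hD C hC i hi)]
    have h2 : B.map x' = B.map x := List.map_congr_left fun i hi => hx i (hB i hi)
    have h3 : override e x' (D.flatten ++ B) = override e x (D.flatten ++ B) :=
      override_congr _ fun i hi => hx i fun hiv => hv (hiv ▸ hi)
    simp only [assignmentRow, List.map_append, List.map_singleton, bitsNum_concat, h1, h2,
      evList_set, ← List.append_assoc, override_concat, h3, hb]
    congr 2
    cases b
    · simp [two_mul, pow_add]
    · simp [two_mul, pow_add]
  refine ⟨fun u => ?_, fun prob F hF => ?_⟩
  · simp only [ExchInference.splitTable, List.mem_flatMap, splitRow, List.mem_map, mem_optValues,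
      h.mem_iff]
    constructor
    · rintro ⟨_, ⟨x, hx, rfl⟩, _, ⟨b, rfl, hb⟩, rfl⟩
      refine ⟨Function.update x v b, fun i => ?_, ?_⟩
      · by_cases hi : i = v
        · subst hi; simpa using hb
        · simpa [hi] using hx i
      · rw [row x _ b (fun i hi => by simp [hi]) (by simp)]
        rfl
    · rintro ⟨x, hx, rfl⟩
      refine ⟨_, ⟨x, hx, rfl⟩, _, ⟨x v, rfl, hx v⟩, ?_⟩
      rw [row x x _ (fun _ _ => rfl) rfl]
      rfl
  · rw [← h.sum_eq prob F hF]
    have hU : ∀ u ∈ U, ((optValues ((evList e).getD v 2)).map fun t =>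
        F (u.2.2.2.set v t)).sum = F u.2.2.2 := by
      intro u hu
      obtain ⟨x, hx, rfl⟩ := (h.mem_iff u).1 hu
      have hov : override e x (D.flatten ++ B) v = e v := by simp only [override, if_neg hv]
      have h0 := evList_set (override e x (D.flatten ++ B)) v false
      have h1 := evList_set (override e x (D.flatten ++ B)) v true
      simp only [Bool.toNat_false, Bool.toNat_true] at h0 h1
      rw [evList_getD]
      rcases hev : e v with _ | _ | _
      · simp [optValues, assignmentRow, h0, h1, hF, prEv_eq_add prob (hov.trans hev)]
      · have := Function.update_eq_self v (override e x (D.flatten ++ B))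
        rw [hov, hev] at this
        simp [optValues, assignmentRow, h0, hF, this]
      · have := Function.update_eq_self v (override e x (D.flatten ++ B))
        rw [hov, hev] at this
        simp [optValues, assignmentRow, h1, hF, this]
    rw [← List.map_congr_left hU, ExchInference.splitTable]
    clear h hU
    induction U with
    | nil => rfl
    | cons u U ih =>
      rw [List.flatMap_cons, List.map_append, List.sum_append, ih, List.map_cons, List.sum_cons,
        splitRow, List.map_map]
      rfl

theorem IsFull.splitBlock {n N : ℕ} {e : Evidence n} {D : Blocks n} {B B' : List (Fin n)}
    {U : List Row} (h : IsFull N e D B U) (hnd : (D.flatten ++ (B ++ B')).Nodup) :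
    IsFull N e D (B ++ B') (splitBlock N (evList e) U (B'.map Fin.val)) := by
  induction B' generalizing B U with
  | nil => simpa [ExchInference.splitBlock] using h
  | cons v B' ih =>
    have hv : v ∉ D.flatten ++ B := by
      rw [← List.append_assoc] at hnd
      exact fun hmem => (List.nodup_append.1 hnd).2.2 v hmem v (by simp) rfl
    have := ih (h.splitTable hv) (by simpa using hnd)
    simpa [ExchInference.splitBlock] using this

theorem IsFull.fullStep {n N : ℕ} {e : Evidence n} {D : Blocks n} {B : List (Fin n)}
    {U : List Row} (h : IsFull N e D [] U) (hnd : (D ++ [B]).flatten.Nodup) :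
    IsFull N e (D ++ [B]) [] (fullStep N (evList e) U (B.map Fin.val)) := by
  have h' := h.splitBlock (B' := B) (by simpa using hnd)
  have row : ∀ x, closeRow (assignmentRow N e D B x) = assignmentRow N e (D ++ [B]) [] x := by
    intro x
    simp [closeRow, assignmentRow, key, bitsNum]
  refine ⟨fun u => ?_, fun prob F hF => ?_⟩
  · simp only [ExchInference.fullStep, List.mem_map, h'.mem_iff, List.nil_append]
    constructor
    · rintro ⟨_, ⟨x, hx, rfl⟩, rfl⟩
      exact ⟨x, hx, row x⟩
    · rintro ⟨x, hx, rfl⟩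
      exact ⟨_, ⟨x, hx, rfl⟩, row x⟩
  · rw [← h'.sum_eq prob F hF, ExchInference.fullStep, List.map_map]
    rfl

theorem isFull_fullTable {n : ℕ} (N : ℕ) (e : Evidence n) (D : Blocks n)
    (hnd : D.flatten.Nodup) :
    IsFull N e D [] (fullTable N (evList e) (D.map fun B => B.map Fin.val)) := by
  induction D using List.reverseRecOn with
  | nil => exact isFull_nil N e
  | append_singleton D B ih =>
    have := (ih (by
      rw [List.flatten_append] at hnd
      exact (List.nodup_append.1 hnd).1)).fullStep hnd
    simpa [fullTable] using this

/-- The table of orbits: each row stems from a completion, each completion has its key in the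
table, and a distribution that depends on the completion only through its key is summed out by
weighting the representatives with the counts. -/
theorem orbitTable_spec {n : ℕ} (N : ℕ) (e : Evidence n) (D : Blocks n)
    (hnd : D.flatten.Nodup) :
    let T := orbitTable N (evList e) (D.map fun B => B.map Fin.val)
    (∀ r ∈ T, ∃ x, Agrees x e ∧ r.1 = key N D x ∧ r.2.2.2 = evList (override e x D.flatten)) ∧
    (∀ x, Agrees x e → ∃ r ∈ T, r.1 = key N D x) ∧
    ∀ (prob : Assignment n → ℝ) (F : List ℕ → ℝ), (∀ E, F (evList E) = prEv prob E) →
      (∀ x x', Agrees x e → Agrees x' e → key N D x' = key N D x →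
        prEv prob (override e x' D.flatten) = prEv prob (override e x D.flatten)) →
      (T.map fun r => (r.2.2.1 : ℝ) * F r.2.2.2).sum = prEv prob e := by
  intro T
  have hR := orbitTable_represents N (evList e) (D.map fun B => B.map Fin.val)
  have hU := isFull_fullTable N e D hnd
  set U := fullTable N (evList e) (D.map fun B => B.map Fin.val)
  have hT : ∀ r ∈ T, ∃ x, Agrees x e ∧ r.1 = key N D x ∧
      r.2.2.2 = evList (override e x D.flatten) := by
    intro r hr
    obtain ⟨u, hu, h1, -, h3⟩ := hR.mem r hr
    obtain ⟨x, hx, rfl⟩ := (hU.mem_iff u).1 hu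
    exact ⟨x, hx, h1.symm, by rw [← h3]; simp [assignmentRow]⟩
  refine ⟨hT, fun x hx => ?_, fun prob F hF hsym => ?_⟩
  · by_contra! hne
    -- Compare the weighted sums of the indicator function of the key of `x`.
    have h := hR.sum_eq fun k _ => if k = key N D x then 1 else 0
    have h0 : weightedSum (fun k _ => if k = key N D x then 1 else 0) T = 0 := by
      refine List.sum_eq_zero fun y hy => ?_
      obtain ⟨r, hr, rfl⟩ := List.mem_map.1 hy
      simp [hne r hr]
    have hmem := (hU.mem_iff _).2 ⟨x, hx, rfl⟩
    have h1 := List.single_le_sum (l := U.map fun r => (r.2.2.1 : ℝ) *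
      if r.1 = key N D x then 1 else 0) (fun y hy => by
        obtain ⟨r, -, rfl⟩ := List.mem_map.1 hy
        positivity) _ (List.mem_map.2 ⟨_, hmem, rfl⟩)
    unfold weightedSum at h h0
    rw [h0] at h
    rw [← h] at h1
    simp [assignmentRow] at h1
    linarith
  · classical
    -- The probability as a function of the key.
    let φ : ℕ → ℝ := fun k =>
      if h : ∃ x, Agrees x e ∧ key N D x = k then prEv prob (override e h.choose D.flatten) else 0
    have hφ : ∀ x, Agrees x e → φ (key N D x) = prEv prob (override e x D.flatten) := by
      intro x hx
      have h : ∃ x', Agrees x' e ∧ key N D x' = key N D x := ⟨x, hx, rfl⟩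
      simp only [φ, dif_pos h]
      exact hsym _ _ hx h.choose_spec.1 h.choose_spec.2
    have h1 : (T.map fun r => (r.2.2.1 : ℝ) * F r.2.2.2).sum = weightedSum (fun k _ => φ k) T := by
      unfold weightedSum
      congr 1
      refine List.map_congr_left fun r hr => ?_
      obtain ⟨x, hx, e1, e2⟩ := hT r hr
      simp only [e1, e2, hφ x hx, hF]
    have h2 : weightedSum (fun k _ => φ k) U = (U.map fun u => F u.2.2.2).sum := by
      unfold weightedSum
      congr 1
      refine List.map_congr_left fun r hr => ?_
      obtain ⟨x, hx, rfl⟩ := (hU.mem_iff r).1 hr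
      simp [assignmentRow, hφ x hx, hF]
    rw [h1, hR.sum_eq, h2, hU.sum_eq prob F hF]

/-! ### The table has polynomial size -/

/-- Bounds on the length of a table, on its keys, powers and counts, and on the length of its
lists of values. The powers are bounded in the form `p * N ≤ Q`, so that splitting a row, which
replaces `p` by at most `p * p * N`, replaces `Q` by `Q * Q`. -/
structure Within (N l k Q c m : ℕ) (T : List Row) : Prop where
  length_le : T.length ≤ l
  key_le : ∀ r ∈ T, r.1 ≤ k
  power_le : ∀ r ∈ T, r.2.1 * N ≤ Q
  count_le : weightedSum (fun _ _ => 1) T ≤ c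
  width_le : ∀ r ∈ T, r.2.2.2.length ≤ m

theorem count_le_weightedSum {T : List Row} {r : Row} (hr : r ∈ T) :
    (r.2.2.1 : ℝ) ≤ weightedSum (fun _ _ => 1) T := by
  have h := List.single_le_sum (l := T.map fun r => (r.2.2.1 : ℝ) * 1) (fun y hy => by
    obtain ⟨r, -, rfl⟩ := List.mem_map.1 hy
    positivity) _ (List.mem_map.2 ⟨r, hr, rfl⟩)
  rwa [mul_one] at h

theorem length_splitTable (N v : ℕ) (os : List ℕ) (T : List Row) :
    (splitTable N v os T).length = T.length * os.length := by
  simp [splitTable, splitRow]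

theorem length_optValues_le (t : ℕ) : (optValues t).length ≤ 2 := by
  unfold optValues
  split_ifs <;> simp

theorem Within.splitTable {N l k Q c m : ℕ} {T : List Row} (h : Within N l k Q c m T) (v : ℕ)
    {os : List ℕ} (hos : os.length ≤ 2) (hN : 0 < N) :
    Within N (2 * l) k (Q * Q) (2 * c) m (splitTable N v os T) := by
  have hmem : ∀ r ∈ ExchInference.splitTable N v os T, ∃ s ∈ T, ∃ b,
      r = (s.1, s.2.1 * s.2.1 * (if b = 1 then N else 1), s.2.2.1, s.2.2.2.set v b) := by
    intro r hr
    obtain ⟨s, hs, hr⟩ := List.mem_flatMap.1 hr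
    obtain ⟨b, -, rfl⟩ := List.mem_map.1 hr
    exact ⟨s, hs, b, rfl⟩
  refine ⟨?_, fun r hr => ?_, fun r hr => ?_, ?_, fun r hr => ?_⟩
  · rw [length_splitTable, mul_comm]
    exact Nat.mul_le_mul hos h.length_le
  · obtain ⟨s, hs, b, rfl⟩ := hmem r hr
    exact h.key_le s hs
  · obtain ⟨s, hs, b, rfl⟩ := hmem r hr
    have := h.power_le s hs
    calc s.2.1 * s.2.1 * (if b = 1 then N else 1) * N ≤ s.2.1 * s.2.1 * N * N := by
          gcongr
          split_ifs <;> omega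
      _ = (s.2.1 * N) * (s.2.1 * N) := by ring
      _ ≤ Q * Q := Nat.mul_le_mul this this
  · rw [weightedSum_splitTable]
    have hc := h.count_le
    have : weightedSum (fun _ _ => (os.map fun _ => (1 : ℝ)).sum) T =
        os.length * weightedSum (fun _ _ => 1) T := by
      unfold weightedSum
      rw [← List.sum_map_mul_left]
      simp [mul_comm]
    rw [this]
    push_cast
    have h0 : 0 ≤ weightedSum (fun _ _ => 1) T := List.sum_nonneg fun y hy => by
      obtain ⟨r, -, rfl⟩ := List.mem_map.1 hy
      positivity
    have : (os.length : ℝ) ≤ 2 := by exact_mod_cast hos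
    exact mul_le_mul this hc h0 (by norm_num)
  · obtain ⟨s, hs, b, rfl⟩ := hmem r hr
    simpa using h.width_le s hs

theorem Within.splitBlock {N l k Q c m : ℕ} {T : List Row} (h : Within N l k Q c m T)
    (e B : List ℕ) (hN : 0 < N) :
    Within N (2 ^ B.length * l) k (Q ^ 2 ^ B.length) (2 ^ B.length * c) m
      (splitBlock N e T B) := by
  induction B generalizing T l Q c with
  | nil => simpa [ExchInference.splitBlock] using h
  | cons v B ih =>
    have := ih (h.splitTable v (length_optValues_le (e.getD v 2)) hN)
    convert this using 1
    · rw [List.length_cons]; ring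
    · rw [List.length_cons, ← pow_two, ← pow_mul]; ring_nf
    · rw [List.length_cons]; ring
    · rfl

theorem Within.mono {N l k Q c m l' k' Q' c' : ℕ} {T : List Row} (h : Within N l k Q c m T)
    (hl : l ≤ l') (hk : k ≤ k') (hQ : Q ≤ Q') (hc : c ≤ c') : Within N l' k' Q' c' m T :=
  ⟨h.length_le.trans hl, fun r hr => (h.key_le r hr).trans hk,
    fun r hr => (h.power_le r hr).trans hQ, h.count_le.trans (by exact_mod_cast hc), h.width_le⟩

theorem Within.fullStep {N l k c m w : ℕ} {T : List Row} (h : Within N l k N c m T)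
    (e : List ℕ) {B : List ℕ} (hB : B.length ≤ w) (hN : 0 < N) :
    Within N (2 ^ w * l) (k + N ^ 2 ^ w) N (2 ^ w * c) m (fullStep N e T B) := by
  have hw : 2 ^ B.length ≤ 2 ^ w := Nat.pow_le_pow_right (by norm_num) hB
  have h' := (h.splitBlock e B hN).mono (Nat.mul_le_mul_right l hw) le_rfl
    (Nat.pow_le_pow_right hN hw) (Nat.mul_le_mul_right c hw)
  refine ⟨by simpa [ExchInference.fullStep] using h'.length_le, fun r hr => ?_, fun r hr => ?_,
    ?_, fun r hr => ?_⟩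
  · obtain ⟨s, hs, rfl⟩ := List.mem_map.1 hr
    have := h'.key_le s hs
    have := (Nat.le_mul_of_pos_right s.2.1 hN).trans (h'.power_le s hs)
    simp only [closeRow]
    omega
  · obtain ⟨s, hs, rfl⟩ := List.mem_map.1 hr
    simp [closeRow]
  · rw [ExchInference.fullStep, weightedSum_closeRow]
    exact h'.count_le
  · obtain ⟨s, hs, rfl⟩ := List.mem_map.1 hr
    exact h'.width_le s hs

theorem length_insertRow_le (T : List Row) (r : Row) :
    (insertRow T r).length ≤ T.length + 1 := by
  unfold insertRow
  split_ifs <;> simp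

theorem length_foldl_insertRow_le (T A : List Row) :
    (T.foldl insertRow A).length ≤ A.length + T.length := by
  induction T generalizing A with
  | nil => simp
  | cons r T ih =>
    have := ih (insertRow A r)
    have := length_insertRow_le A r
    simp only [List.foldl_cons, List.length_cons]
    omega

theorem Within.take {N l k Q c m : ℕ} {T : List Row} (h : Within N l k Q c m T) (j : ℕ) :
    Within N l k Q c m (T.take j) := by
  refine ⟨(List.length_take_le' _ _).trans h.length_le,
    fun r hr => h.key_le r (List.mem_of_mem_take hr),
    fun r hr => h.power_le r (List.mem_of_mem_take hr), le_trans ?_ h.count_le,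
    fun r hr => h.width_le r (List.mem_of_mem_take hr)⟩
  unfold weightedSum
  conv_rhs => rw [← List.take_append_drop j T, List.map_append, List.sum_append]
  refine le_add_of_nonneg_right (List.sum_nonneg fun y hy => ?_)
  obtain ⟨r, -, rfl⟩ := List.mem_map.1 hy
  positivity

theorem Within.merge {N l k Q c m : ℕ} {T : List Row} (h : Within N l k Q c m T)
    (hT : ∀ r ∈ T, r.2.1 = 1) : Within N l k Q c m (T.foldl insertRow []) := by
  obtain ⟨-, h2, h3⟩ := merged_nil.foldl_insertRow hT
  simp only [List.nil_append] at h3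
  refine ⟨(length_foldl_insertRow_le _ _).trans (by simpa using h.length_le), fun r hr => ?_,
    fun r hr => ?_, ?_, fun r hr => ?_⟩
  · obtain ⟨s, hs, e1, e2, e3⟩ := h3 r hr
    rw [e1]; exact h.key_le s hs
  · obtain ⟨s, hs, e1, e2, e3⟩ := h3 r hr
    rw [e2]; exact h.power_le s hs
  · rw [h2]
    simpa [weightedSum] using h.count_le
  · obtain ⟨s, hs, e1, e2, e3⟩ := h3 r hr
    rw [e3]; exact h.width_le s hs

/-- Distinct keys up to `k` leave room for `k + 1` rows only, which keeps the length of the merged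
table polynomial. -/
theorem Within.orbitStep {N l k c m w : ℕ} {T : List Row} (h : Within N l k N c m T)
    (e : List ℕ) {B : List ℕ} (hB : B.length ≤ w) (hN : 0 < N) :
    Within N (k + N ^ 2 ^ w + 1) (k + N ^ 2 ^ w) N (2 ^ w * c) m (orbitStep N e T B) := by
  have h' : Within _ _ _ _ _ _ (ExchInference.orbitStep N e T B) :=
    (h.fullStep e hB hN).merge power_fullStep
  refine ⟨?_, h'.key_le, h'.power_le, h'.count_le, h'.width_le⟩
  have hnd := (merged_orbitStep N e T B).nodup
  rw [← List.length_map (f := Prod.fst), ← List.toFinset_card_of_nodup hnd]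
  refine (Finset.card_le_card (t := Finset.range (k + N ^ 2 ^ w + 1)) fun j hj => ?_).trans
    (by simp)
  obtain ⟨r, hr, rfl⟩ := List.mem_map.1 (List.mem_toFinset.1 hj)
  have := h'.key_le r hr
  simp only [Finset.mem_range]
  omega

theorem within_orbitTable {N w : ℕ} {e : List ℕ} {D : List (List ℕ)}
    (hD : ∀ B ∈ D, B.length ≤ w) (hN : 0 < N) :
    Within N (D.length * N ^ 2 ^ w + 1) (D.length * N ^ 2 ^ w) N (2 ^ (w * D.length)) e.length
      (orbitTable N e D) := by
  induction D using List.reverseRecOn with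
  | nil => constructor <;> simp [orbitTable, weightedSum]
  | append_singleton D B ih =>
    have := (ih fun C hC => hD C (by simp [hC])).orbitStep e (hD B (by simp)) hN
    rw [orbitTable, List.foldl_append, List.length_append]
    convert this using 1
    · rw [List.length_singleton]; ring
    · rw [List.length_singleton]; ring
    · rw [List.length_singleton]; ring
    · rfl

/-- Tables of size polynomial in `sz a`. -/
def TableBdd {α : Type*} (sz : α → ℕ) (T : α → List Row) : Prop :=
  ∃ B : α → ℕ, PolyBdd sz B ∧ ∀ a, (T a).length ≤ B a ∧ ∀ r ∈ T a,
    r.1 ≤ B a ∧ r.2.1 ≤ B a ∧ r.2.2.1 ≤ 2 ^ B a ∧ r.2.2.2.length ≤ B a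

theorem TableBdd.of_within {α : Type*} {sz N l k Q c m : α → ℕ} {T : α → List Row}
    (h : ∀ a, Within (N a) (l a) (k a) (Q a) (2 ^ c a) (m a) (T a)) (hN : ∀ a, 0 < N a)
    (hl : PolyBdd sz l) (hk : PolyBdd sz k) (hQ : PolyBdd sz Q) (hc : PolyBdd sz c)
    (hm : PolyBdd sz m) : TableBdd sz T := by
  refine ⟨fun a => l a + k a + Q a + c a + m a, (((hl.add hk).add hQ).add hc).add hm,
    fun a => ⟨(h a).length_le.trans ?_, fun r hr => ⟨?_, ?_, ?_, ?_⟩⟩⟩ <;> dsimp only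
  · omega
  · exact ((h a).key_le r hr).trans (by omega)
  · exact (Nat.le_mul_of_pos_right _ (hN a)).trans (((h a).power_le r hr).trans (by omega))
  · have h1 := (count_le_weightedSum hr).trans (h a).count_le
    have h2 : r.2.2.1 ≤ 2 ^ c a := by exact_mod_cast h1
    exact h2.trans (Nat.pow_le_pow_right (by norm_num) (by omega))
  · exact ((h a).width_le r hr).trans (by omega)

/-! ### The table is computed in polynomial time -/

namespace Comp

variable {C : CostModel} {α : Type*} {sz : α → ℕ} {i : α → Val}

theorem optValues {t : α → ℕ} (ht : Comp C sz i t) (bt : PolyBdd sz t) :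
    Comp C sz i fun a => optValues (t a) :=
  (ite (eqNat ht (constNat 2) (.of_polyBdd bt) (.of_polyBdd (.const 2)))
    (cons (constNat 0) (cons (constNat 1) nil)) (cons ht nil)).congr fun a => by
      simp [ExchInference.optValues]

theorem splitTable {N v : α → ℕ} {os : α → List ℕ} {T : α → List Row}
    (hN : Comp C sz i N) (hv : Comp C sz i v) (hos : Comp C sz i os) (hT : Comp C sz i T)
    (bN : PolyBdd sz N) (bv : PolyBdd sz v) (lo : ∀ a, (os a).length ≤ 2)
    (bo : ∀ a, ∀ b ∈ os a, b ≤ 2) (bT : TableBdd sz T) :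
    Comp C sz i fun a => splitTable (N a) (v a) (os a) (T a) := by
  obtain ⟨B, hB, bT⟩ := bT
  refine flatMap (f := fun a r => splitRow (N a) (v a) (os a) r) hT (hB.mono fun a => (bT a).1)
    ⟨fun _ => 2, .const 2, fun a r _ => by simpa [splitRow] using lo a⟩ ?_
  refine map (f := fun (x : {x : α × Row // x.2 ∈ T x.1}) b => (x.1.2.1,
    x.1.2.2.1 * x.1.2.2.1 * (if b = 1 then N x.1.1 else 1), x.1.2.2.2.1,
    x.1.2.2.2.2.set (v x.1.1) b)) (hos.env _) ((PolyBdd.const 2).mono fun x => lo x.1.1) ?_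
  have hB' := hB.reindex fun y : {y : {x : α × Row // x.2 ∈ T x.1} × ℕ // y.2 ∈ os y.1.1.1} =>
    y.1.1.1.1
  have row := fun y : {y : {x : α × Row // x.2 ∈ T x.1} × ℕ // y.2 ∈ os y.1.1.1} =>
    (bT y.1.1.1.1).2 _ y.1.1.2
  have bp := NumBdd.of_polyBdd (C := C) (hB'.mono fun y => (row y).2.1)
  have bN' := bN.reindex fun y : {y : {x : α × Row // x.2 ∈ T x.1} × ℕ // y.2 ∈ os y.1.1.1} =>
    y.1.1.1.1
  have hN' := (hN.env (v := fun x => enc x.1.2) fun x : {x : α × Row // x.2 ∈ T x.1} =>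
    x.1.1).env (v := fun y => enc y.1.2) fun y : {y : {x : α × Row // x.2 ∈ T x.1} × ℕ //
      y.2 ∈ os y.1.1.1} => y.1.1
  have hv' := (hv.env (v := fun x => enc x.1.2) fun x : {x : α × Row // x.2 ∈ T x.1} =>
    x.1.1).env (v := fun y => enc y.1.2) fun y : {y : {x : α × Row // x.2 ∈ T x.1} × ℕ //
      y.2 ∈ os y.1.1.1} => y.1.1
  have hr := (arg (C := C) (sz := fun x : {x : α × Row // x.2 ∈ T x.1} => sz x.1.1)
    (u := fun x => i x.1.1) (v := fun x => x.1.2)).env (v := fun y => enc y.1.2)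
      fun y : {y : {x : α × Row // x.2 ∈ T x.1} × ℕ // y.2 ∈ os y.1.1.1} => y.1.1
  have hfac := (ite (eqNat arg (constNat 1) (.of_polyBdd ((PolyBdd.const 2).mono fun y =>
    bo _ _ y.2)) (.of_polyBdd (.const 1))) hN' (constNat 1)).congr
      (y := fun y => if y.1.2 = 1 then N y.1.1.1.1 else 1) fun y => by simp
  refine mk hr.fst (mk (mulNat (mulNat hr.snd.fst hr.snd.fst bp bp)
    hfac (by simpa using bp.mul bp) (.of_polyBdd ((bN'.add (.const 1)).mono fun y => ?_)))
    (mk hr.snd.snd.fst (set hr.snd.snd.snd (hB'.mono fun y => (row y).2.2.2)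
      hv' (bv.reindex _) arg)))
  split_ifs <;> omega

theorem insertRow {T : α → List Row} {r : α → Row} (hT : Comp C sz i T) (hr : Comp C sz i r)
    (bT : TableBdd sz T) (br : TableBdd sz fun a => [r a]) :
    Comp C sz i fun a => insertRow (T a) (r a) := by
  obtain ⟨B, hB, bT⟩ := bT
  obtain ⟨B', hB', br⟩ := br
  have br' := fun a => (br a).2 (r a) (by simp)
  have hB1 := hB.reindex fun x : {x : α × Row // x.2 ∈ T x.1} => x.1.1
  have hB2 := hB'.reindex fun x : {x : α × Row // x.2 ∈ T x.1} => x.1.1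
  have row := fun x : {x : α × Row // x.2 ∈ T x.1} => (bT x.1.1).2 _ x.2
  have hlen := hB.mono fun a => (bT a).1
  have heq := eqNat (C := C) (i := fun x : {x : α × Row // x.2 ∈ T x.1} => .pair (i x.1.1)
    (enc x.1.2)) arg.fst (hr.env _).fst (.of_polyBdd (hB1.mono fun x => (row x).1))
    (.of_polyBdd (hB2.mono fun x => (br' x.1.1).1))
  exact ite (any hT hlen heq)
    (map (f := fun a (s : Row) => if decide (s.1 = (r a).1) then
      (s.1, s.2.1, s.2.2.1 + (r a).2.2.1, s.2.2.2) else s) hT hlen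
      (ite heq (mk arg.fst (mk arg.snd.fst (mk (addNat arg.snd.snd.fst (hr.env _).snd.snd.fst
        ⟨_, hB1, fun x => NumLE.natCast (row x).2.2.1⟩
        ⟨_, hB2, fun x => NumLE.natCast (br' x.1.1).2.2.1⟩) arg.snd.snd.snd))) arg))
    (cons hr hT)

end Comp

namespace Comp

variable {C : CostModel} {α : Type*} {sz : α → ℕ} {i : α → Val}

theorem splitBlock {N l k c m : α → ℕ} {e B : α → List ℕ} {T : α → List Row} {w : ℕ}
    (hN : Comp C sz i N) (he : Comp C sz i e) (hB : Comp C sz i B) (hT : Comp C sz i T)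
    (hN0 : ∀ a, 0 < N a) (bN : PolyBdd sz N) (le : PolyBdd sz fun a => (e a).length)
    (be : ∀ a, ∀ t ∈ e a, t ≤ 2) (lB : ∀ a, (B a).length ≤ w)
    (bB : ∃ V, PolyBdd sz V ∧ ∀ a, ∀ v ∈ B a, v ≤ V a)
    (bT : ∀ a, Within (N a) (l a) (k a) (N a) (2 ^ c a) (m a) (T a))
    (hl : PolyBdd sz l) (hk : PolyBdd sz k) (hc : PolyBdd sz c) (hm : PolyBdd sz m) :
    Comp C sz i fun a => splitBlock (N a) (e a) (T a) (B a) := by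
  obtain ⟨V, hV, bB⟩ := bB
  have he2 : ∀ a j, (e a).getD j 2 ≤ 2 := by
    intro a j
    by_cases hj : j < (e a).length
    · rw [List.getD_eq_getElem _ _ hj]
      exact be a _ (List.getElem_mem hj)
    · rw [List.getD_eq_default _ _ (not_lt.1 hj)]
  refine foldl (f := fun a T v => ExchInference.splitTable (N a) v
      (ExchInference.optValues ((e a).getD v 2)) T)
    (fun a T v => Within (N a) (2 ^ w * l a) (k a) (N a ^ 2 ^ w) (2 ^ (w + c a)) (m a) T ∧
      v ∈ B a) hB hT ((PolyBdd.const w).mono lB) (fun a j hj => ⟨?_, List.getElem_mem hj⟩) ?_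
  · have h := (bT a).splitBlock (e a) ((B a).take j) (hN0 a)
    have hw : 2 ^ ((B a).take j).length ≤ 2 ^ w := Nat.pow_le_pow_right (by norm_num)
      ((List.length_take_le' _ _).trans (lB a))
    refine h.mono (Nat.mul_le_mul_right _ hw) le_rfl (Nat.pow_le_pow_right (hN0 a) hw) ?_
    rw [pow_add]
    exact Nat.mul_le_mul_right _ hw
  · have bv := (hV.reindex fun x : {x : α × List Row × ℕ // Within (N x.1) (2 ^ w * l x.1)
      (k x.1) (N x.1 ^ 2 ^ w) (2 ^ (w + c x.1)) (m x.1) x.2.1 ∧ x.2.2 ∈ B x.1} => x.1.1).mono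
      (f := fun x => x.1.2.2) fun x => bB _ _ x.2.2
    refine splitTable (hN.env _) arg.snd (optValues (getD (he.env _) (le.reindex _) arg.snd bv
      (constNat 2)) ((PolyBdd.const 2).mono fun x => he2 _ _)) arg.fst (bN.reindex _) bv
      (fun x => length_optValues_le _) (fun x b hb => ?_) (.of_within (fun x => x.2.1)
        (fun x => hN0 _) (((PolyBdd.const (2 ^ w)).mul hl).reindex _) (hk.reindex _)
        ((bN.pow (2 ^ w)).reindex _) (((PolyBdd.const w).add hc).reindex _) (hm.reindex _))
    have := he2 x.1.1 x.1.2.2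
    unfold ExchInference.optValues at hb
    split_ifs at hb <;> simp only [List.mem_cons, List.not_mem_nil, or_false] at hb <;> omega

theorem closeRows {T : α → List Row} (hT : Comp C sz i T) (bT : TableBdd sz T) :
    Comp C sz i fun a => (T a).map closeRow := by
  obtain ⟨B, hB, bT⟩ := bT
  have hB' := hB.reindex fun x : {x : α × Row // x.2 ∈ T x.1} => x.1.1
  have row := fun x : {x : α × Row // x.2 ∈ T x.1} => (bT x.1.1).2 _ x.2
  exact map (f := fun _ => closeRow) hT (hB.mono fun a => (bT a).1)
    (mk (addNat arg.fst arg.snd.fst (.of_polyBdd (hB'.mono fun x => (row x).1))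
      (.of_polyBdd (hB'.mono fun x => (row x).2.1))) (mk (constNat 1) arg.snd.snd))

theorem orbitStep {N l k c m : α → ℕ} {e B : α → List ℕ} {T : α → List Row} {w : ℕ}
    (hN : Comp C sz i N) (he : Comp C sz i e) (hB : Comp C sz i B) (hT : Comp C sz i T)
    (hN0 : ∀ a, 0 < N a) (bN : PolyBdd sz N) (le : PolyBdd sz fun a => (e a).length)
    (be : ∀ a, ∀ t ∈ e a, t ≤ 2) (lB : ∀ a, (B a).length ≤ w)
    (bB : ∃ V, PolyBdd sz V ∧ ∀ a, ∀ v ∈ B a, v ≤ V a)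
    (bT : ∀ a, Within (N a) (l a) (k a) (N a) (2 ^ c a) (m a) (T a))
    (hl : PolyBdd sz l) (hk : PolyBdd sz k) (hc : PolyBdd sz c) (hm : PolyBdd sz m) :
    Comp C sz i fun a => orbitStep (N a) (e a) (T a) (B a) := by
  have hQ := bN.pow (2 ^ w)
  have bsplit : TableBdd sz fun a => ExchInference.splitBlock (N a) (e a) (T a) (B a) := by
    refine .of_within (fun a => ((bT a).splitBlock (e a) (B a) (hN0 a)).mono
      (l' := 2 ^ w * l a) (Q' := N a ^ 2 ^ w) (c' := 2 ^ (w + c a)) ?_ le_rfl ?_ ?_) hN0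
      ((PolyBdd.const _).mul hl) hk hQ ((PolyBdd.const w).add hc) hm
    · exact Nat.mul_le_mul_right _ (Nat.pow_le_pow_right (by norm_num) (lB a))
    · exact Nat.pow_le_pow_right (hN0 a) (Nat.pow_le_pow_right (by norm_num) (lB a))
    · rw [pow_add]
      exact Nat.mul_le_mul_right _ (Nat.pow_le_pow_right (by norm_num) (lB a))
  have hfull : Comp C sz i fun a => fullStep (N a) (e a) (T a) (B a) :=
    closeRows (splitBlock hN he hB hT hN0 bN le be lB bB bT hl hk hc hm) bsplit
  have bfull : ∀ a, Within (N a) (2 ^ w * l a) (k a + N a ^ 2 ^ w) (N a) (2 ^ (w + c a)) (m a)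
      (fullStep (N a) (e a) (T a) (B a)) := fun a => by
    rw [pow_add]
    exact (bT a).fullStep (e a) (lB a) (hN0 a)
  have hl' : PolyBdd sz fun a => 2 ^ w * l a := (PolyBdd.const _).mul hl
  have hk' := hk.add hQ
  have hc' : PolyBdd sz fun a => w + c a := (PolyBdd.const w).add hc
  refine foldl (f := fun _ => ExchInference.insertRow) (fun a A r =>
    Within (N a) (2 ^ w * l a) (k a + N a ^ 2 ^ w) (N a) (2 ^ (w + c a)) (m a) A ∧
      r ∈ fullStep (N a) (e a) (T a) (B a)) hfull nil (hl'.mono fun a => (bfull a).length_le)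
    (fun a j hj => ⟨((bfull a).take j).merge fun r hr =>
      power_fullStep r (List.mem_of_mem_take hr), List.getElem_mem hj⟩) ?_
  refine insertRow arg.fst arg.snd (.of_within (fun x => x.2.1) (fun x => hN0 _) (hl'.reindex _)
    (hk'.reindex _) (bN.reindex _) (hc'.reindex _) (hm.reindex _)) ?_
  obtain ⟨b, hb, hbT⟩ := TableBdd.of_within bfull hN0 hl' hk' bN hc' hm
  exact ⟨_, (hb.add (.const 1)).reindex _, fun x => ⟨by simp, fun r hr => by
    obtain rfl := List.mem_singleton.1 hr
    obtain ⟨h1, h2, h3, h4⟩ := (hbT x.1.1).2 _ x.2.2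
    exact ⟨by omega, by omega, h3.trans (Nat.pow_le_pow_right (by norm_num) (by omega)),
      by omega⟩⟩⟩

/-- The table of orbits for blocks of bounded width is computed in polynomial time. -/
theorem orbitTable {N : α → ℕ} {e : α → List ℕ} {D : α → List (List ℕ)} {w : ℕ}
    (hN : Comp C sz i N) (he : Comp C sz i e) (hD : Comp C sz i D)
    (hN0 : ∀ a, 0 < N a) (bN : PolyBdd sz N) (le : PolyBdd sz fun a => (e a).length)
    (be : ∀ a, ∀ t ∈ e a, t ≤ 2) (lD : PolyBdd sz fun a => (D a).length)
    (wD : ∀ a, ∀ B ∈ D a, B.length ≤ w)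
    (bD : ∃ V, PolyBdd sz V ∧ ∀ a, ∀ B ∈ D a, ∀ v ∈ B, v ≤ V a) :
    Comp C sz i (fun a => orbitTable (N a) (e a) (D a)) ∧
      TableBdd sz fun a => ExchInference.orbitTable (N a) (e a) (D a) := by
  have hk : PolyBdd sz fun a => (D a).length * N a ^ 2 ^ w := lD.mul (bN.pow _)
  have hl := hk.add (.const 1)
  have hc : PolyBdd sz fun a => w * (D a).length := (PolyBdd.const w).mul lD
  refine ⟨?_, .of_within (fun a => within_orbitTable (wD a) (hN0 a)) hN0 hl hk bN hc le⟩
  refine foldl (f := fun a => ExchInference.orbitStep (N a) (e a)) (fun a T B =>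
    Within (N a) ((D a).length * N a ^ 2 ^ w + 1) ((D a).length * N a ^ 2 ^ w) (N a)
      (2 ^ (w * (D a).length)) (e a).length T ∧ B ∈ D a) hD
    (cons (mk (constNat 0) (mk (constNat 1) (mk (constNat 1) he))) nil) lD
    (fun a j hj => ⟨?_, List.getElem_mem hj⟩) ?_
  · have h := within_orbitTable (e := e a) (D := (D a).take j)
      (fun B hB => wD a B (List.mem_of_mem_take hB)) (hN0 a)
    have hj := List.length_take_le' j (D a)
    have h1 := Nat.mul_le_mul_right (N a ^ 2 ^ w) hj
    exact h.mono (by omega) h1 le_rfl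
      (Nat.pow_le_pow_right (by norm_num) (Nat.mul_le_mul_left w hj))
  · obtain ⟨V, hV, bV⟩ := bD
    exact orbitStep (hN.env _) (he.env _) arg.snd arg.fst (fun x => hN0 _) (bN.reindex _)
      (le.reindex _) (fun x => be _) (fun x => wD _ _ x.2.2)
      ⟨_, hV.reindex _, fun x => bV _ _ x.2.2⟩ (fun x => x.2.1) (hl.reindex _) (hk.reindex _)
      (hc.reindex _) (le.reindex _)

end Comp

/-! ### Inference by weighted sums over orbits -/

section Interface

variable {C : CostModel} {α : Type*} {sz : α → ℕ} {i : α → Val} {τ : Type*} [Enc τ]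

theorem PolyTime.comp {o : α → Val} {x : α → τ} (h : PolyTime C sz i fun a out => out = o a)
    (hx : ∀ a, o a = enc (x a)) : Comp C sz i x := by
  obtain ⟨p, q, h⟩ := h
  refine ⟨p, q, fun a => ?_⟩
  obtain ⟨out, t, s, rfl, he, -, ht⟩ := h a
  exact ⟨t, by omega, hx a ▸ he⟩

theorem PolyTime.numBdd {x : α → ℝ} (h : PolyTime C sz i fun a out => out = .num (x a)) :
    NumBdd C sz x := by
  obtain ⟨p, q, h⟩ := h
  refine ⟨fun a => q.eval (sz a), ⟨q, fun _ => le_rfl⟩, fun a => ?_⟩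
  obtain ⟨out, t, s, rfl, -, hs, ht⟩ := h a
  refine (NumLE.of_numSize_le (s := s) ?_).mono (by dsimp only; omega)
  rw [← hs]
  exact le_self_add

theorem Comp.polyTime {o : α → Val} {spec : α → Val → Prop} (h : Comp C sz i o)
    (hs : ∃ B, PolyBdd sz B ∧ ∀ a, (o a).size C ≤ (B a : ℕ)) (ho : ∀ a, spec a (o a)) :
    PolyTime C sz i spec := by
  obtain ⟨p, q, h⟩ := h
  obtain ⟨B, ⟨q', hB⟩, hs⟩ := hs
  refine ⟨p, q + q', fun a => ?_⟩
  obtain ⟨t, ht, he⟩ := h a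
  obtain ⟨s, hs', hsB⟩ := ENat.le_natCast_iff.1 (hs a)
  refine ⟨o a, t, s, ho a, he, hs', ?_⟩
  have := hB a
  rw [Polynomial.eval_add]
  omega

end Interface

theorem size_num_le {C : CostModel} {B : ℕ} {x : ℝ} (h : NumLE C B x) :
    (Val.num x).size C ≤ (2 * B + 3 : ℕ) := by
  obtain ⟨s, hs, hsB⟩ := h.exists_numSize_eq
  rw [Val.size, hs]
  exact_mod_cast Nat.succ_le_succ hsB

theorem size_evList_le (C : CostModel) {n : ℕ} (e : Evidence n) :
    (enc (evList e)).size C ≤ (6 * n + 3 : ℕ) := by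
  have h2 : ∀ t : ℕ, t ≤ 2 → (encNat t).size C ≤ (5 : ℕ) := fun t ht =>
    size_num_le (NumLE.natCast (B := 1) (by simpa using ht))
  have h : ∀ l : List ℕ, (∀ t ∈ l, t ≤ 2) → (encList encNat l).size C ≤ (6 * l.length + 3 : ℕ) := by
    intro l
    induction l with
    | nil =>
      intro _
      simpa [encList] using size_num_le (C := C) (B := 0) (NumLE.natCast (k := 0) (by simp))
    | cons t l ih =>
      intro hl
      have h1 := h2 t (hl t (by simp))
      have h3 := ih fun t ht => hl t (by simp [ht])
      rw [encList, Val.size]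
      refine (add_le_add (add_le_add h1 h3) le_rfl).trans ?_
      norm_cast
      rw [List.length_cons]
      omega
  have := h (evList e) (evList_le e)
  rwa [length_evList] at this

theorem enc_blocks {n : ℕ} (D : Blocks n) :
    encBlocks D = enc (D.map (List.map Fin.val)) := by
  have h : ∀ B : List (Fin n), encList (fun i : Fin n => encNat (i : ℕ)) B =
      encList encNat (B.map Fin.val) := by
    intro B
    induction B with
    | nil => rfl
    | cons v B ih => rw [encList, ih]; rfl
  unfold encBlocks
  induction D with
  | nil => rfl
  | cons B D ih => rw [encList, ih, h]; rfl

theorem IsDecomposition.length_le {n : ℕ} {S : Finset (Fin n)} {D : Blocks n}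
    (h : IsDecomposition S D) : D.length ≤ n := by
  have h1 : D.length ≤ D.flatten.length := by
    have hne := h.2.2
    clear h
    induction D with
    | nil => simp
    | cons B D ih =>
      have := ih fun C hC => hne C (by simp [hC])
      have := List.length_pos_iff.2 (hne B (by simp))
      rw [List.flatten_cons, List.length_append, List.length_cons]
      omega
  have h2 := h.1.length_le_card
  rw [Fintype.card_fin] at h2
  omega

theorem prEv_some {n : ℕ} (prob : Assignment n → ℝ) (x : Assignment n) :
    prEv prob (fun i => some (x i)) = prob x := by
  unfold prEv
  rw [Finset.sum_eq_single x]
  · intro z hz hne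
    refine absurd (funext fun i => ?_) hne
    simpa [eq_comm] using (Finset.mem_filter.1 hz).2 i
  · intro h
    simp at h

/-- The probability of the evidence listed in `l`. -/
noncomputable def listPr {n : ℕ} (prob : Assignment n → ℝ) (l : List ℕ) : ℝ :=
  prEv prob (Function.invFun evList l)

theorem listPr_evList {n : ℕ} (prob : Assignment n → ℝ) (e : Evidence n) :
    listPr prob (evList e) = prEv prob e := by
  rw [listPr, Function.leftInverse_invFun fun _ _ => evList_injective]

/-- Exchangeability in terms of keys. -/
theorem IsExchangeableGiven.prEv_eq {n N : ℕ} {prob : Assignment n → ℝ} {y : Evidence n}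
    {S : Finset (Fin n)} {D : Blocks n} (h : IsExchangeableGiven prob y S D) (hN : n < N)
    {x x' : Assignment n} (hx : Agrees x y) (hx' : Agrees x' y) (hk : key N D x' = key N D x) :
    prEv prob (restrict x' (y.dom ∪ S)) = prEv prob (restrict x (y.dom ∪ S)) := by
  obtain ⟨π, hπ⟩ := exists_perm_of_key_eq (h.1.length_le.trans_lt hN) h.2.1 hk
  exact h.2.2 π x x' hx hx' hπ

theorem dom_restrict {n : ℕ} (x : Assignment n) (S : Finset (Fin n)) :
    (restrict x S).dom = S := by
  ext i
  by_cases h : i ∈ S <;> simp [Evidence.dom, restrict, h]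

/-- If the values `G` at the rows of a table are computable, so is their sum weighted with the
counts. -/
theorem Comp.weightedSum {C : CostModel} {α : Type*} {sz : α → ℕ} {i : α → Val}
    {T : α → List Row} {G : α → List ℕ → ℝ} (hT : Comp C sz i T) (bT : TableBdd sz T)
    (hG : Comp C (fun x : {x : α × Row // x.2 ∈ T x.1} => sz x.1.1)
      (fun x => .pair (i x.1.1) (enc x.1.2.2.2.2)) fun x => G x.1.1 x.1.2.2.2.2)
    (bG : NumBdd C (fun x : {x : α × Row // x.2 ∈ T x.1} => sz x.1.1)
      fun x => G x.1.1 x.1.2.2.2.2) :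
    Comp C sz i (fun a => ((T a).map fun r => (r.2.2.1 : ℝ) * G a r.2.2.2).sum) ∧
      NumBdd C sz fun a => ((T a).map fun r => (r.2.2.1 : ℝ) * G a r.2.2.2).sum := by
  obtain ⟨B, hB, bT⟩ := bT
  have hlen := hB.mono fun a => (bT a).1
  have bc : NumBdd C (fun x : {x : α × Row // x.2 ∈ T x.1} => sz x.1.1)
      fun x => (x.1.2.2.2.1 : ℝ) :=
    ⟨_, hB.reindex _, fun x => NumLE.natCast ((bT x.1.1).2 _ x.2).2.2.1⟩
  have hb : ListNumBdd C sz fun a => (T a).map fun r => (r.2.2.1 : ℝ) * G a r.2.2.2 := by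
    obtain ⟨B', ⟨q, hq⟩, h'⟩ := bc.mul bG
    refine ⟨fun a => q.eval (sz a), ⟨q, fun _ => le_rfl⟩, fun a x hx => ?_⟩
    obtain ⟨r, hr, rfl⟩ := List.mem_map.1 hx
    exact (h' ⟨(a, r), hr⟩).mono (hq ⟨(a, r), hr⟩)
  have hlen' : PolyBdd sz fun a => ((T a).map fun r => (r.2.2.1 : ℝ) * G a r.2.2.2).length := by
    simpa using hlen
  refine ⟨listSum (map (f := fun a r => (r.2.2.1 : ℝ) * G a r.2.2.2) hT hlen
    (mulReal arg.snd.snd.fst.natCast ?_ bc bG)) hlen' hb, .list_sum hlen' hb⟩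
  exact hG.comp (mkVal (fstVal id) arg.snd.snd.snd.toVal)

section Model

variable {ι : Type*} {C : CostModel} {F : ι → Model}

/-- The number of variables is part of the input. -/
theorem Comp.modelSize {α : Type*} {sz : α → ℕ} (g : α → ι) {v : α → Val} :
    Comp C sz (fun a => .pair (F (g a)).input (v a)) fun a => (F (g a)).n :=
  Comp.fstVal (Comp.sndVal (u := fun a => (F (g a)).code) (Comp.fstVal Comp.id))

theorem Comp.blocksY {α : Type*} {sz : α → ℕ} (g : α → ι) {v : α → Val} :
    Comp C sz (fun a => .pair (F (g a)).input (v a))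
      fun a => (F (g a)).blocksY.map (List.map Fin.val) :=
  (Comp.sndVal (Comp.sndVal (u := fun a => (F (g a)).code)
    (Comp.fstVal Comp.id))).cast fun _ => enc_blocks _

theorem Comp.evidence {α : Type*} {sz : α → ℕ} (g : α → ι) (e : ∀ a, Evidence (F (g a)).n) :
    Comp C sz (fun a => .pair (F (g a)).input (encEvidence (e a))) fun a => evList (e a) :=
  (Comp.sndVal (u := fun a => (F (g a)).input) Comp.id).cast fun _ => (enc_evList _).symm

/-- The table of orbits for evidence on models of the family is computed in polynomial time. -/
theorem Comp.modelTable {α : Type*} (g : α → ι) (e : ∀ a, Evidence (F (g a)).n)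
    (D : ∀ a, Blocks (F (g a)).n) {w : ℕ} (hD : ∀ a, (D a).length ≤ (F (g a)).n)
    (hw : ∀ a, WidthLE (D a) w)
    (cD : Comp C (fun a => (F (g a)).n) (fun a => .pair (F (g a)).input (encEvidence (e a)))
      fun a => (D a).map (List.map Fin.val)) :
    Comp C (fun a => (F (g a)).n) (fun a => .pair (F (g a)).input (encEvidence (e a)))
      (fun a => ExchInference.orbitTable ((F (g a)).n + 1) (evList (e a))
        ((D a).map (List.map Fin.val))) ∧
    TableBdd (fun a => (F (g a)).n)
      fun a => ExchInference.orbitTable ((F (g a)).n + 1) (evList (e a))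
        ((D a).map (List.map Fin.val)) := by
  refine Comp.orbitTable (w := w) (Comp.addNat (Comp.modelSize g) (Comp.constNat 1)
    (.of_polyBdd .self) (.of_polyBdd (.const 1))) (Comp.evidence g e) cD (fun _ => by omega)
    (PolyBdd.self.add (.const 1)) (by simpa using PolyBdd.self) (fun a => evList_le _)
    (by simpa using PolyBdd.self.mono hD) (fun a B hB => ?_)
    ⟨_, .self, fun a B hB v hv => ?_⟩
  · obtain ⟨B, hB', rfl⟩ := List.mem_map.1 hB
    simpa using hw a B hB'
  · obtain ⟨B, hB, rfl⟩ := List.mem_map.1 hB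
    obtain ⟨v, -, rfl⟩ := List.mem_map.1 hv
    exact v.2.le

/-- The probabilities of full assignments to `Y` are computed in polynomial time, and they have
polynomial bit length. -/
def YProbComp (C : CostModel) (F : ι → Model) : Prop :=
  Comp C (fun a : YAssignment F => (F a.1).n)
    (fun a => .pair (F a.1).input (encEvidence a.2.1))
    (fun a => prEv (F a.1).prob a.2.1) ∧
  NumBdd C (fun a : YAssignment F => (F a.1).n) fun a => prEv (F a.1).prob a.2.1

theorem override_eq_some {M : Model} {y : Evidence M.n} (hy : y.dom = M.Y) {x : Assignment M.n}
    (hx : Agrees x y) {L : List (Fin M.n)} (hL : L.toFinset = M.Z) :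
    override y x L = fun i => some (x i) := by
  rw [override_eq_restrict hx hL, hy, Model.Z, Finset.union_sdiff_of_subset (Finset.subset_univ _)]
  funext i
  simp [restrict]

theorem yProbComp_of_exchangeable (hZ : EffExchangeablyDecomposable C F) (hPr : EffProb C F) :
    YProbComp C F := by
  obtain ⟨w, D, hD, cD⟩ := hZ
  have hT := Comp.modelTable (C := C) (fun a : YAssignment F => a.1) (fun a => a.2.1) D
    (fun a => (hD a).1.1.length_le) (fun a => (hD a).2) (cD.comp fun a => enc_blocks _)
  set T := fun a : YAssignment F => orbitTable ((F a.1).n + 1) (evList a.2.1)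
    ((D a).map (List.map Fin.val)) with hTdef
  have spec := fun a : YAssignment F => orbitTable_spec ((F a.1).n + 1) a.2.1 (D a) (hD a).1.1.1
  -- The rows contain full assignments, to which the program for `Pr` applies.
  have full : ∀ x : {x : YAssignment F × Row // x.2 ∈ T x.1}, ∃ z : Assignment (F x.1.1.1).n,
      x.1.2.2.2.2 = evList fun i => some (z i) := fun x => by
    obtain ⟨z, hz, -, hE⟩ := (spec x.1.1).1 _ x.2
    exact ⟨z, by rw [hE, override_eq_some x.1.1.2.2 hz (hD x.1.1).1.1.2.1]⟩
  choose z hz using full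
  have hprob : ∀ x, (F x.1.1.1).prob (z x) = listPr (F x.1.1.1).prob x.1.2.2.2.2 := fun x => by
    rw [hz, listPr_evList, prEv_some]
  let g : {x : YAssignment F × Row // x.2 ∈ T x.1} → Σ i, Assignment (F i).n :=
    fun x => ⟨x.1.1.1, z x⟩
  have h1 := ((PolyTime.comp (x := fun a : Σ i, Assignment (F i).n => (F a.1).prob a.2) hPr
    fun _ => rfl).reindex g).congr hprob
  have h2 : NumBdd C (fun x => (F (g x).1).n) _ := (PolyTime.numBdd hPr).reindex g
  have key := Comp.weightedSum (G := fun a => listPr (F a.1).prob) hT.1 hT.2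
    (h1.comp (Comp.mkVal (Comp.fstVal (Comp.fstVal Comp.id)) ?_)) ?_
  · have hsum : ∀ a : YAssignment F, ((T a).map fun r =>
        (r.2.2.1 : ℝ) * listPr (F a.1).prob r.2.2.2).sum = prEv (F a.1).prob a.2.1 := fun a => by
      refine (spec a).2.2 (F a.1).prob (listPr (F a.1).prob) (listPr_evList _)
        fun x x' hx hx' hk => ?_
      rw [override_eq_restrict hx (hD a).1.1.2.1, override_eq_restrict hx' (hD a).1.1.2.1]
      exact (hD a).1.prEv_eq (Nat.lt_succ_self _) hx hx' hk
    simp only [hsum] at key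
    exact key
  · exact (Comp.sndVal Comp.id).congr fun x => by
      rw [← enc_evList_some, ← hz]
  · obtain ⟨B, hB, hb⟩ := h2
    exact ⟨B, hB, fun x => by simpa only [← hprob] using hb x⟩

end Model

/-! ### Independent decompositions: the product formula -/

/-- All bit lists of length `k`. -/
def allBits : ℕ → List (List Bool)
  | 0 => [[]]
  | k + 1 => (allBits k).map (List.cons false) ++ (allBits k).map (List.cons true)

theorem mem_allBits {k : ℕ} {l : List Bool} : l ∈ allBits k ↔ l.length = k := by
  induction k generalizing l with
  | zero => simp [allBits]
  | succ k ih =>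
    rcases l with _ | ⟨_ | _, l⟩ <;> simp [allBits, ih]

/-- The evidence `e` with the values `l` assigned to the variables in `B`. -/
def setBits {n : ℕ} (e : Evidence n) : List (Fin n) → List Bool → Evidence n
  | v :: B, b :: l => setBits (Function.update e v (some b)) B l
  | _, _ => e

theorem setBits_of_notMem {n : ℕ} {e : Evidence n} {B : List (Fin n)} {l : List Bool} {i : Fin n}
    (hi : i ∉ B) : setBits e B l i = e i := by
  induction B generalizing e l with
  | nil => rfl
  | cons v B ih =>
    rcases l with _ | ⟨b, l⟩
    · rfl
    · rw [List.mem_cons, not_or] at hi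
      rw [setBits, ih hi.2]
      simp [hi.1]

theorem setBits_ne_none {n : ℕ} {e : Evidence n} {B : List (Fin n)} {l : List Bool} {i : Fin n}
    (hl : l.length = B.length) (hi : i ∈ B ∨ e i ≠ none) : setBits e B l i ≠ none := by
  induction B generalizing e l with
  | nil => simpa [setBits] using hi
  | cons v B ih =>
    rcases l with _ | ⟨b, l⟩
    · simp at hl
    · refine ih (by simpa using hl) ?_
      by_cases hv : i = v
      · right; simp [hv]
      · simpa [hv] using hi

theorem agrees_setBits {n : ℕ} {e : Evidence n} {B : List (Fin n)} (hB : B.Nodup) {l : List Bool}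
    (hl : l.length = B.length) (he : ∀ i ∈ B, e i = none) {x : Assignment n}
    (h : Agrees x (setBits e B l)) : Agrees x e ∧ B.map x = l := by
  induction B generalizing e l with
  | nil => exact ⟨h, (List.eq_nil_of_length_eq_zero hl).symm⟩
  | cons v B ih =>
    rcases l with _ | ⟨b, l⟩
    · simp at hl
    · rw [List.nodup_cons] at hB
      obtain ⟨h1, h2⟩ := ih hB.2 (by simpa using hl) (fun i hi => by
        have : i ≠ v := fun hiv => hB.1 (hiv ▸ hi)
        simpa [this] using he i (by simp [hi])) h
      refine ⟨fun i => ?_, ?_⟩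
      · by_cases hv : i = v
        · exact .inl (he i (by simp [hv]))
        · simpa [hv] using h1 i
      · have := h1 v
        simp only [Function.update_self, reduceCtorEq, Option.some.injEq, false_or] at this
        rw [List.map_cons, h2, this]

theorem prEv_eq_sum_setBits {n : ℕ} (prob : Assignment n → ℝ) {e : Evidence n}
    {B : List (Fin n)} (hB : B.Nodup) (he : ∀ i ∈ B, e i = none) :
    prEv prob e = ((allBits B.length).map fun l => prEv prob (setBits e B l)).sum := by
  induction B generalizing e with
  | nil => simp [allBits, setBits]
  | cons v B ih =>
    rw [List.nodup_cons] at hB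
    have he' : ∀ b, ∀ i ∈ B, Function.update e v (some b) i = none := fun b i hi => by
      have : i ≠ v := fun hiv => hB.1 (hiv ▸ hi)
      simpa [this] using he i (by simp [hi])
    rw [prEv_eq_add prob (he v (by simp)), ih hB.2 (he' _), ih hB.2 (he' _), List.length_cons,
      allBits, List.map_append, List.sum_append, List.map_map, List.map_map]
    rfl

/-- Distributivity: if the probabilities of the completions of `e` are products over blocks, the
blocks can be summed out separately. -/
theorem prEv_eq_prod {n : ℕ} (prob : Assignment n → ℝ)
    (P : List (List (Fin n) × (List Bool → ℝ))) (e : Evidence n) (c : ℝ)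
    (hP : (P.map Prod.fst).flatten.Nodup) (he : ∀ i, e i = none ↔ i ∈ (P.map Prod.fst).flatten)
    (h : ∀ x, Agrees x e → prob x = c * (P.map fun t => t.2 (t.1.map x)).prod) :
    prEv prob e = c * (P.map fun t => ((allBits t.1.length).map t.2).sum).prod := by
  induction P generalizing e c with
  | nil =>
    obtain ⟨x, hx⟩ := exists_agrees e
    have : e = fun i => some (x i) := funext fun i => (hx i).resolve_left fun h0 => by
      simpa using (he i).1 h0
    rw [this, prEv_some, h x hx]
    simp
  | cons t P ih =>
    obtain ⟨B, q⟩ := t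
    simp only [List.map_cons, List.flatten_cons, List.nodup_append] at hP
    have hB : ∀ i ∈ B, e i = none := fun i hi => (he i).2 (by simp [hi])
    have step : ∀ l ∈ allBits B.length, prEv prob (setBits e B l) =
        q l * (c * (P.map fun t => ((allBits t.1.length).map t.2).sum).prod) := by
      intro l hl
      have hl := mem_allBits.1 hl
      rw [← mul_assoc, mul_comm (q l)]
      refine ih _ _ hP.2.1 (fun i => ?_) fun x hx => ?_
      · by_cases hi : i ∈ B
        · refine iff_of_false (setBits_ne_none hl (.inl hi)) fun hi' => hP.2.2 i hi i hi' rfl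
        · rw [setBits_of_notMem hi, he i]
          simp [hi]
      · obtain ⟨h1, h2⟩ := agrees_setBits hP.1 hl hB hx
        rw [h x h1, List.map_cons, List.prod_cons, h2]
        ring
    rw [prEv_eq_sum_setBits prob hP.1 hB, List.map_congr_left step, List.sum_map_mul_right,
      List.map_cons, List.prod_cons]
    ring

/-- Assignments to disjoint blocks have a common extension. -/
theorem exists_assignment {n : ℕ} (x₀ : Assignment n) (P : List (List (Fin n) × List Bool))
    (hP : (P.map Prod.fst).flatten.Nodup) (hl : ∀ t ∈ P, t.2.length = t.1.length) :
    ∃ x : Assignment n, (∀ t ∈ P, t.1.map x = t.2) ∧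
      ∀ i ∉ (P.map Prod.fst).flatten, x i = x₀ i := by
  induction P with
  | nil => exact ⟨x₀, by simp, fun _ _ => rfl⟩
  | cons t P ih =>
    simp only [List.map_cons, List.flatten_cons, List.nodup_append] at hP
    obtain ⟨x, h1, h2⟩ := ih hP.2.1 fun t ht => hl t (by simp [ht])
    refine ⟨fun i => if i ∈ t.1 then t.2.getD (t.1.idxOf i) false else x i, fun s hs => ?_,
      fun i hi => ?_⟩
    · rcases List.mem_cons.1 hs with rfl | hs
      · refine List.ext_getElem (by simp [hl s]) fun j hj1 hj2 => ?_
        rw [List.length_map] at hj1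
        simp [hP.1.idxOf_getElem, hj2]
      · rw [← h1 s hs]
        refine List.map_congr_left fun i hi => if_neg fun hi' => hP.2.2 i hi' i ?_ rfl
        exact List.mem_flatten.2 ⟨s.1, List.mem_map.2 ⟨s, hs, rfl⟩, hi⟩
    · simp only [List.map_cons, List.flatten_cons, List.mem_append, not_or] at hi
      dsimp only
      rw [if_neg hi.1, h2 i hi.2]

/-! ### Independent decompositions: the algorithm -/

/-- All lists of `B.length` binary digits. -/
def digitLists (B : List ℕ) : List (List ℕ) :=
  B.foldl (fun O _ => O.map (List.cons 0) ++ O.map (List.cons 1)) [[]]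

theorem digitLists_eq (B : List ℕ) :
    digitLists B = (allBits B.length).map (List.map Bool.toNat) := by
  have h : ∀ k, B.foldl (fun O _ => O.map (List.cons 0) ++ O.map (List.cons 1))
      ((allBits k).map (List.map Bool.toNat)) =
        (allBits (k + B.length)).map (List.map Bool.toNat) := by
    induction B with
    | nil => simp
    | cons v B ih =>
      intro k
      rw [List.foldl_cons, List.length_cons, show k + (B.length + 1) = k + 1 + B.length by omega,
        ← ih (k + 1), allBits]
      congr 1
      simp [Function.comp_def]
  simpa [allBits, digitLists] using h 0

theorem length_allBits (k : ℕ) : (allBits k).length = 2 ^ k := by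
  induction k with
  | zero => rfl
  | succ k ih => rw [allBits, List.length_append, List.length_map, List.length_map, ih]; ring

/-- The first entry with nonzero value, or the last entry if all values vanish. -/
noncomputable def selectNonzero (L : List (ℝ × List ℕ)) : ℝ × List ℕ :=
  L.foldl (fun s t => if s.1 = 0 then t else s) (0, [])

theorem selectNonzero_spec {L : List (ℝ × List ℕ)} (hL : L ≠ []) :
    selectNonzero L ∈ L ∧ ((selectNonzero L).1 = 0 → ∀ t ∈ L, t.1 = 0) := by
  unfold selectNonzero
  induction L using List.reverseRecOn with
  | nil => exact absurd rfl hL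
  | append_singleton L t ih =>
    rw [List.foldl_append, List.foldl_cons, List.foldl_nil]
    rcases L.eq_nil_or_concat' with rfl | ⟨L', t', hL'⟩
    · simp
    · obtain ⟨h1, h2⟩ := ih (by simp [hL'])
      split_ifs with h
      · refine ⟨by simp, fun h0 s hs => ?_⟩
        rcases List.mem_append.1 hs with hs | hs
        · exact h2 h s hs
        · rw [List.mem_singleton.1 hs, h0]
      · exact ⟨List.mem_append_left _ h1, fun h0 => absurd h0 h⟩

/-- Assign the digits `l` to the variables in `B`. -/
def assignBlock (E B l : List ℕ) : List ℕ :=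
  B.zipIdx.foldl (fun E t => E.set t.1 (l.getD t.2 0)) E

theorem length_assignBlock (E B l : List ℕ) : (assignBlock E B l).length = E.length := by
  unfold assignBlock
  induction B.zipIdx generalizing E with
  | nil => rfl
  | cons t L ih => rw [List.foldl_cons, ih, List.length_set]

theorem assignBlock_evList {n : ℕ} (e : Evidence n) (x : Assignment n) (L B : List (Fin n)) :
    assignBlock (evList (override e x L)) (B.map Fin.val) ((B.map x).map Bool.toNat) =
      evList (override e x (L ++ B)) := by
  have h : ∀ (B L : List (Fin n)) (k : ℕ) (l : List ℕ),
      (∀ j (hj : j < B.length), l.getD (k + j) 0 = (x B[j]).toNat) →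
      ((B.map Fin.val).zipIdx k).foldl (fun E t => E.set t.1 (l.getD t.2 0))
        (evList (override e x L)) = evList (override e x (L ++ B)) := by
    intro B
    induction B with
    | nil => simp
    | cons v B ih =>
      intro L k l hl
      have h0 := hl 0 (by simp)
      simp only [add_zero, List.getElem_cons_zero] at h0
      rw [List.map_cons, List.zipIdx_cons, List.foldl_cons]
      simp only
      rw [h0, evList_set, ← override_concat, ih (L ++ [v]) (k + 1) l fun j hj => ?_]
      · simp
      · have := hl (j + 1) (by simpa using hj)
        simpa [add_assoc, add_comm 1 j] using this
  refine h B L 0 _ fun j hj => ?_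
  simp [hj]

/-- From the blocks, paired with the values and the digits of all assignments to the block, one
obtains a full assignment that gives a nonzero value to each factor that has one. -/
noncomputable def selectAssignment (e : List ℕ) (W : List (List ℕ × List (ℝ × List ℕ))) :
    List ℕ :=
  W.foldl (fun E t => assignBlock E t.1 (selectNonzero t.2).2) e

theorem selectAssignment_evList {n : ℕ} (e : Evidence n) (x : Assignment n)
    (D : Blocks n) (W : List (List ℕ × List (ℝ × List ℕ)))
    (h : List.Forall₂ (fun (B : List (Fin n)) (t : List ℕ × List (ℝ × List ℕ)) =>
      t.1 = B.map Fin.val ∧ (selectNonzero t.2).2 = (B.map x).map Bool.toNat) D W) :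
    selectAssignment (evList e) W = evList (override e x D.flatten) := by
  have key : ∀ L : List (Fin n), selectAssignment (evList (override e x L)) W =
      evList (override e x (L ++ D.flatten)) := by
    induction h with
    | nil => simp [selectAssignment]
    | @cons B _ _ _ ht _ ih =>
      intro L
      have := ih (L ++ B)
      rw [← assignBlock_evList, ← ht.1, ← ht.2] at this
      simpa [selectAssignment] using this
  have h0 : override e x [] = e := by funext i; simp [override]
  simpa [h0] using key []

/-- The probability of `y` from the values of the factors and the value `p` of the selected full
assignment. If the product of the selected values vanishes, so does the value of some factor at
all assignments to its block, and both sides of the formula are zero. -/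
noncomputable def factorFormula (p : ℝ) (W : List (List ℕ × List (ℝ × List ℕ))) : ℝ :=
  p / (W.map fun t => (selectNonzero t.2).1).prod * (W.map fun t => (t.2.map Prod.fst).sum).prod

/-- For each block its variables and, for each assignment to the block, the value of its factor and
the digits of the assignment. -/
def factorTable {n : ℕ} (D : Blocks n) (Q : Fin D.length → List Bool → ℝ) :
    List (List ℕ × List (ℝ × List ℕ)) :=
  List.ofFn fun l => ((D.get l).map Fin.val,
    (allBits (D.get l).length).map fun b => (Q l b, b.map Bool.toNat))

/-- The constant `c` of proportionality is recovered: the selected assignment `x` has probability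
`c` times the product of the selected factor values. -/
theorem factorFormula_spec {M : Model} {y : Evidence M.n} (hy : y.dom = M.Y) {D : Blocks M.n}
    {Q : Fin D.length → List Bool → ℝ} (h : IsIndependentGiven M.prob y M.Z D Q) :
    ∃ x : Assignment M.n, selectAssignment (evList y) (factorTable D Q) =
        evList (fun i => some (x i)) ∧
      factorFormula (M.prob x) (factorTable D Q) = prEv M.prob y := by
  obtain ⟨⟨hnd, hDZ, -⟩, c, hc⟩ := h
  let vals : Fin D.length → List (ℝ × List ℕ) := fun l =>
    (allBits (D.get l).length).map fun b => (Q l b, b.map Bool.toNat)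
  have hne : ∀ l, vals l ≠ [] := fun l h0 => by
    have := congrArg List.length h0
    simp [vals, length_allBits] at this
  have hsel : ∀ l, ∃ b : List Bool, b.length = (D.get l).length ∧
      selectNonzero (vals l) = (Q l b, b.map Bool.toNat) := fun l => by
    obtain ⟨b, hb, he⟩ := List.mem_map.1 (selectNonzero_spec (hne l)).1
    exact ⟨b, mem_allBits.1 hb, he.symm⟩
  choose b hb hsel using hsel
  obtain ⟨x₀, hx₀⟩ := exists_agrees y
  have hfst : (List.ofFn fun l => (D.get l, b l)).map Prod.fst = D := by
    rw [List.map_ofFn]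
    exact List.ofFn_get D
  obtain ⟨x, hx, hx'⟩ := exists_assignment x₀ (List.ofFn fun l => (D.get l, b l))
    (by rwa [hfst]) (fun t ht => by
      obtain ⟨l, rfl⟩ := (List.mem_ofFn' _ _).1 ht
      exact hb l)
  rw [hfst] at hx'
  have hxb : ∀ l, (D.get l).map x = b l := fun l => hx (D.get l, b l)
    ((List.mem_ofFn' _ _).2 ⟨l, rfl⟩)
  have hnone : ∀ i, y i = none ↔ i ∈ D.flatten := fun i => by
    rw [← List.mem_toFinset, hDZ, Model.Z, ← hy]
    simp [Evidence.dom]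
  have hxy : Agrees x y := fun i => by
    by_cases hi : i ∈ D.flatten
    · exact .inl ((hnone i).2 hi)
    · rw [hx' i hi]
      exact hx₀ i
  have hfull : ∀ x, Agrees x y → M.prob x = c * ∏ l, Q l ((D.get l).map x) := fun x hx => by
    rw [← hc x hx, ← override_eq_restrict hx hDZ, override_eq_some hy hx hDZ, prEv_some]
  refine ⟨x, ?_, ?_⟩
  · rw [selectAssignment_evList y x D, override_eq_some hy hxy hDZ]
    refine List.forall₂_iff_get.2 ⟨by simp [factorTable], fun j hj1 hj2 => ?_⟩
    have hs := hsel ⟨j, hj1⟩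
    have hx := hxb ⟨j, hj1⟩
    simp only [vals, List.get_eq_getElem] at hs hx
    simp [factorTable, hs, hx]
  · have hprod := prEv_eq_prod M.prob (List.ofFn fun l => (D.get l, Q l)) y c
      (by rw [List.map_ofFn]; exact (List.ofFn_get D).symm ▸ hnd)
      (fun i => by rw [List.map_ofFn, hnone i]; exact (List.ofFn_get D).symm ▸ Iff.rfl)
      (fun x hx => by rw [hfull x hx, List.map_ofFn, List.prod_ofFn]; rfl)
    rw [List.map_ofFn, List.prod_ofFn] at hprod
    have hS : ∀ l, ((vals l).map Prod.fst).sum = ((allBits (D.get l).length).map (Q l)).sum :=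
      fun l => by simp [vals, Function.comp_def]
    have hform : factorFormula (M.prob x) (factorTable D Q) =
        M.prob x / (∏ l, Q l (b l)) * ∏ l, ((vals l).map Prod.fst).sum := by
      rw [factorFormula, factorTable, List.map_ofFn, List.map_ofFn, List.prod_ofFn,
        List.prod_ofFn]
      congr 2
      exact Finset.prod_congr rfl fun l _ => congrArg Prod.fst (hsel l)
    rw [hform, hprod, hfull x hxy]
    simp only [hxb, Function.comp_def]
    rw [Finset.prod_congr rfl fun l _ => hS l]
    by_cases h0 : ∏ l, Q l (b l) = 0
    · obtain ⟨l, -, hl⟩ := Finset.prod_eq_zero_iff.1 h0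
      have hz := (selectNonzero_spec (hne l)).2 (by rw [hsel l]; exact hl)
      have : ((allBits (D.get l).length).map (Q l)).sum = 0 := by
        rw [← hS]
        refine List.sum_eq_zero fun v hv => ?_
        obtain ⟨t, ht, rfl⟩ := List.mem_map.1 hv
        exact hz t ht
      have hS0 : ∏ l, ((allBits (D.get l).length).map (Q l)).sum = 0 :=
        Finset.prod_eq_zero (Finset.mem_univ l) this
      rw [hS0, mul_zero, mul_zero]
    · rw [mul_div_cancel_right₀ _ h0]

/-- Bounds on the length of a table of factor values, on its blocks, values and digit lists. -/
def FactorBdd (C : CostModel) {α : Type*} (sz : α → ℕ)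
    (W : α → List (List ℕ × List (ℝ × List ℕ))) : Prop :=
  ∃ B : α → ℕ, PolyBdd sz B ∧ ∀ a, (W a).length ≤ B a ∧ ∀ t ∈ W a, t.1.length ≤ B a ∧
    (∀ v ∈ t.1, v ≤ B a) ∧ t.2.length ≤ B a ∧ ∀ u ∈ t.2, NumLE C (B a) u.1 ∧ u.2.length ≤ B a

theorem NumLE.selectNonzero {C : CostModel} {B : ℕ} {L : List (ℝ × List ℕ)}
    (h : ∀ u ∈ L, NumLE C B u.1 ∧ u.2.length ≤ B) :
    NumLE C B (selectNonzero L).1 ∧ (selectNonzero L).2.length ≤ B := by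
  rcases L.eq_nil_or_concat' with rfl | ⟨L', t, hL⟩
  · exact ⟨by simpa [ExchInference.selectNonzero] using
      NumLE.natCast (C := C) (B := B) (k := 0) (by simp), by simp [ExchInference.selectNonzero]⟩
  · exact h _ (selectNonzero_spec (by simp [hL])).1

namespace Comp

variable {C : CostModel} {α : Type*} {sz : α → ℕ} {i : α → Val}

theorem digitLists {B : α → List ℕ} {w : ℕ} (hB : Comp C sz i B) (lB : ∀ a, (B a).length ≤ w) :
    Comp C sz i fun a => digitLists (B a) := by
  have hlen : ∀ a j, (((B a).take j).foldl (fun O _ => O.map (List.cons 0) ++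
      O.map (List.cons 1)) [[]]).length ≤ 2 ^ w := fun a j => by
    have h := congrArg List.length (digitLists_eq ((B a).take j))
    rw [List.length_map, length_allBits] at h
    exact h.le.trans (Nat.pow_le_pow_right (by norm_num)
      ((List.length_take_le' _ _).trans (lB a)))
  refine foldl (f := fun _ (O : List (List ℕ)) (_ : ℕ) => O.map (List.cons 0) ++
    O.map (List.cons 1)) (fun _ O _ => O.length ≤ 2 ^ w) hB (cons nil nil)
    ((PolyBdd.const w).mono lB) (fun a j _ => hlen a j) ?_
  have bO : PolyBdd (fun x : {x : α × List (List ℕ) × ℕ // x.2.1.length ≤ 2 ^ w} => sz x.1.1)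
      fun x => x.1.2.1.length := (PolyBdd.const (2 ^ w)).mono fun x => x.2
  exact append (map (f := fun _ => List.cons 0) arg.fst bO (cons (constNat 0) arg))
    (map (f := fun _ => List.cons 1) arg.fst bO (cons (constNat 1) arg)) (by simpa using bO)

theorem selectNonzero {L : α → List (ℝ × List ℕ)} (hL : Comp C sz i L)
    (lL : PolyBdd sz fun a => (L a).length)
    (bL : ∃ B, PolyBdd sz B ∧ ∀ a, ∀ u ∈ L a, NumLE C (B a) u.1) :
    Comp C sz i fun a => selectNonzero (L a) := by
  classical
  obtain ⟨B, hB, bL⟩ := bL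
  have h0 : Comp C sz i fun _ => (0 : ℝ) := by simpa using constReal (C := C) 0
  refine (foldl (f := fun _ (s t : ℝ × List ℕ) => if decide (s.1 = 0) then t else s)
    (fun a s _ => NumLE C (B a) s.1) hL (h0.mk nil) lL (fun a j hj => ?_)
    (ite (eqReal arg.fst.fst (by simpa using constReal (C := C) 0)
      ⟨_, hB.reindex _, fun x => x.2⟩ (by simpa using NumBdd.of_polyBdd (C := C) (.const 0)))
      arg.snd arg.fst)).congr fun a => by simp [ExchInference.selectNonzero]
  have h1 : ∀ l : List (ℝ × List ℕ), (∀ u ∈ l, NumLE C (B a) u.1) → ∀ s : ℝ × List ℕ,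
      NumLE C (B a) s.1 →
      NumLE C (B a) (l.foldl (fun s t => if decide (s.1 = 0) then t else s) s).1 := by
    intro l
    induction l with
    | nil => exact fun _ s hs => hs
    | cons t l ih =>
      intro hl s hs
      refine ih (fun u hu => hl u (by simp [hu])) _ ?_
      dsimp only
      split_ifs
      · exact hl t (by simp)
      · exact hs
  exact h1 _ (fun u hu => bL a u (List.mem_of_mem_take hu)) _
    (by simpa using NumLE.natCast (C := C) (B := B a) (k := 0) (by simp))

theorem assignBlock {E B l : α → List ℕ} (hE : Comp C sz i E) (hB : Comp C sz i B)
    (hl : Comp C sz i l) (lE : PolyBdd sz fun a => (E a).length)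
    (lB : PolyBdd sz fun a => (B a).length) (ll : PolyBdd sz fun a => (l a).length)
    (bB : ∃ V, PolyBdd sz V ∧ ∀ a, ∀ v ∈ B a, v ≤ V a) :
    Comp C sz i fun a => assignBlock (E a) (B a) (l a) := by
  obtain ⟨V, hV, bB⟩ := bB
  refine foldl (f := fun a E (t : ℕ × ℕ) => E.set t.1 ((l a).getD t.2 0))
    (fun a E' t => E'.length = (E a).length ∧ t ∈ (B a).zipIdx) (hB.zipIdx lB) hE
    (by simpa using lB) (fun a j hj => ⟨?_, List.getElem_mem _⟩)
    (set arg.fst ((lE.reindex _).mono fun x => x.2.1.le) arg.snd.fst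
      ((hV.reindex _).mono fun x => bB _ _ (List.fst_mem_of_mem_zipIdx x.2.2))
      (getD (hl.env _) (ll.reindex _) arg.snd.snd ((lB.reindex _).mono fun x => ?_)
        (constNat 0)))
  · generalize (B a).zipIdx.take j = L
    generalize E a = E'
    induction L generalizing E' with
    | nil => rfl
    | cons t L ih => rw [List.foldl_cons, ih, List.length_set]
  · have := List.snd_lt_of_mem_zipIdx x.2.2
    omega

theorem selectAssignment {e : α → List ℕ} {W : α → List (List ℕ × List (ℝ × List ℕ))}
    (he : Comp C sz i e) (hW : Comp C sz i W) (le : PolyBdd sz fun a => (e a).length)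
    (bW : FactorBdd C sz W) : Comp C sz i fun a => selectAssignment (e a) (W a) := by
  obtain ⟨B, hB, bW⟩ := bW
  refine foldl (f := fun _ E (t : List ℕ × List (ℝ × List ℕ)) =>
      ExchInference.assignBlock E t.1 (ExchInference.selectNonzero t.2).2)
    (fun a E t => E.length = (e a).length ∧ t ∈ W a) hW he (hB.mono fun a => (bW a).1)
    (fun a j hj => ⟨?_, List.getElem_mem _⟩) ?_
  · generalize (W a).take j = L
    generalize e a = E'
    induction L generalizing E' with
    | nil => rfl
    | cons t L ih => rw [List.foldl_cons, ih, length_assignBlock]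
  · have hB' := hB.reindex fun x : {x : α × List ℕ × (List ℕ × List (ℝ × List ℕ)) //
      x.2.1.length = (e x.1).length ∧ x.2.2 ∈ W x.1} => x.1.1
    have row := fun x : {x : α × List ℕ × (List ℕ × List (ℝ × List ℕ)) //
      x.2.1.length = (e x.1).length ∧ x.2.2 ∈ W x.1} => (bW x.1.1).2 _ x.2.2
    exact assignBlock arg.fst arg.snd.fst (selectNonzero arg.snd.snd
        (hB'.mono fun x => (row x).2.2.1) ⟨_, hB', fun x u hu => ((row x).2.2.2 u hu).1⟩).snd
      ((le.reindex _).mono fun x => x.2.1.le) (hB'.mono fun x => (row x).1)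
      (hB'.mono fun x => (NumLE.selectNonzero (row x).2.2.2).2) ⟨_, hB', fun x => (row x).2.1⟩

theorem factorFormula {p : α → ℝ} {W : α → List (List ℕ × List (ℝ × List ℕ))}
    (hp : Comp C sz i p) (bp : NumBdd C sz p) (hW : Comp C sz i W) (bW : FactorBdd C sz W) :
    Comp C sz i (fun a => factorFormula (p a) (W a)) ∧
      NumBdd C sz fun a => ExchInference.factorFormula (p a) (W a) := by
  obtain ⟨B, hB, bW⟩ := bW
  have hB' := hB.reindex fun x : {x : α × (List ℕ × List (ℝ × List ℕ)) // x.2 ∈ W x.1} => x.1.1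
  have row := fun x : {x : α × (List ℕ × List (ℝ × List ℕ)) // x.2 ∈ W x.1} =>
    (bW x.1.1).2 _ x.2
  have lW := hB.mono fun a => (bW a).1
  have lq : PolyBdd sz fun a =>
      ((W a).map fun t => (ExchInference.selectNonzero t.2).1).length := by simpa using lW
  have ls : PolyBdd sz fun a => ((W a).map fun t => (t.2.map Prod.fst).sum).length := by
    simpa using lW
  have bq : ListNumBdd C sz fun a => (W a).map fun t => (ExchInference.selectNonzero t.2).1 :=
    ⟨B, hB, fun a x hx => by
      obtain ⟨t, ht, rfl⟩ := List.mem_map.1 hx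
      exact (NumLE.selectNonzero ((bW a).2 t ht).2.2.2).1⟩
  have bs : ListNumBdd C sz fun a => (W a).map fun t => (t.2.map Prod.fst).sum :=
    ⟨fun a => B a * (B a + 1), hB.mul (hB.add (.const 1)), fun a x hx => by
      obtain ⟨t, ht, rfl⟩ := List.mem_map.1 hx
      obtain ⟨-, -, h3, h4⟩ := (bW a).2 t ht
      refine (NumLE.list_sum (B := B a) fun y hy => ?_).mono (Nat.mul_le_mul_right _ ?_)
      · obtain ⟨u, hu, rfl⟩ := List.mem_map.1 hy
        exact (h4 u hu).1
      · simpa using h3⟩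
  have cq : Comp C sz i fun a => (W a).map fun t => (ExchInference.selectNonzero t.2).1 :=
    map (f := fun _ t => (ExchInference.selectNonzero t.2).1) hW lW
      (selectNonzero arg.snd (hB'.mono fun x => (row x).2.2.1)
        ⟨_, hB', fun x u hu => ((row x).2.2.2 u hu).1⟩).fst
  have cs : Comp C sz i fun a => (W a).map fun t => (t.2.map Prod.fst).sum := by
    have l2 := hB'.mono fun x => (row x).2.2.1
    refine map (f := fun _ t => (t.2.map Prod.fst).sum) hW lW
      (listSum (map (f := fun _ => Prod.fst) arg.snd l2 arg.fst) (by simpa using l2)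
        ⟨_, hB', fun x y hy => ?_⟩)
    obtain ⟨u, hu, rfl⟩ := List.mem_map.1 hy
    exact ((row x).2.2.2 u hu).1
  have nq := NumBdd.list_prod lq bq
  have ns := NumBdd.list_prod ls bs
  exact ⟨mulReal (divReal hp (listProd cq lq bq) bp nq) (listProd cs ls bs) (bp.div nq) ns,
    (bp.div nq).mul ns⟩

end Comp

section Model

variable {ι : Type*} {C : CostModel} {F : ι → Model}

/-- The `l`-th factor as a function of lists of digits `0` and `1`; the value is `0` if there is no
`l`-th block. -/
def onDigits {n : ℕ} {D : Blocks n} (Q : Fin D.length → List Bool → ℝ) (l : ℕ) (b : List ℕ) : ℝ :=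
  if h : l < D.length then Q ⟨l, h⟩ (b.map fun t => decide (t = 1)) else 0

theorem map_toNat_map_decide (b : List Bool) :
    (b.map Bool.toNat).map (fun t => decide (t = 1)) = b := by
  induction b with
  | nil => rfl
  | cons t b ih => cases t <;> simp_all

theorem enc_map_toNat (b : List Bool) : enc (b.map Bool.toNat) = encList encBool b := by
  change encList encNat _ = _
  induction b with
  | nil => rfl
  | cons t b ih =>
    rw [List.map_cons, encList, encList, ih]
    cases t <;> simp [encNat, encBool]

theorem factorTable_eq_map {n : ℕ} (D : Blocks n) (Q : Fin D.length → List Bool → ℝ) :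
    factorTable D Q = (D.map (List.map Fin.val)).zipIdx.map fun t =>
      (t.1, (digitLists t.1).map fun b => (onDigits Q t.2 b, b)) := by
  refine List.ext_getElem (by simp [factorTable]) fun j hj1 hj2 => ?_
  have hj : j < D.length := by simpa [factorTable] using hj1
  simp [factorTable, digitLists_eq, onDigits, hj, Function.comp_def]

theorem yProbComp_of_independent (hZ : EffIndependentlyDecomposable C F) (hPr : EffProb C F) :
    YProbComp C F := by
  obtain ⟨w, D, Q, hD, cD, cQ⟩ := hZ
  let sz : YAssignment F → ℕ := fun a => (F a.1).n
  let i : YAssignment F → Val := fun a => .pair (F a.1).input (encEvidence a.2.1)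
  let Dn : YAssignment F → List (List ℕ) := fun a => (D a).map (List.map Fin.val)
  have hDn : Comp C sz i Dn := cD.comp fun a => enc_blocks _
  have lDn : PolyBdd sz fun a => (Dn a).length :=
    PolyBdd.self.mono fun a => by simpa [Dn] using (hD a).1.1.length_le
  have bQ := PolyTime.numBdd cQ
  have cQ := PolyTime.comp (x := fun a : (Σ a : YAssignment F, Σ l : Fin (D a).length,
    {b : List Bool // b.length = ((D a).get l).length}) => Q a.1 a.2.1 a.2.2.1) cQ fun _ => rfl
  have item : ∀ a, ∀ t ∈ (Dn a).zipIdx, ∃ h : t.2 < (D a).length,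
      t.1 = ((D a).get ⟨t.2, h⟩).map Fin.val := fun a t ht => by
    have h1 := List.snd_lt_of_mem_zipIdx ht
    have h2 := List.fst_eq_of_mem_zipIdx ht
    have h3 : t.2 < (D a).length := by simpa [Dn] using h1
    exact ⟨h3, by simpa [Dn] using h2⟩
  have hW : Comp C sz i fun a => factorTable (D a) (Q a) := by
    refine Comp.congr (Comp.map (f := fun a (t : List ℕ × ℕ) =>
      (t.1, (digitLists t.1).map fun b => (onDigits (Q a) t.2 b, b))) (hDn.zipIdx lDn)
        (by simpa using lDn) (Comp.mk Comp.arg.fst ?_)) fun a => (factorTable_eq_map _ _).symm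
    have hw : ∀ x : {x : YAssignment F × List ℕ × ℕ // x.2 ∈ (Dn x.1).zipIdx},
        x.1.2.1.length ≤ w := fun x => by
      obtain ⟨h, h'⟩ := item x.1.1 x.1.2 x.2
      rw [h', List.length_map]
      exact (hD x.1.1).2 _ (List.get_mem _ _)
    refine Comp.map (f := fun (x : {x : YAssignment F × List ℕ × ℕ // x.2 ∈ (Dn x.1).zipIdx}) b =>
      (onDigits (Q x.1.1) x.1.2.2 b, b)) (Comp.digitLists Comp.arg.fst hw)
      ((PolyBdd.const (2 ^ w)).mono fun x => ?_) (Comp.mk ?_ Comp.arg)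
    · rw [digitLists_eq, List.length_map, length_allBits]
      exact Nat.pow_le_pow_right (by norm_num) (hw x)
    · -- Each item is a block index with the digits of an assignment to the block, which is an
      -- instance of the program for the factors.
      have hb : ∀ y : {y : {x : YAssignment F × List ℕ × ℕ // x.2 ∈ (Dn x.1).zipIdx} × List ℕ //
          y.2 ∈ digitLists y.1.1.2.1}, ∃ b : List Bool, b.length = y.1.1.1.2.1.length ∧
            b.map Bool.toNat = y.1.2 := fun y => by
        have h := y.2
        rw [digitLists_eq] at h
        obtain ⟨b, hb, he⟩ := List.mem_map.1 h
        exact ⟨b, mem_allBits.1 hb, he⟩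
      choose b hlen hb using hb
      let g : {y : {x : YAssignment F × List ℕ × ℕ // x.2 ∈ (Dn x.1).zipIdx} × List ℕ //
          y.2 ∈ digitLists y.1.1.2.1} → Σ a : YAssignment F, Σ l : Fin (D a).length,
            {b : List Bool // b.length = ((D a).get l).length} := fun y =>
        ⟨y.1.1.1.1, ⟨y.1.1.1.2.2, (item _ _ y.1.1.2).1⟩, ⟨b y, by
          rw [hlen y, (item _ _ y.1.1.2).2, List.length_map]⟩⟩
      refine ((cQ.reindex g).comp (Comp.mkVal (Comp.fstVal (Comp.fstVal Comp.id))
        (Comp.mkVal ?_ ?_))).congr fun y => ?_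
      · exact (Comp.snd (x := fun y : {y : {x : YAssignment F × List ℕ × ℕ //
          x.2 ∈ (Dn x.1).zipIdx} × List ℕ // y.2 ∈ digitLists y.1.1.2.1} => y.1.1.1.2)
          (Comp.sndVal (Comp.fstVal Comp.id))).toVal
      · exact (Comp.sndVal Comp.id).congr fun y => by rw [← enc_map_toNat, hb]
      · rw [← hb y, onDigits, dif_pos (item _ _ y.1.1.2).1, map_toNat_map_decide]
  have bW : FactorBdd C sz fun a => factorTable (D a) (Q a) := by
    obtain ⟨B, ⟨q, hq⟩, hB⟩ := bQ
    obtain ⟨K, hK⟩ : ∃ K, K = 2 ^ w := ⟨_, rfl⟩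
    refine ⟨fun a => q.eval (sz a) + sz a + w + K, (((PolyBdd.mono ⟨q, fun _ => le_rfl⟩
      fun a => le_rfl).add .self).add (.const w)).add (.const K), fun a => ⟨?_, ?_⟩⟩
    · have := (hD a).1.1.length_le
      simp only [factorTable, List.length_ofFn]
      dsimp only [sz]
      omega
    · intro t ht
      obtain ⟨l, rfl⟩ := (List.mem_ofFn' _ _).1 ht
      have hl := (hD a).2 _ (List.get_mem (D a) l)
      refine ⟨?_, fun v hv => ?_, ?_, fun u hu => ?_⟩
      · rw [List.length_map]
        dsimp only [sz]
        omega
      · obtain ⟨v, -, rfl⟩ := List.mem_map.1 hv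
        have := v.2
        dsimp only [sz]
        omega
      · rw [List.length_map, length_allBits]
        have := Nat.pow_le_pow_right (n := 2) (by norm_num) hl
        dsimp only [sz]
        omega
      · obtain ⟨b, hb, rfl⟩ := List.mem_map.1 hu
        have hb := mem_allBits.1 hb
        refine ⟨(hB ⟨a, l, ⟨b, hb⟩⟩).mono ?_, ?_⟩
        · have := hq ⟨a, l, ⟨b, hb⟩⟩
          dsimp only [sz] at this
          dsimp only [sz]
          omega
        · rw [List.length_map]
          dsimp only [sz]
          omega
  have spec := fun a : YAssignment F => factorFormula_spec a.2.2 (hD a).1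
  choose x hx hval using spec
  let g : YAssignment F → Σ i, Assignment (F i).n := fun a => ⟨a.1, x a⟩
  have cp := (PolyTime.comp (x := fun a : Σ i, Assignment (F i).n => (F a.1).prob a.2) hPr
    fun _ => rfl).reindex g
  have bp : NumBdd C sz fun a => (F a.1).prob (x a) := (PolyTime.numBdd hPr).reindex g
  have hsel := Comp.selectAssignment (Comp.evidence (fun a : YAssignment F => a.1)
    fun a => a.2.1) hW (by simpa using PolyBdd.self) bW
  have hp : Comp C sz i fun a => (F a.1).prob (x a) :=
    cp.comp (Comp.mkVal (Comp.fstVal Comp.id) (hsel.toVal.congr fun a => by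
      rw [hx, enc_evList_some]))
  have h := Comp.factorFormula hp bp hW bW
  simp only [hval] at h
  exact h

end Model

/-! ### Marginal and MPE inference -/

/-- The pair with the largest first component. The starting value `-1` is below all
probabilities. -/
noncomputable def bestPair (L : List (ℝ × List ℕ)) : ℝ × List ℕ :=
  L.foldl (fun s t => if s.1 < t.1 then t else s) (-1, [])

theorem bestPair_mem_or (L : List (ℝ × List ℕ)) :
    (bestPair L = (-1, []) ∨ bestPair L ∈ L) ∧ ∀ t ∈ L, t.1 ≤ (bestPair L).1 := by
  unfold bestPair
  induction L using List.reverseRecOn with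
  | nil => simp
  | append_singleton L t ih =>
    rw [List.foldl_append, List.foldl_cons, List.foldl_nil]
    obtain ⟨h1, h2⟩ := ih
    split_ifs with h
    · refine ⟨.inr (by simp), fun s hs => ?_⟩
      rcases List.mem_append.1 hs with hs | hs
      · exact (h2 s hs).trans h.le
      · rw [List.mem_singleton.1 hs]
    · refine ⟨h1.imp_right fun h1 => List.mem_append_left _ h1, fun s hs => ?_⟩
      rcases List.mem_append.1 hs with hs | hs
      · exact h2 s hs
      · rw [List.mem_singleton.1 hs]
        exact not_lt.1 h

theorem Comp.bestPair {C : CostModel} {α : Type*} {sz : α → ℕ} {i : α → Val}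
    {L : α → List (ℝ × List ℕ)} (hL : Comp C sz i L) (lL : PolyBdd sz fun a => (L a).length)
    (bL : NumBdd C (fun x : {x : α × ℝ × List ℕ // x.2 ∈ L x.1} => sz x.1.1) fun x => x.1.2.1) :
    Comp C sz i fun a => bestPair (L a) := by
  classical
  obtain ⟨B, ⟨q, hq⟩, hB⟩ := bL
  have bL : ∀ a, ∀ t ∈ L a, NumLE C (q.eval (sz a)) t.1 := fun a t ht =>
    (hB ⟨(a, t), ht⟩).mono (hq ⟨(a, t), ht⟩)
  have h0 : Comp C sz i fun _ => (-1 : ℝ) := by simpa using constReal (C := C) (-1)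
  have hq' : PolyBdd (fun x : {x : α × (ℝ × List ℕ) × ℝ × List ℕ //
      (x.2.1 = (-1, []) ∨ x.2.1 ∈ L x.1) ∧ x.2.2 ∈ L x.1} => sz x.1.1)
      fun x => q.eval (sz x.1.1) := ⟨q, fun _ => le_rfl⟩
  refine (foldl (f := fun _ (s t : ℝ × List ℕ) => if decide (s.1 < t.1) then t else s)
    (fun a s t => (s = (-1, []) ∨ s ∈ L a) ∧ t ∈ L a) hL (h0.mk nil) lL
    (fun a j hj => ⟨?_, List.getElem_mem hj⟩)
    (ite (ltReal arg.fst.fst arg.snd.fst ⟨_, hq', fun x => ?_⟩ ⟨_, hq', fun x => bL _ _ x.2.2⟩)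
      arg.snd arg.fst)).congr fun a => by simp [ExchInference.bestPair]
  · have := (bestPair_mem_or ((L a).take j)).1.imp_right fun h => List.mem_of_mem_take h
    simpa [ExchInference.bestPair] using this
  · dsimp only
    rcases x.2.1 with h | h
    · rw [h]
      simpa using (NumLE.natCast (C := C) (B := q.eval (sz x.1.1)) (k := 1)
        Nat.one_le_two_pow).neg
    · exact bL _ _ h

/-- A list of representatives with computable values. -/
theorem Comp.scored {C : CostModel} {α : Type*} {sz : α → ℕ} {i : α → Val}
    {T : α → List Row} {G : α → List ℕ → ℝ} (hT : Comp C sz i T)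
    (lT : PolyBdd sz fun a => (T a).length)
    (hG : Comp C (fun x : {x : α × Row // x.2 ∈ T x.1} => sz x.1.1)
      (fun x => .pair (i x.1.1) (enc x.1.2.2.2.2)) fun x => G x.1.1 x.1.2.2.2.2) :
    Comp C sz i fun a => (T a).map fun r => (G a r.2.2.2, r.2.2.2) :=
  map (f := fun a r => (G a r.2.2.2, r.2.2.2)) hT lT
    (mk (hG.comp (mkVal (fstVal id) arg.snd.snd.snd.toVal)) arg.snd.snd.snd)

section Model

variable {ι : Type*} {C : CostModel} {F : ι → Model}

theorem override_eq_restrict_Y {M : Model} {e : Evidence M.n} (he : e.dom ⊆ M.Y)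
    {x : Assignment M.n} (hx : Agrees x e) {L : List (Fin M.n)} (hL : L.toFinset = M.Y) :
    override e x L = restrict x M.Y := by
  rw [override_eq_restrict hx hL, Finset.union_eq_right.2 he]

theorem IsExchangeableGiven.prEv_restrict_eq {n N : ℕ} {prob : Assignment n → ℝ}
    {S : Finset (Fin n)} {D : Blocks n} (h : IsExchangeableGiven prob (Evidence.empty n) S D)
    (hN : n < N) {x x' : Assignment n} (hk : key N D x' = key N D x) :
    prEv prob (restrict x' S) = prEv prob (restrict x S) := by
  have := h.prEv_eq hN (x := x) (x' := x') (fun _ => .inl rfl) (fun _ => .inl rfl) hk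
  have he : (Evidence.empty n).dom = ∅ := by simp [Evidence.dom, Evidence.empty]
  simpa [he] using this

/-- The table of orbits of the assignments to `Y` that agree with the evidence. -/
def yTable (a : YEvidence F) : List Row :=
  orbitTable ((F a.1).n + 1) (evList a.2.1) ((F a.1).blocksY.map (List.map Fin.val))

theorem comp_yTable (hY : MarginallyExchangeableBdd F) :
    Comp C (fun a : YEvidence F => (F a.1).n)
      (fun a => .pair (F a.1).input (encEvidence a.2.1)) yTable ∧
    TableBdd (fun a : YEvidence F => (F a.1).n) yTable := by
  obtain ⟨w, hY⟩ := hY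
  exact Comp.modelTable (fun a : YEvidence F => a.1) (fun a => a.2.1) (fun a => (F a.1).blocksY)
    (fun a => (hY a.1).1.1.length_le) (fun a => (hY a.1).2) (Comp.blocksY _)

theorem yTable_mem (hY : MarginallyExchangeableBdd F) (a : YEvidence F) {r : Row}
    (hr : r ∈ yTable a) : ∃ x, Agrees x a.2.1 ∧ r.1 = key ((F a.1).n + 1) (F a.1).blocksY x ∧
      r.2.2.2 = evList (restrict x (F a.1).Y) := by
  obtain ⟨w, hY⟩ := hY
  obtain ⟨x, hx, hk, hE⟩ := (orbitTable_spec ((F a.1).n + 1) a.2.1 (F a.1).blocksY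
    (hY a.1).1.1.1).1 r hr
  exact ⟨x, hx, hk, by rw [hE, override_eq_restrict_Y a.2.2 hx (hY a.1).1.1.2.1]⟩

/-- The rows contain assignments to all of `Y`, to which the program for `Pr(y)` applies. -/
theorem comp_listPr_yTable (hY : MarginallyExchangeableBdd F) (hPr : YProbComp C F) :
    Comp C (fun x : {x : YEvidence F × Row // x.2 ∈ yTable x.1} => (F x.1.1.1).n)
      (fun x => .pair (.pair (F x.1.1.1).input (encEvidence x.1.1.2.1)) (enc x.1.2.2.2.2))
      (fun x => listPr (F x.1.1.1).prob x.1.2.2.2.2) ∧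
    NumBdd C (fun x : {x : YEvidence F × Row // x.2 ∈ yTable x.1} => (F x.1.1.1).n)
      fun x => listPr (F x.1.1.1).prob x.1.2.2.2.2 := by
  choose z hz using fun x : {x : YEvidence F × Row // x.2 ∈ yTable x.1} => yTable_mem hY x.1.1 x.2
  let g : {x : YEvidence F × Row // x.2 ∈ yTable x.1} → YAssignment F := fun x =>
    ⟨x.1.1.1, ⟨restrict (z x) (F x.1.1.1).Y, dom_restrict _ _⟩⟩
  have hval : ∀ x, prEv (F (g x).1).prob (g x).2.1 =
      listPr (F x.1.1.1).prob x.1.2.2.2.2 := fun x => by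
    rw [(hz x).2.2, listPr_evList]
  refine ⟨((hPr.1.reindex g).congr hval).comp (Comp.mkVal (Comp.fstVal (Comp.fstVal Comp.id))
    ((Comp.sndVal Comp.id).congr fun x => ?_)), ?_⟩
  · rw [(hz x).2.2, enc_evList]
  · obtain ⟨B, hB, hb⟩ := hPr.2.reindex g
    exact ⟨B, hB, fun x => by simpa only [← hval] using hb x⟩

theorem marginalPolyTime (hY : MarginallyExchangeableBdd F) (hPr : YProbComp C F) :
    MarginalPolyTime C F := by
  obtain ⟨h1, h2⟩ := comp_yTable (C := C) hY
  obtain ⟨h3, h4⟩ := comp_listPr_yTable hY hPr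
  have h := Comp.weightedSum (G := fun a => listPr (F a.1).prob) h1 h2 h3 h4
  have hsum : ∀ a : YEvidence F, ((yTable a).map fun r =>
      (r.2.2.1 : ℝ) * listPr (F a.1).prob r.2.2.2).sum = prEv (F a.1).prob a.2.1 := fun a => by
    obtain ⟨w, hY⟩ := hY
    refine (orbitTable_spec ((F a.1).n + 1) a.2.1 (F a.1).blocksY (hY a.1).1.1.1).2.2
      (F a.1).prob (listPr (F a.1).prob) (listPr_evList _) fun x x' hx hx' hk => ?_
    rw [override_eq_restrict_Y a.2.2 hx (hY a.1).1.1.2.1,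
      override_eq_restrict_Y a.2.2 hx' (hY a.1).1.1.2.1]
    exact (hY a.1).1.prEv_restrict_eq (Nat.lt_succ_self _) hk
  simp only [hsum] at h
  obtain ⟨B, hB, hb⟩ := h.2
  exact h.1.toVal.polyTime ⟨_, ((PolyBdd.const 2).mul hB).add (.const 3),
    fun a => size_num_le (hb a)⟩ fun a => rfl

/-- The representatives of the orbits with their probabilities. -/
noncomputable def yCandidates (a : YEvidence F) : List (ℝ × List ℕ) :=
  (yTable a).map fun r => (listPr (F a.1).prob r.2.2.2, r.2.2.2)

theorem comp_bestPair_yCandidates (hY : MarginallyExchangeableBdd F) (hPr : YProbComp C F) :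
    Comp C (fun a : YEvidence F => (F a.1).n)
      (fun a => .pair (F a.1).input (encEvidence a.2.1)) fun a => bestPair (yCandidates a) := by
  obtain ⟨h1, h2⟩ := comp_yTable (C := C) hY
  obtain ⟨h3, h4⟩ := comp_listPr_yTable hY hPr
  have lT : PolyBdd (fun a : YEvidence F => (F a.1).n) fun a => (yTable a).length := by
    obtain ⟨B, hB, hb⟩ := h2
    exact hB.mono fun a => (hb a).1
  have hL := Comp.scored (G := fun a : YEvidence F => listPr (F a.1).prob) h1 lT h3
  have bL : NumBdd C (fun x : {x : YEvidence F × ℝ × List ℕ // x.2 ∈ yCandidates x.1} =>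
      (F x.1.1.1).n) fun x => x.1.2.1 := by
    obtain ⟨B, ⟨q, hq⟩, hb⟩ := h4
    refine ⟨fun x => q.eval (F x.1.1.1).n, ⟨q, fun _ => le_rfl⟩, fun x => ?_⟩
    obtain ⟨r, hr, he⟩ := List.mem_map.1 x.2
    dsimp only
    rw [← he]
    exact (hb ⟨(x.1.1, r), hr⟩).mono (hq ⟨(x.1.1, r), hr⟩)
  exact Comp.bestPair hL (by simpa [yCandidates] using lT) bL

/-- All assignments to `Y` that agree with the evidence are equivalent to a candidate, so that a
best candidate is a most probable explanation. -/
theorem bestPair_yCandidates_spec (hY : MarginallyExchangeableBdd F) (a : YEvidence F) :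
    ∃ y : Evidence (F a.1).n, (y.dom = (F a.1).Y ∧ Extends y a.2.1 ∧
      ∀ y' : Evidence (F a.1).n, y'.dom = (F a.1).Y → Extends y' a.2.1 →
        prEv (F a.1).prob y' ≤ prEv (F a.1).prob y) ∧
      (bestPair (yCandidates a)).2 = evList y := by
  have hY' := hY
  obtain ⟨w, hw⟩ := hY
  have hspec := (orbitTable_spec ((F a.1).n + 1) a.2.1 (F a.1).blocksY (hw a.1).1.1.1).2.1
  have hnonneg : ∀ y : Evidence (F a.1).n, 0 ≤ prEv (F a.1).prob y := fun y =>
    Finset.sum_nonneg fun x _ => (F a.1).prob_mem.1 x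
  have hrow : ∀ t ∈ yCandidates a, ∃ x, Agrees x a.2.1 ∧
      t = (prEv (F a.1).prob (restrict x (F a.1).Y), evList (restrict x (F a.1).Y)) := by
    intro t ht
    obtain ⟨r, hr, rfl⟩ := List.mem_map.1 ht
    obtain ⟨x, hx, -, hE⟩ := yTable_mem hY' a hr
    exact ⟨x, hx, by rw [hE, listPr_evList]⟩
  obtain ⟨hmem, hmax⟩ := bestPair_mem_or (yCandidates a)
  have hmem : bestPair (yCandidates a) ∈ yCandidates a := by
    -- The table is not empty, and probabilities exceed `-1`.
    refine hmem.resolve_left fun hbad => ?_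
    obtain ⟨x, hx⟩ := exists_agrees a.2.1
    obtain ⟨r, hr, -⟩ := hspec x hx
    have hrL : (listPr (F a.1).prob r.2.2.2, r.2.2.2) ∈ yCandidates a := List.mem_map.2 ⟨r, hr, rfl⟩
    obtain ⟨z, -, hz⟩ := hrow _ hrL
    have h := hmax _ hrL
    rw [hbad, hz] at h
    have := hnonneg (restrict z (F a.1).Y)
    simp only at h
    linarith
  obtain ⟨x, hx, hbx⟩ := hrow _ hmem
  refine ⟨restrict x (F a.1).Y, ⟨dom_restrict _ _, fun i => ?_, fun y' hy' he' => ?_⟩,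
    by rw [hbx]⟩
  · by_cases hi : i ∈ (F a.1).Y
    · simpa [restrict, hi] using hx i
    · refine .inl ?_
      by_contra h0
      exact hi (a.2.2 (by simpa [Evidence.dom, Option.isSome_iff_ne_none] using h0))
  · obtain ⟨x', hx'⟩ := exists_agrees y'
    have hagr : Agrees x' a.2.1 := fun i => by
      rcases he' i with h | h
      · exact .inl h
      · rw [h]; exact hx' i
    have hyr : y' = restrict x' (F a.1).Y := by
      funext i
      by_cases hi : i ∈ (F a.1).Y
      · have hne : y' i ≠ none := by
          rw [← hy'] at hi
          simpa [Evidence.dom, Option.isSome_iff_ne_none] using hi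
        simpa [restrict, hi] using (hx' i).resolve_left hne
      · have : y' i = none := by
          rw [← hy'] at hi
          simpa [Evidence.dom, Option.isSome_iff_ne_none] using hi
        simp [restrict, hi, this]
    obtain ⟨r, hr, hk⟩ := hspec x' hagr
    obtain ⟨z, hz, hkz, hE⟩ := yTable_mem hY' a hr
    have hrL : (listPr (F a.1).prob r.2.2.2, r.2.2.2) ∈ yCandidates a := List.mem_map.2 ⟨r, hr, rfl⟩
    have h := hmax _ hrL
    rw [hE, listPr_evList, hbx] at h
    rw [hyr, (hw a.1).1.prEv_restrict_eq (Nat.lt_succ_self _) (hk.symm.trans hkz)]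
    exact h

theorem mpePolyTime (hY : MarginallyExchangeableBdd F) (hPr : YProbComp C F) :
    MPEPolyTime C F := by
  choose y hy hbest using fun a : YEvidence F => bestPair_yCandidates_spec hY a
  refine ((comp_bestPair_yCandidates hY hPr).snd.toVal).polyTime
    ⟨fun a => 6 * (F a.1).n + 3, ((PolyBdd.const 6).mul .self).add (.const 3), fun a => ?_⟩
    fun a => ⟨y a, (hy a).1, (hy a).2.1, (hy a).2.2, ?_⟩
  · rw [hbest]
    exact size_evList_le C _
  · rw [hbest, enc_evList]

end Model

end ExchInference

theorem mainTheorem3 {ι : Type*} (C : CostModel) (F : ι → Model)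
    (hY : MarginallyExchangeableBdd F)
    (hZ : EffExchangeablyDecomposable C F ∨ EffIndependentlyDecomposable C F)
    (hPr : EffProb C F) :
    MPEPolyTime C F ∧ MarginalPolyTime C F := by
  have h : YProbComp C F := hZ.elim (fun h => yProbComp_of_exchangeable h hPr)
    fun h => yProbComp_of_independent h hPr
  exact ⟨mpePolyTime hY h, marginalPolyTime hY h⟩
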